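/- **Setting.** Let $S\subseteq\mathbb R^D$ be measurable (the integration region; $\int dx$ means $\int_S dx$). For each component $j=1,\dots,C$ let $\phi_{j,p}$, $p\in\mathbb M_j$, be finitely many functions in $L^2(S)\cap L^4(S)$, orthonormal in $L^2(S)$ for each fixed $j$. Let $a_{j,p}$ be independent bosonic annihilation operators on the Fock space $\mathcal H=\bigotimes_j\mathcal H_{\mathbb M_j}$ of these modes, and put $\tilde\Psi_j(x)=\sum_{p}\phi_{j,p}(x)\,a_{j,p}$ and $\tilde\delta_j(x)=\sum_p|\phi_{j,p}(x)|^2$. Operators are described by their matrix elements between occupation-number states. For amplitudes $\alpha=(\alpha_{j,p})$ and $\lambda=(\lambda_{j,p})$ write $\Psi_j=\sum_p\phi_{j,p}\alpha_{j,p}$ and $\Lambda_j=\sum_p\phi_{j,p}\lambda_{j,p}$; functionals of $\Psi,\Psi^*$ are functions of $\alpha$. With Wirtinger derivatives, $$\frac{\delta}{\delta\Psi_j(x)}=\sum_p\phi_{j,p}(x)^*\frac{\partial}{\partial\alpha_{j,p}},\qquad \frac{\delta}{\delta\Psi_j^*(x)}=\sum_p\phi_{j,p}(x)\frac{\partial}{\partial\alpha_{j,p}^*}.$$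 The functional Wigner transform of an operator $T$ on $\mathcal H$ is $$\mathcal W[T](\alpha)=\frac1{\pi^{2\sum_j|\mathbb M_j|}}\int d^2\lambda\,\Big(\prod_j e^{\int dx(-\Lambda_j\Psi_j^*+\Lambda_j^*\Psi_j)}\Big)\,\mathrm{Tr}\Big\{T\prod_j e^{\int dx(\Lambda_j\tilde\Psi_j^\dagger-\Lambda_j^*\tilde\Psi_j)}\Big\}.$$ Fix components $j,k$ (possibly equal, no summation), let $Q_{jk}=\int dx\,\tilde\Psi_j^\dagger\tilde\Psi_k^\dagger\tilde\Psi_j\tilde\Psi_k$, and let $\mathcal L_x$ be the differential operator (all functions evaluated at $x$, all derivatives acting on everything to their right) $$\begin{aligned}\mathcal L_x={}&\frac{\delta}{\delta\Psi_j}\Big(-\Psi_j\Psi_k\Psi_k^*+\frac{\tilde\delta_k}2(\delta_{jk}\Psi_k+\Psi_j)\Big)+\frac{\delta}{\delta\Psi_j^*}\Big(\Psi_j^*\Psi_k\Psi_k^*-\frac{\tilde\delta_k}2(\delta_{jk}\Psi_k^*+\Psi_j^*)\Big)\\&+\frac{\delta}{\delta\Psi_k}\Big(-\Psi_j\Ps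i_j^*\Psi_k+\frac{\tilde\delta_j}2(\delta_{jk}\Psi_j+\Psi_k)\Big)+\frac{\delta}{\delta\Psi_k^*}\Big(\Psi_j\Psi_j^*\Psi_k^*-\frac{\tilde\delta_j}2(\delta_{jk}\Psi_j^*+\Psi_k^*)\Big)\\&+\frac{\delta}{\delta\Psi_j}\frac{\delta}{\delta\Psi_j^*}\frac{\delta}{\delta\Psi_k}\frac14\Psi_k-\frac{\delta}{\delta\Psi_j}\frac{\delta}{\delta\Psi_j^*}\frac{\delta}{\delta\Psi_k^*}\frac14\Psi_k^*+\frac{\delta}{\delta\Psi_k}\frac{\delta}{\delta\Psi_k^*}\frac{\delta}{\delta\Psi_j}\frac14\Psi_j-\frac{\delta}{\delta\Psi_k}\frac{\delta}{\delta\Psi_k^*}\frac{\delta}{\delta\Psi_j^*}\frac14\Psi_j^*.\end{aligned}$$ **Theorem.** Let $A$ be a bounded operator on $\mathcal H$. 1. If the matrix elements $\langle m|A|n\rangle$ decay faster than every power of the particle numbers (equivalently, all products of $A$ with creation and annihilation operators on both sides are Hilbert–Schmidt), then the traces and integrals defining $\mathcal W[A]$ and $\mathcal W[[Q_{jk},A]]$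 converge absolutely, $\mathcal W[A]$ is smooth, and for every $\alpha$ the integral below converges absolutely and $$\mathcal W\big[[Q_{jk},A]\big](\alpha)=\int dx\,\big(\mathcal L_x\,\mathcal W[A]\big)(\alpha).$$ 2. Let $A$ be any Hilbert–Schmidt operator, and for an operator $T$ let $T_R$ be its compression to the states with at most $R$ particles. Then $\mathcal W[A_R]$ converges in $L^2$, as $R\to\infty$, to a function $w$, which is taken as $\mathcal W[A]$ (and which agrees almost everywhere with the integral formula for $A$ as in 1), and $\mathcal W[[Q_{jk},A]_R]$ converges in the sense of tempered distributions to a tempered distribution, which is taken as $\mathcal W[[Q_{jk},A]]$. The same formula holds for these, with derivatives in the sense of distributions: for every Schwartz function $f$, the integral below converges absolutely and $$\big\langle\mathcal W\big[[Q_{jk},A]\big],f\big\rangle=\int dx\,\big\langle\mathcal L_x\,\mathcal W[A],f\big\rangle .$$ -/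

import Mathlib

open MeasureTheory Filter Topology
open scoped ENNReal ContDiff ComplexConjugate LineDeriv SchwartzMap

noncomputable section

namespace FunctionalWigner

/-! ### Operators on Fock space as matrices in the occupation-number basis

An operator is described by its matrix elements `K m n = ⟨m|K|n⟩` between occupation-number states.
This covers unbounded operators such as field operators, whose rows and columns are finite. -/

/-- Matrix elements `⟨m|K|n⟩` with respect to an orthonormal basis labelled by `O`. -/
abbrev Kernel (O : Type) := O → O → ℂ

variable {O : Type}

/-- The product of operators: `⟨m|K L|n⟩ = ∑ l, ⟨m|K|l⟩ ⟨l|L|n⟩`. -/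
def opMul (K L : Kernel O) : Kernel O := fun m n => ∑' l, K m l * L l n

/-- The Hermitian adjoint. -/
def opAdj (K : Kernel O) : Kernel O := fun m n => conj (K n m)

/-- The commutator `[K, L]`. -/
def opComm (K L : Kernel O) : Kernel O := opMul K L - opMul L K

/-- The trace. -/
def opTrace (K : Kernel O) : ℂ := ∑' n, K n n

/-- The powers of an operator. -/
def opPow [DecidableEq O] (K : Kernel O) : ℕ → Kernel O
  | 0 => fun m n => if m = n then 1 else 0
  | r + 1 => opMul K (opPow K r)

/-- The exponential `∑ r, K ^ r / r!`, taken between occupation-number states (these are analytic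
vectors for the generators of displacements, so for them this is the unitary group). -/
def opExp [DecidableEq O] (K : Kernel O) : Kernel O :=
  fun m n => ∑' r : ℕ, opPow K r m n / (r.factorial : ℂ)

/-! ### One component -/

/-- Configuration space `ℝ^D`. -/
abbrev Space (D : ℕ) := EuclideanSpace ℝ (Fin D)

variable {D N : ℕ}

/-- Occupation numbers of `N` bosonic modes. -/
abbrev Occ (N : ℕ) := Fin N → ℕ

/-- The annihilation operator of mode `p`: `a_p |n⟩ = √(n_p) |n - e_p⟩`. -/
def annihilation (p : Fin N) : Kernel (Occ N) :=
  fun m n => if n = m + Pi.single p 1 then (Real.sqrt (n p) : ℂ) else 0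

/-- The restricted field operator `Ψ̃(x) = ∑ p, φ_p(x) a_p` of one component. -/
def fieldOp (φ : Fin N → Space D → ℂ) (x : Space D) : Kernel (Occ N) :=
  ∑ p, φ p x • annihilation p

/-- The function `∑ p, φ_p α_p` of the restricted function space with mode amplitudes `α`. -/
def compose (φ : Fin N → Space D → ℂ) (α : Fin N → ℂ) (x : Space D) : ℂ :=
  ∑ p, φ p x * α p

/-- The restricted delta function `δ_𝕄(x', x) = ∑ p, φ_p(x')^* φ_p(x)`. -/
def restrictedDelta (φ : Fin N → Space D → ℂ) (x' x : Space D) : ℂ :=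
  ∑ p, conj (φ p x') * φ p x

/-- The displacement operator `D̂[Λ, Λ^*] = exp ∫ dx (Λ Ψ̃† - Λ^* Ψ̃)` of one component, for the
function `Λ` with mode amplitudes `l`. -/
def displacementOp (S : Set (Space D)) (φ : Fin N → Space D → ℂ) (l : Fin N → ℂ) :
    Kernel (Occ N) :=
  opExp fun m n => ∫ x in S,
    (compose φ l x * opAdj (fieldOp φ x) m n - conj (compose φ l x) * fieldOp φ x m n)

/-- The displacement functional `D[Λ, Λ^*, Ψ, Ψ^*] = exp ∫ dx (-Λ Ψ^* + Λ^* Ψ)`, for the functions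
`Λ`, `Ψ` with mode amplitudes `l`, `α`. -/
def displacementFunctional (S : Set (Space D)) (φ : Fin N → Space D → ℂ) (l α : Fin N → ℂ) : ℂ :=
  Complex.exp (∫ x in S,
    (-compose φ l x * conj (compose φ α x) + conj (compose φ l x) * compose φ α x))

/-! ### Several components -/

variable {C : ℕ} {M : Fin C → ℕ}

/-- Occupation numbers of all modes: component `j` has `M j` modes. -/
abbrev MultiOcc (M : Fin C → ℕ) := (j : Fin C) → Occ (M j)

/-- The bosonic Fock space of all restricted modes. -/
abbrev Fock (M : Fin C → ℕ) := lp (fun _ : MultiOcc M => ℂ) 2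

/-- Mode amplitudes of a tuple `Ψ = (Ψ_1, …, Ψ_C)` of restricted functions. A functional of
`Ψ, Ψ^*` is a function of these amplitudes. -/
abbrev Phase (M : Fin C → ℕ) := (j : Fin C) → Fin (M j) → ℂ

instance : (volume : Measure (Phase M)).HasTemperateGrowth :=
  Measure.IsAddHaarMeasure.instHasTemperateGrowth

/-- The total number of particles. -/
def totalNumber (n : MultiOcc M) : ℕ := ∑ j, ∑ p, n j p

/-- The number state `|n⟩`. -/
def numberState (n : MultiOcc M) : Fock M := lp.single 2 n (1 : ℂ)

/-- The matrix elements `⟨m|A|n⟩` of a bounded operator. -/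
def matrixElements (A : Fock M →L[ℂ] Fock M) : Kernel (MultiOcc M) :=
  fun m n => inner ℂ (numberState m) (A (numberState n))

/-- Hilbert-Schmidt operators. -/
def IsHilbertSchmidt (A : Fock M →L[ℂ] Fock M) : Prop :=
  Summable fun n : MultiOcc M => ‖A (numberState n)‖ ^ 2

/-- Matrix elements that decay faster than every power of the particle numbers. Equivalently, all
products of the operator with creation and annihilation operators on both sides are
Hilbert-Schmidt. -/
def RapidlyDecreasing (K : Kernel (MultiOcc M)) : Prop :=
  ∀ r : ℕ, ∃ c : ℝ, ∀ m n, (1 + totalNumber m + totalNumber n : ℝ) ^ r * ‖K m n‖ ≤ c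

/-- Compression `P K P` of an operator to the states with at most `R` particles. -/
def truncate (R : ℕ) (K : Kernel (MultiOcc M)) : Kernel (MultiOcc M) :=
  fun m n => if totalNumber m ≤ R ∧ totalNumber n ≤ R then K m n else 0

/-- An operator of component `j`, acting on the Fock space of all components. -/
def onComponent (j : Fin C) (K : Kernel (Occ (M j))) : Kernel (MultiOcc M) :=
  fun m n => if ∀ i, i ≠ j → m i = n i then K (m j) (n j) else 0

/-- The product `∏ j, K j` of operators of the different components, that is, their tensor
product. -/
def componentProduct (K : (j : Fin C) → Kernel (Occ (M j))) : Kernel (MultiOcc M) :=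
  fun m n => ∏ j, K j (m j) (n j)

variable (S : Set (Space D)) (φ : (j : Fin C) → Fin (M j) → Space D → ℂ)

/-- The restricted field operator `Ψ̃_j(x)` on the Fock space of all components. -/
def field (j : Fin C) (x : Space D) : Kernel (MultiOcc M) :=
  onComponent j (fieldOp (φ j) x)

/-- The interaction operator `∫ dx Ψ̃_j† Ψ̃_k† Ψ̃_j Ψ̃_k`. -/
def interaction (j k : Fin C) : Kernel (MultiOcc M) :=
  fun m n => ∫ x in S,
    opMul (opAdj (field φ j x)) (opMul (opAdj (field φ k x))
      (opMul (field φ j x) (field φ k x))) m n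

/-- `∏ j, D̂_j[Λ_j, Λ_j^*]`. -/
def displacement (l : Phase M) : Kernel (MultiOcc M) :=
  componentProduct fun j => displacementOp S (φ j) (l j)

/-- The functional Wigner transformation
`𝒲[T] = π^(-2 ∑ |𝕄_j|) ∫ δ²Λ (∏ j, D[Λ_j, Λ_j^*, Ψ_j, Ψ_j^*]) Tr {T ∏ j, D̂_j[Λ_j, Λ_j^*]}`. -/
def wigner (T : Kernel (MultiOcc M)) (α : Phase M) : ℂ :=
  1 / (Real.pi : ℂ) ^ (2 * ∑ j, M j) *
    ∫ l : Phase M, (∏ j, displacementFunctional S (φ j) (l j) (α j)) *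
      opTrace (opMul T (displacement S φ l))

/-- The trace and the integral in the Wigner transformation of `T` converge absolutely. -/
def WignerConverges (T : Kernel (MultiOcc M)) : Prop :=
  (∀ l : Phase M, Summable fun q : MultiOcc M × MultiOcc M =>
    T q.1 q.2 * displacement S φ l q.2 q.1) ∧
  ∀ α : Phase M, Integrable fun l : Phase M =>
    (∏ j, displacementFunctional S (φ j) (l j) (α j)) * opTrace (opMul T (displacement S φ l))

/-! ### Functional derivatives -/

/-- The amplitude vector `z e_{j,p}`. -/
def modeVec (j : Fin C) (p : Fin (M j)) (z : ℂ) : Phase M := Pi.single j (Pi.single p z)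

/-- The Wirtinger derivative `∂/∂α_{j,p} = (∂/∂x - i ∂/∂y) / 2`. -/
def wirtinger (j : Fin C) (p : Fin (M j)) (F : Phase M → ℂ) (α : Phase M) : ℂ :=
  (lineDeriv ℝ F α (modeVec j p 1) - Complex.I * lineDeriv ℝ F α (modeVec j p Complex.I)) / 2

/-- The Wirtinger derivative `∂/∂α_{j,p}^* = (∂/∂x + i ∂/∂y) / 2`. -/
def wirtingerBar (j : Fin C) (p : Fin (M j)) (F : Phase M → ℂ) (α : Phase M) : ℂ :=
  (lineDeriv ℝ F α (modeVec j p 1) + Complex.I * lineDeriv ℝ F α (modeVec j p Complex.I)) / 2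

/-- The functional derivative `δ/δΨ_j(x) = ∑ p, φ_{j,p}(x)^* ∂/∂α_{j,p}`. -/
def funDeriv (j : Fin C) (x : Space D) (F : Phase M → ℂ) (α : Phase M) : ℂ :=
  ∑ p, conj (φ j p x) * wirtinger j p F α

/-- The functional derivative `δ/δΨ_j^*(x) = ∑ p, φ_{j,p}(x) ∂/∂α_{j,p}^*`. -/
def funDerivBar (j : Fin C) (x : Space D) (F : Phase M → ℂ) (α : Phase M) : ℂ :=
  ∑ p, φ j p x * wirtingerBar j p F α

/-- The value `Ψ_j(x)`. -/
def psi (j : Fin C) (x : Space D) (α : Phase M) : ℂ := compose (φ j) (α j) x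

/-- The value `Ψ_j^*(x)`. -/
def psiBar (j : Fin C) (x : Space D) (α : Phase M) : ℂ := conj (psi φ j x α)

/-- `δ̃_j(x) = δ_{𝕄_j}(x, x)`. -/
def deltaTilde (j : Fin C) (x : Space D) : ℂ := restrictedDelta (φ j) x x

/-- `-Ψ_j Ψ_k Ψ_k^* + (δ̃_k / 2) (δ_{jk} Ψ_k + Ψ_j)` at `x`. -/
def drift (j k : Fin C) (x : Space D) (α : Phase M) : ℂ :=
  -(psi φ j x α * psi φ k x α * psiBar φ k x α)
    + deltaTilde φ k x / 2 * ((if j = k then 1 else 0) * psi φ k x α + psi φ j x α)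

/-- `Ψ_j^* Ψ_k Ψ_k^* - (δ̃_k / 2) (δ_{jk} Ψ_k^* + Ψ_j^*)` at `x`. -/
def driftBar (j k : Fin C) (x : Space D) (α : Phase M) : ℂ :=
  psiBar φ j x α * psi φ k x α * psiBar φ k x α
    - deltaTilde φ k x / 2 * ((if j = k then 1 else 0) * psiBar φ k x α + psiBar φ j x α)

/-- The differential operator at the point `x`, applied to a functional `F`. -/
def wignerGenerator (j k : Fin C) (x : Space D) (F : Phase M → ℂ) (α : Phase M) : ℂ :=
  funDeriv φ j x (fun β => drift φ j k x β * F β) α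
    + funDerivBar φ j x (fun β => driftBar φ j k x β * F β) α
    + funDeriv φ k x (fun β => drift φ k j x β * F β) α
    + funDerivBar φ k x (fun β => driftBar φ k j x β * F β) α
    + funDeriv φ j x (funDerivBar φ j x (funDeriv φ k x
        (fun β => 1 / 4 * psi φ k x β * F β))) α
    - funDeriv φ j x (funDerivBar φ j x (funDerivBar φ k x
        (fun β => 1 / 4 * psiBar φ k x β * F β))) α
    + funDeriv φ k x (funDerivBar φ k x (funDeriv φ j x
        (fun β => 1 / 4 * psi φ j x β * F β))) α
    - funDeriv φ k x (funDerivBar φ k x (funDerivBar φ j x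
        (fun β => 1 / 4 * psiBar φ j x β * F β))) α

/-! ### The same operations on tempered distributions -/

/-- The functional derivative `δ/δΨ_j(x)` of a tempered distribution. -/
def funDerivDist (j : Fin C) (x : Space D) (u : 𝓢'(Phase M, ℂ)) : 𝓢'(Phase M, ℂ) :=
  ∑ p, (conj (φ j p x) / 2) • (∂_{modeVec j p 1} u - Complex.I • ∂_{modeVec j p Complex.I} u)

/-- The functional derivative `δ/δΨ_j^*(x)` of a tempered distribution. -/
def funDerivBarDist (j : Fin C) (x : Space D) (u : 𝓢'(Phase M, ℂ)) : 𝓢'(Phase M, ℂ) :=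
  ∑ p, (φ j p x / 2) • (∂_{modeVec j p 1} u + Complex.I • ∂_{modeVec j p Complex.I} u)

/-- The product of a polynomially bounded smooth function and a tempered distribution. -/
def mulDist (g : Phase M → ℂ) (u : 𝓢'(Phase M, ℂ)) : 𝓢'(Phase M, ℂ) :=
  TemperedDistribution.smulLeftCLM ℂ g u

/-- The differential operator at the point `x`, applied to a tempered distribution. -/
def wignerGeneratorDist (j k : Fin C) (x : Space D) (u : 𝓢'(Phase M, ℂ)) : 𝓢'(Phase M, ℂ) :=
  funDerivDist φ j x (mulDist (drift φ j k x) u)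
    + funDerivBarDist φ j x (mulDist (driftBar φ j k x) u)
    + funDerivDist φ k x (mulDist (drift φ k j x) u)
    + funDerivBarDist φ k x (mulDist (driftBar φ k j x) u)
    + funDerivDist φ j x (funDerivBarDist φ j x (funDerivDist φ k x
        (mulDist (fun β => 1 / 4 * psi φ k x β) u)))
    - funDerivDist φ j x (funDerivBarDist φ j x (funDerivBarDist φ k x
        (mulDist (fun β => 1 / 4 * psiBar φ k x β) u)))
    + funDerivDist φ k x (funDerivBarDist φ k x (funDerivDist φ j x
        (mulDist (fun β => 1 / 4 * psi φ j x β) u)))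
    - funDerivDist φ k x (funDerivBarDist φ k x (funDerivBarDist φ j x
        (mulDist (fun β => 1 / 4 * psiBar φ j x β) u)))

/-- `w` is the Wigner transform of a Hilbert-Schmidt operator with matrix elements `T`: the limit
in `L²` of the Wigner transforms of its compressions to finitely many particles. -/
def IsWignerL2 (T : Kernel (MultiOcc M)) (w : Lp ℂ 2 (volume : Measure (Phase M))) : Prop :=
  Tendsto (fun R : ℕ => eLpNorm (fun α => wigner S φ (truncate R T) α - w α) 2 volume)
    atTop (𝓝 0)

/-- `u` is the Wigner transform of `T` as a tempered distribution: the limit in the sense of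
distributions of the Wigner transforms of the compressions of `T` to finitely many particles. -/
def IsWignerDist (T : Kernel (MultiOcc M)) (u : 𝓢'(Phase M, ℂ)) : Prop :=
  ∀ f : 𝓢(Phase M, ℂ),
    Tendsto (fun R : ℕ => ∫ α, f α * wigner S φ (truncate R T) α) atTop (𝓝 (u f))

end FunctionalWigner

end

/-!
Throughout, an operator is encoded by its matrix elements `T N`, where `N : Label M → ℕ` holds the
occupation numbers of a pair of number states `m` (row, labels `inl i`) and `n` (column, labels
`inr i`). On such functions multiplication by `a_i` and `a_i†` from either side is one of the ladder
operators `lower s` and `raise s`.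

The Wigner function of `T` is the superposition `wignerSeries T` of the Wigner functions
`wignerElem α N` of the transitions `|m⟩⟨n|`. The formula holds because it is an identity between
ladder operators:

* Multiplication by `α_i` and `α_i^*`, and differentiation by them, correspond to
  `T ↦ (a_i T + T a_i) / 2`, `(a_i† T + T a_i†) / 2`, `T a_i† - a_i† T` and `a_i T - T a_i`
  (`wignerSeries_coordOp`, `wignerSeries_coordBarOp`, `hasWirtinger_wignerSeries`). These relations
  follow, under the integral over `λ` and by one integration by parts, from those for the
  displacement operator `D`: `[a_i, D] = λ_i D`, `[a_i†, D] = λ_i^* D`, and the formulas for its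
  derivatives (`coord_smul_charElem`, `coordBar_smul_charElem`, `hasWirtinger_charElem`). The
  commutators are read off the exponential series; together with the vacuum expectation value, a
  Gaussian, they determine every matrix element of `D`, whence the derivatives.
* Substituting these operators into the differential operator at `x` and normal ordering with
  `[Ψ̃, Ψ̃†] = δ̃` leaves the commutator with `Ψ̃_j† Ψ̃_k† Ψ̃_j Ψ̃_k` at `x`
  (`generatorOp_eq_commOp`, which rests on `generator_identity_same` and `generator_identity_ne`).
  Both sides are finite sums over quadruples of modes whose coefficients are products of four mode
  functions, integrable because these are in `L⁴`, so that the integral over `x` is taken term by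
  term.

Convergence comes from the same relations. Matrix elements of the unitary `D` are at most one
(`norm_displacementElem_le_one`), and since multiplication by an amplitude is a ladder operator,
which costs only a power of the number of particles, `D` decays on phase space faster than any
power, with constants polynomial in the number of particles (`UniformDecay.of_ladder`). The same
argument applies to the Wigner functions, which proves that `wignerSeries T` is a Schwartz function
when `T` decreases rapidly (`wignerSchwartz`). This gives the formula for rapidly decreasing
operators, `wigner_opComm_interaction`.

For Hilbert-Schmidt operators, integration by parts shows that `lower s` and `raise s` are adjoint
for the `L²` inner product of Wigner functions. Hence the Wigner functions of the transitions are
orthogonal with equal norms (`wignerInner_single`), and the Wigner functions of the compressions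
converge in `L²` (`tendsto_wignerLimit`). Multiplication by polynomials and differentiation are
continuous on tempered distributions, so that the identity between ladder operators passes to the
limit (`Represents`, `exists_isWignerDist`); since the interaction conserves the number of
particles, the compression of the commutator is the commutator with the compression
(`flatten_truncate_opComm`).
-/

noncomputable section

set_option linter.unusedSectionVars false

namespace FunctionalWigner

/-! ### Ladder operators on functions of occupation numbers -/

section Ladder

variable {ι : Type} [Fintype ι] [DecidableEq ι]

/-- `(lower i f) N = √(N i + 1) f (N + e i)`: annihilation at the label `i`. -/
def lower (i : ι) : Module.End ℂ ((ι → ℕ) → ℂ) where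
  toFun f N := (Real.sqrt (N i + 1) : ℂ) * f (N + Pi.single i 1)
  map_add' f g := by ext N; simp [mul_add]
  map_smul' c f := by ext N; simp [mul_left_comm]

/-- `(raise i f) N = √(N i) f (N - e i)`: creation at the label `i`. At `N i = 0`, where the
subtraction is truncated, the coefficient vanishes. -/
def raise (i : ι) : Module.End ℂ ((ι → ℕ) → ℂ) where
  toFun f N := (Real.sqrt (N i) : ℂ) * f (N - Pi.single i 1)
  map_add' f g := by ext N; simp [mul_add]
  map_smul' c f := by ext N; simp [mul_left_comm]

lemma lower_apply (i : ι) (f : (ι → ℕ) → ℂ) (N : ι → ℕ) :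
    lower i f N = (Real.sqrt (N i + 1) : ℂ) * f (N + Pi.single i 1) := rfl

lemma raise_apply (i : ι) (f : (ι → ℕ) → ℂ) (N : ι → ℕ) :
    raise i f N = (Real.sqrt (N i) : ℂ) * f (N - Pi.single i 1) := rfl

lemma raise_apply_of_eq_zero {i : ι} {N : ι → ℕ} (h : N i = 0) (f : (ι → ℕ) → ℂ) :
    raise i f N = 0 := by simp [raise_apply, h]

lemma raise_apply_add_single (i : ι) (f : (ι → ℕ) → ℂ) (N : ι → ℕ) :
    raise i f (N + Pi.single i 1) = (Real.sqrt (N i + 1) : ℂ) * f N := by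
  simp [raise_apply]

lemma exists_eq_add_single {i : ι} {N : ι → ℕ} (h : N i ≠ 0) :
    ∃ N' : ι → ℕ, N = N' + Pi.single i 1 := by
  refine ⟨N - Pi.single i 1, ?_⟩
  ext k
  by_cases hk : k = i
  · subst hk; simp; omega
  · simp [hk]

lemma sqrt_mul_self_natCast (n : ℕ) :
    (Real.sqrt (n + 1) : ℂ) * (Real.sqrt (n + 1) : ℂ) = (n : ℂ) + 1 := by
  rw [← Complex.ofReal_mul, Real.mul_self_sqrt (by positivity)]; push_cast; rfl

lemma lower_raise_self (i : ι) (f : (ι → ℕ) → ℂ) :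
    lower i (raise i f) = raise i (lower i f) + f := by
  ext N
  rw [lower_apply, raise_apply_add_single, Pi.add_apply, ← mul_assoc, sqrt_mul_self_natCast]
  by_cases h : N i = 0
  · rw [raise_apply_of_eq_zero h]; simp [h]
  · obtain ⟨N', rfl⟩ := exists_eq_add_single h
    rw [raise_apply_add_single, lower_apply, ← mul_assoc, sqrt_mul_self_natCast]
    simp; ring

lemma lower_raise_of_ne {i k : ι} (h : i ≠ k) (f : (ι → ℕ) → ℂ) :
    lower i (raise k f) = raise k (lower i f) := by
  ext N
  have h2 : N + Pi.single i 1 - Pi.single k 1 = N - Pi.single k 1 + Pi.single i 1 ∨ N k = 0 := by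
    by_cases hk : N k = 0
    · exact Or.inr hk
    · left
      obtain ⟨N', rfl⟩ := exists_eq_add_single hk
      rw [add_right_comm]; simp
  rw [lower_apply, raise_apply, raise_apply, lower_apply]
  rcases h2 with h2 | h2
  · rw [h2]
    simp [h, h.symm]
    ring
  · simp [h2, h.symm]

lemma lower_lower (i k : ι) (f : (ι → ℕ) → ℂ) : lower i (lower k f) = lower k (lower i f) := by
  by_cases h : i = k
  · rw [h]
  · ext N
    simp only [lower_apply]
    rw [add_right_comm]
    simp [h, Ne.symm h]
    ring

lemma raise_raise (i k : ι) (f : (ι → ℕ) → ℂ) : raise i (raise k f) = raise k (raise i f) := by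
  by_cases h : i = k
  · rw [h]
  · ext N
    simp only [raise_apply]
    rw [tsub_right_comm]
    simp [h, Ne.symm h]
    ring

lemma lower_mul_raise (i k : ι) :
    lower i * raise k =
      raise k * lower i + if i = k then (1 : Module.End ℂ ((ι → ℕ) → ℂ)) else 0 := by
  refine LinearMap.ext fun f => ?_
  split_ifs with h
  · subst h; simpa using lower_raise_self i f
  · simpa using lower_raise_of_ne h f

lemma lower_mul_lower (i k : ι) : lower i * lower k = lower k * lower i :=
  LinearMap.ext (lower_lower i k)

lemma raise_mul_raise (i k : ι) : raise i * raise k = raise k * raise i :=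
  LinearMap.ext (raise_raise i k)

lemma lower_single (i : ι) (n : ι → ℕ) :
    lower i (Pi.single n (1 : ℂ)) =
      (Real.sqrt (n i) : ℂ) • Pi.single (n - Pi.single i 1) (1 : ℂ) := by
  ext N
  rw [lower_apply]
  by_cases h : n = N + Pi.single i 1
  · subst h; simp
  · rw [Pi.single_eq_of_ne (Ne.symm h), Pi.smul_apply]
    by_cases h0 : n i = 0
    · simp [h0]
    · obtain ⟨n', rfl⟩ := exists_eq_add_single h0
      have : N ≠ n' := fun hh => h (by rw [hh])
      simp [this]

lemma raise_single (i : ι) (n : ι → ℕ) :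
    raise i (Pi.single n (1 : ℂ)) =
      (Real.sqrt (n i + 1) : ℂ) • Pi.single (n + Pi.single i 1) (1 : ℂ) := by
  ext N
  by_cases h0 : N i = 0
  · have : N ≠ n + Pi.single i 1 := fun hh => by simp [hh] at h0
    rw [raise_apply_of_eq_zero h0]; simp [this]
  · obtain ⟨N', rfl⟩ := exists_eq_add_single h0
    rw [raise_apply_add_single]
    by_cases h : N' = n
    · subst h; simp
    · simp [h]

/-- `lower i` and `raise i` are transposes of each other. No convergence is needed: the two series
have the same nonzero terms. -/
lemma tsum_lower_mul (i : ι) (f g : (ι → ℕ) → ℂ) :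
    ∑' N, lower i f N * g N = ∑' N, f N * raise i g N := by
  rw [← (add_left_injective (Pi.single i 1 : ι → ℕ)).tsum_eq (f := fun N => f N * raise i g N)]
  · refine tsum_congr fun N => ?_
    rw [raise_apply_add_single, lower_apply]; ring
  · intro N hN
    have : N i ≠ 0 := fun h => hN (by simp [raise_apply_of_eq_zero h])
    obtain ⟨N', h⟩ := exists_eq_add_single this
    exact ⟨N', h.symm⟩

lemma tsum_raise_mul (i : ι) (f g : (ι → ℕ) → ℂ) :
    ∑' N, raise i f N * g N = ∑' N, f N * lower i g N := by
  simp_rw [mul_comm _ (g _), mul_comm (f _), tsum_lower_mul]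

/-! ### Growth and decay in the number of particles -/

/-- The total number `∑ i, N i`. -/
def size (N : ι → ℕ) : ℕ := ∑ i, N i

@[simp] lemma size_zero : size (0 : ι → ℕ) = 0 := by simp [size]

@[simp] lemma size_add_single (N : ι → ℕ) (i : ι) : size (N + Pi.single i 1) = size N + 1 := by
  simp [size, Finset.sum_add_distrib]

lemma le_size (N : ι → ℕ) (i : ι) : N i ≤ size N :=
  Finset.single_le_sum (f := N) (fun _ _ => Nat.zero_le _) (Finset.mem_univ i)

lemma size_sub_single_le (N : ι → ℕ) (i : ι) : size (N - Pi.single i 1) ≤ size N :=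
  Finset.sum_le_sum fun _ _ => Nat.sub_le _ _

/-- A family of functions of occupation numbers that grows at most polynomially in the number of
particles, uniformly in the parameter. -/
def PolyBounded {E : Type*} (g : E → (ι → ℕ) → ℂ) : Prop :=
  ∃ (c : ℝ) (k : ℕ), ∀ z N, ‖g z N‖ ≤ c * (1 + size N : ℝ) ^ k

/-- Functions of occupation numbers that decay faster than every power of the number of
particles. -/
def RapidDecay (T : (ι → ℕ) → ℂ) : Prop :=
  ∀ r : ℕ, ∃ c : ℝ, ∀ N, (1 + size N : ℝ) ^ r * ‖T N‖ ≤ c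

namespace PolyBounded

variable {E : Type*} {g h : E → (ι → ℕ) → ℂ}

lemma exists_nonneg (hg : PolyBounded g) :
    ∃ (c : ℝ) (k : ℕ), 0 ≤ c ∧ ∀ z N, ‖g z N‖ ≤ c * (1 + size N : ℝ) ^ k := by
  obtain ⟨c, k, hc⟩ := hg
  refine ⟨|c|, k, abs_nonneg c, fun z N => (hc z N).trans ?_⟩
  gcongr
  exact le_abs_self c

lemma add (hg : PolyBounded g) (hh : PolyBounded h) : PolyBounded fun z => g z + h z := by
  obtain ⟨c, k, hc0, hc⟩ := hg.exists_nonneg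
  obtain ⟨d, l, hd0, hd⟩ := hh.exists_nonneg
  refine ⟨c + d, max k l, fun z N => ?_⟩
  have h1 : (1 : ℝ) ≤ 1 + size N := by simp
  calc ‖(g z + h z) N‖ ≤ ‖g z N‖ + ‖h z N‖ := norm_add_le _ _
    _ ≤ c * (1 + size N : ℝ) ^ k + d * (1 + size N : ℝ) ^ l := add_le_add (hc z N) (hd z N)
    _ ≤ c * (1 + size N : ℝ) ^ (max k l) + d * (1 + size N : ℝ) ^ (max k l) := by
        gcongr <;> simp
    _ = _ := by ring

lemma smul (c : ℂ) (hg : PolyBounded g) : PolyBounded fun z => c • g z := by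
  obtain ⟨d, k, hd⟩ := hg
  refine ⟨‖c‖ * d, k, fun z N => ?_⟩
  simp only [Pi.smul_apply, norm_smul, mul_assoc]
  gcongr
  exact hd z N

lemma zero : PolyBounded fun _ : E => (0 : (ι → ℕ) → ℂ) := ⟨0, 0, by simp⟩

lemma sum {κ : Type*} (s : Finset κ) {g : κ → E → (ι → ℕ) → ℂ} (hg : ∀ i ∈ s, PolyBounded (g i)) :
    PolyBounded fun z => ∑ i ∈ s, g i z := by
  classical
  induction s using Finset.induction_on with
  | empty => simpa using zero
  | insert a s ha ih =>
    simp only [Finset.sum_insert ha]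
    exact (hg a (by simp)).add (ih fun i hi => hg i (by simp [hi]))

lemma lower (i : ι) (hg : PolyBounded g) : PolyBounded fun z => lower i (g z) := by
  obtain ⟨c, k, hc0, hc⟩ := hg.exists_nonneg
  refine ⟨c * 2 ^ k, k + 1, fun z N => ?_⟩
  simp only [lower_apply, norm_mul, Complex.norm_real, Real.norm_of_nonneg (Real.sqrt_nonneg _)]
  have h1 : Real.sqrt (N i + 1) ≤ 1 + size N := by
    rw [Real.sqrt_le_left (by positivity)]
    have : (N i : ℝ) ≤ size N := by exact_mod_cast le_size N i
    nlinarith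
  have h2 := hc z (N + Pi.single i 1)
  rw [size_add_single] at h2
  have h3 : (1 + ((size N + 1 : ℕ) : ℝ)) ^ k ≤ (2 * (1 + size N : ℝ)) ^ k := by
    gcongr; push_cast; linarith [(Nat.cast_nonneg (size N) : (0 : ℝ) ≤ _)]
  calc _ ≤ (1 + size N : ℝ) * (c * (2 * (1 + size N : ℝ)) ^ k) := by
        gcongr
        exact h2.trans (by gcongr)
    _ = _ := by rw [mul_pow]; ring

lemma raise (i : ι) (hg : PolyBounded g) : PolyBounded fun z => raise i (g z) := by
  obtain ⟨c, k, hc0, hc⟩ := hg.exists_nonneg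
  refine ⟨c, k + 1, fun z N => ?_⟩
  simp only [raise_apply, norm_mul, Complex.norm_real, Real.norm_of_nonneg (Real.sqrt_nonneg _)]
  have h1 : Real.sqrt (N i) ≤ 1 + size N := by
    rw [Real.sqrt_le_left (by positivity)]
    have : (N i : ℝ) ≤ size N := by exact_mod_cast le_size N i
    nlinarith
  have h3 : (size (N - Pi.single i 1) : ℝ) ≤ size N := by exact_mod_cast size_sub_single_le N i
  calc _ ≤ (1 + size N : ℝ) * (c * (1 + size N : ℝ) ^ k) := by
        gcongr
        exact (hc z _).trans (by gcongr)
    _ = _ := by ring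

end PolyBounded

lemma summable_one_add_size_pow_inv :
    Summable fun N : ι → ℕ => ((1 + size N : ℝ) ^ (2 * Fintype.card ι))⁻¹ := by
  have h1 : Summable fun n : ℕ => (((1 : ℝ) + n) ^ 2)⁻¹ := by
    have := (summable_nat_add_iff 1).2 (Real.summable_nat_pow_inv.2 (one_lt_two))
    simpa [add_comm] using this
  refine Summable.of_nonneg_of_le (f := fun N : ι → ℕ => ∏ i, (((1 : ℝ) + N i) ^ 2)⁻¹)
    (fun N => by positivity) (fun N => ?_) ?_
  · rw [Finset.prod_inv_distrib, pow_mul]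
    refine inv_anti₀ (Finset.prod_pos fun i _ => by positivity) ?_
    calc ∏ i, ((1 : ℝ) + N i) ^ 2 ≤ ∏ _i : ι, (1 + size N : ℝ) ^ 2 := by
          gcongr with i
          exact_mod_cast le_size N i
      _ = _ := by simp
  · refine summable_of_sum_le (c := ∏ _i : ι, ∑' n : ℕ, (((1 : ℝ) + n) ^ 2)⁻¹)
      (fun N => Finset.prod_nonneg fun i _ => by positivity) fun s => ?_
    obtain ⟨K, hK⟩ : ∃ K : ℕ, s ⊆ Fintype.piFinset fun _ : ι => Finset.range K := by
      refine ⟨s.sup size + 1, fun N hN => ?_⟩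
      simp only [Fintype.mem_piFinset, Finset.mem_range, Nat.lt_succ_iff]
      exact fun i => (le_size N i).trans (Finset.le_sup (f := size) hN)
    calc _ ≤ ∑ N ∈ Fintype.piFinset fun _ : ι => Finset.range K, ∏ i, (((1 : ℝ) + N i) ^ 2)⁻¹ :=
          Finset.sum_le_sum_of_subset_of_nonneg hK fun N _ _ =>
            Finset.prod_nonneg fun i _ => by positivity
      _ = ∏ _i : ι, ∑ n ∈ Finset.range K, (((1 : ℝ) + n) ^ 2)⁻¹ := by
          rw [Finset.prod_univ_sum]
      _ ≤ _ := by
          refine Finset.prod_le_prod (fun i _ => Finset.sum_nonneg fun n _ => by positivity)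
            fun i _ => h1.sum_le_tsum _ fun n _ => by positivity

namespace RapidDecay

variable {T T' : (ι → ℕ) → ℂ}

lemma add (hT : RapidDecay T) (hT' : RapidDecay T') : RapidDecay (T + T') := by
  intro r
  obtain ⟨c, hc⟩ := hT r
  obtain ⟨d, hd⟩ := hT' r
  refine ⟨c + d, fun N => ?_⟩
  calc _ ≤ (1 + size N : ℝ) ^ r * (‖T N‖ + ‖T' N‖) := by
        gcongr; exact norm_add_le _ _
    _ ≤ _ := by linarith [hc N, hd N]

lemma smul (a : ℂ) (hT : RapidDecay T) : RapidDecay (a • T) := by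
  intro r
  obtain ⟨c, hc⟩ := hT r
  refine ⟨‖a‖ * c, fun N => ?_⟩
  rw [Pi.smul_apply, norm_smul, mul_left_comm]
  gcongr
  exact hc N

lemma zero : RapidDecay (0 : (ι → ℕ) → ℂ) := fun r => ⟨0, by simp⟩

lemma neg (hT : RapidDecay T) : RapidDecay (-T) := by
  simpa using hT.smul (-1)

lemma sub (hT : RapidDecay T) (hT' : RapidDecay T') : RapidDecay (T - T') := by
  rw [sub_eq_add_neg]; exact hT.add hT'.neg

lemma sum {κ : Type*} (s : Finset κ) {T : κ → (ι → ℕ) → ℂ} (hT : ∀ i ∈ s, RapidDecay (T i)) :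
    RapidDecay (∑ i ∈ s, T i) := by
  classical
  induction s using Finset.induction_on with
  | empty => simpa using zero
  | insert a s ha ih =>
    rw [Finset.sum_insert ha]
    exact (hT a (by simp)).add (ih fun i hi => hT i (by simp [hi]))

lemma lower (i : ι) (hT : RapidDecay T) : RapidDecay (lower i T) := by
  intro r
  obtain ⟨c, hc⟩ := hT (r + 1)
  refine ⟨c, fun N => le_trans ?_ (hc (N + Pi.single i 1))⟩
  rw [lower_apply, norm_mul, Complex.norm_real, Real.norm_of_nonneg (Real.sqrt_nonneg _),
    size_add_single, pow_succ, mul_assoc]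
  have h1 : Real.sqrt (N i + 1) ≤ 1 + (size N + 1 : ℕ) := by
    rw [Real.sqrt_le_left (by positivity)]
    have : (N i : ℝ) ≤ size N := by exact_mod_cast le_size N i
    push_cast
    nlinarith
  gcongr
  simp

lemma raise (i : ι) (hT : RapidDecay T) : RapidDecay (raise i T) := by
  intro r
  obtain ⟨c, hc⟩ := hT (r + 1)
  refine ⟨2 ^ r * c, fun N => ?_⟩
  have hc0 : 0 ≤ c := le_trans (by positivity) (hc 0)
  by_cases h : N i = 0
  · rw [raise_apply_of_eq_zero h]; simpa using by positivity
  obtain ⟨N, rfl⟩ := exists_eq_add_single h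
  rw [raise_apply_add_single, norm_mul, Complex.norm_real,
    Real.norm_of_nonneg (Real.sqrt_nonneg _), size_add_single]
  have h1 : Real.sqrt (N i + 1) ≤ 1 + size N := by
    rw [Real.sqrt_le_left (by positivity)]
    have : (N i : ℝ) ≤ size N := by exact_mod_cast le_size N i
    nlinarith
  have h3 : (1 + ((size N + 1 : ℕ) : ℝ)) ^ r ≤ (2 * (1 + size N : ℝ)) ^ r := by
    gcongr; push_cast; linarith [(Nat.cast_nonneg (size N) : (0 : ℝ) ≤ _)]
  calc _ ≤ (2 * (1 + size N : ℝ)) ^ r * ((1 + size N : ℝ) * ‖T N‖) := by gcongr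
    _ = 2 ^ r * ((1 + size N : ℝ) ^ (r + 1) * ‖T N‖) := by rw [mul_pow]; ring
    _ ≤ _ := by gcongr; exact hc N

lemma of_finite_support (hT : T.support.Finite) : RapidDecay T := by
  intro r
  refine ⟨∑ N ∈ hT.toFinset, (1 + size N : ℝ) ^ r * ‖T N‖, fun N => ?_⟩
  by_cases h : T N = 0
  · rw [h]; simpa using Finset.sum_nonneg fun N _ => by positivity
  · exact Finset.single_le_sum (f := fun N => (1 + size N : ℝ) ^ r * ‖T N‖)
      (fun N _ => by positivity) (by simpa using h)

/-- A rapidly decreasing sequence is summable against any polynomial weight. -/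
lemma summable_mul_pow (hT : RapidDecay T) (k : ℕ) :
    Summable fun N => ‖T N‖ * (1 + size N : ℝ) ^ k := by
  obtain ⟨c, hc⟩ := hT (k + 2 * Fintype.card ι)
  refine Summable.of_nonneg_of_le (fun N => by positivity) (fun N => ?_)
    (summable_one_add_size_pow_inv.mul_left c)
  have h0 : (0 : ℝ) < (1 + size N : ℝ) ^ (2 * Fintype.card ι) := by positivity
  rw [← div_eq_mul_inv, le_div_iff₀ h0]
  refine le_trans (le_of_eq ?_) (hc N)
  rw [pow_add]; ring

lemma summable_mul {E : Type*} (hT : RapidDecay T) {g : E → (ι → ℕ) → ℂ} (hg : PolyBounded g)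
    (z : E) : Summable fun N => T N * g z N := by
  obtain ⟨c, k, hc⟩ := hg
  refine Summable.of_norm_bounded ((hT.summable_mul_pow k).mul_left c) fun N => ?_
  rw [norm_mul, mul_left_comm]
  gcongr
  exact hc z N

end RapidDecay

end Ladder

/-! ### Displacement operators of one component -/

section Displacement

variable {ι : Type} [Fintype ι] [DecidableEq ι]

/-- The generator `∑ p, (l_p a_p† - l_p^* a_p)` of the displacement by `l`. -/
def displacementGen (l : ι → ℂ) : Module.End ℂ ((ι → ℕ) → ℂ) :=
  ∑ p, (l p • raise p - conj (l p) • lower p)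

lemma displacementGen_apply (l : ι → ℂ) (f : (ι → ℕ) → ℂ) (m : ι → ℕ) :
    displacementGen l f m = ∑ p, (l p * raise p f m - conj (l p) * lower p f m) := by
  simp [displacementGen]

lemma lower_mul_displacementGen (l : ι → ℂ) (p : ι) :
    lower p * displacementGen l = displacementGen l * lower p + l p • 1 := by
  simp only [displacementGen, Finset.mul_sum, Finset.sum_mul, mul_sub, sub_mul, mul_smul_comm,
    smul_mul_assoc, lower_mul_raise, lower_mul_lower p, smul_add]
  simp only [add_sub_right_comm, Finset.sum_add_distrib]
  simp

lemma raise_mul_displacementGen (l : ι → ℂ) (p : ι) :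
    raise p * displacementGen l = displacementGen l * raise p + conj (l p) • 1 := by
  simp only [displacementGen, Finset.mul_sum, Finset.sum_mul, mul_sub, sub_mul, mul_smul_comm,
    smul_mul_assoc, lower_mul_raise, raise_mul_raise p, smul_add, sub_add_eq_sub_sub]
  simp only [Finset.sum_sub_distrib]
  simp

/-- If `[A, G] = c` is a scalar, then `[A, G ^ (r + 1)] = (r + 1) c G ^ r`. -/
lemma mul_pow_succ_of_commutator {R : Type*} [Ring R] [Algebra ℂ R] {A G : R} {c : ℂ}
    (h : A * G = G * A + c • 1) (r : ℕ) :
    A * G ^ (r + 1) = G ^ (r + 1) * A + ((r + 1 : ℂ) * c) • G ^ r := by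
  induction r with
  | zero => simp [h]
  | succ r ih =>
    rw [pow_succ, ← mul_assoc, ih, add_mul, mul_assoc, h, mul_add, ← mul_assoc, smul_mul_assoc,
      ← pow_succ, ← pow_succ, add_assoc, mul_smul_comm, mul_one, ← add_smul]
    push_cast
    ring_nf

/-- The term of order `r` of the displacement operator, before division by `r!`. -/
def displacementTerm (l : ι → ℂ) (r : ℕ) (m n : ι → ℕ) : ℂ :=
  (displacementGen l ^ r) (Pi.single n 1) m

/-- Matrix elements of the displacement operator as a power series in its generator. -/
def displacementElem (l : ι → ℂ) (m n : ι → ℕ) : ℂ :=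
  ∑' r : ℕ, displacementTerm l r m n / (r.factorial : ℂ)

lemma displacementTerm_succ_apply (l : ι → ℂ) (r : ℕ) (m n : ι → ℕ) :
    displacementTerm l (r + 1) m n =
      ∑ p, (l p * raise p (fun k => displacementTerm l r k n) m
        - conj (l p) * lower p (fun k => displacementTerm l r k n) m) := by
  rw [displacementTerm, pow_succ', Module.End.mul_apply, displacementGen_apply]
  rfl

/-- The commutator `[a_p, G ^ r]` between number states. -/
lemma lower_displacementTerm (l : ι → ℂ) (p : ι) (r : ℕ) (m n : ι → ℕ) :
    lower p (fun k => displacementTerm l (r + 1) k n) m =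
      raise p (fun k => displacementTerm l (r + 1) m k) n
        + ((r + 1 : ℂ) * l p) * displacementTerm l r m n := by
  have h := congrArg (fun A : Module.End ℂ ((ι → ℕ) → ℂ) => A (Pi.single n 1) m)
    (mul_pow_succ_of_commutator (lower_mul_displacementGen l p) r)
  simp only [Module.End.mul_apply, LinearMap.add_apply, LinearMap.smul_apply, lower_single,
    map_smul, Pi.add_apply, Pi.smul_apply, smul_eq_mul] at h
  exact h

/-- The commutator `[a_p†, G ^ r]` between number states. -/
lemma raise_displacementTerm (l : ι → ℂ) (p : ι) (r : ℕ) (m n : ι → ℕ) :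
    raise p (fun k => displacementTerm l (r + 1) k n) m =
      lower p (fun k => displacementTerm l (r + 1) m k) n
        + ((r + 1 : ℂ) * conj (l p)) * displacementTerm l r m n := by
  have h := congrArg (fun A : Module.End ℂ ((ι → ℕ) → ℂ) => A (Pi.single n 1) m)
    (mul_pow_succ_of_commutator (raise_mul_displacementGen l p) r)
  simp only [Module.End.mul_apply, LinearMap.add_apply, LinearMap.smul_apply, raise_single,
    map_smul, Pi.add_apply, Pi.smul_apply, smul_eq_mul] at h
  exact h

/-! #### Convergence of the exponential series -/

/-- `G ^ r |n⟩` has at most `r` particles more than `|n⟩`, and each application of `G` costs a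
factor of the square root of the number of particles. -/
lemma displacementTerm_bound (l : ι → ℂ) (r : ℕ) (n : ι → ℕ) :
    (∀ m, size n + r < size m → displacementTerm l r m n = 0) ∧
    ∀ m, ‖displacementTerm l r m n‖ ≤
      ∏ s ∈ Finset.range r, (2 * (∑ p, ‖l p‖) * Real.sqrt (size n + s + 1)) := by
  induction r with
  | zero =>
    refine ⟨fun m hm => ?_, fun m => ?_⟩
    · have : m ≠ n := by rintro rfl; simp at hm
      simp [displacementTerm, this]
    · by_cases h : m = n <;> simp [displacementTerm, h]
  | succ r ih =>
    obtain ⟨ih1, ih2⟩ := ih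
    have hr : ∀ m p, size n + (r + 1) < size m →
        raise p (fun k => displacementTerm l r k n) m = 0 := by
      intro m p hm
      by_cases h0 : m p = 0
      · exact raise_apply_of_eq_zero h0 _
      obtain ⟨m, rfl⟩ := exists_eq_add_single h0
      rw [size_add_single] at hm
      rw [raise_apply_add_single, ih1 m (by omega), mul_zero]
    refine ⟨fun m hm => ?_, fun m => ?_⟩
    · rw [displacementTerm_succ_apply]
      refine Finset.sum_eq_zero fun p _ => ?_
      rw [hr m p hm, lower_apply, ih1 _ (by rw [size_add_single]; omega)]
      simp
    · rw [displacementTerm_succ_apply, Finset.prod_range_succ]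
      set B := ∏ s ∈ Finset.range r, (2 * (∑ p, ‖l p‖) * Real.sqrt (size n + s + 1)) with hB
      have hB0 : 0 ≤ B := (norm_nonneg _).trans (ih2 0)
      have e1 : ∀ p, ‖raise p (fun k => displacementTerm l r k n) m‖ ≤
          Real.sqrt (size n + r + 1) * B := by
        intro p
        by_cases hm : size n + (r + 1) < size m
        · rw [hr m p hm, norm_zero]; positivity
        rw [raise_apply, norm_mul, Complex.norm_real, Real.norm_of_nonneg (Real.sqrt_nonneg _)]
        gcongr
        · have := le_size m p
          have h2 : m p ≤ size n + r + 1 := by omega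
          exact_mod_cast h2
        · exact ih2 _
      have e2 : ∀ p, ‖lower p (fun k => displacementTerm l r k n) m‖ ≤
          Real.sqrt (size n + r + 1) * B := by
        intro p
        rw [lower_apply]
        by_cases hm : size n + r < size m + 1
        · rw [ih1 _ (by rw [size_add_single]; exact hm), mul_zero, norm_zero]; positivity
        rw [norm_mul, Complex.norm_real, Real.norm_of_nonneg (Real.sqrt_nonneg _)]
        gcongr
        · have := le_size m p
          have h2 : m p ≤ size n + r := by omega
          exact_mod_cast h2
        · exact ih2 _
      calc _ ≤ ∑ p, (‖l p‖ * (Real.sqrt (size n + r + 1) * B)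
            + ‖l p‖ * (Real.sqrt (size n + r + 1) * B)) := by
            refine (norm_sum_le _ _).trans (Finset.sum_le_sum fun p _ => ?_)
            refine (norm_sub_le _ _).trans ?_
            rw [norm_mul, norm_mul, RCLike.norm_conj]
            gcongr
            · exact e1 p
            · exact e2 p
        _ = _ := by
            simp only [← two_mul]
            rw [← Finset.mul_sum, ← Finset.sum_mul]
            ring

lemma summable_prod_sqrt_div_factorial (c : ℝ) (hc : 0 ≤ c) (n : ℕ) :
    Summable fun r : ℕ => (∏ s ∈ Finset.range r, (c * Real.sqrt (n + s + 1))) / r.factorial := by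
  refine summable_of_ratio_norm_eventually_le (r := 1 / 2) (by norm_num) ?_
  -- the ratio of consecutive terms is `c √(n + r + 1) / (r + 1)`
  have h : ∀ᶠ r : ℕ in atTop, 4 * c ^ 2 * (n + 1) ≤ r + 1 := by
    have := tendsto_natCast_atTop_atTop (R := ℝ)
    filter_upwards [this.eventually_ge_atTop (4 * c ^ 2 * (n + 1))] with r hr
    linarith
  filter_upwards [h] with r hr
  have h1 : c * Real.sqrt (n + r + 1) ≤ 1 / 2 * (r + 1) := by
    have h2 : Real.sqrt (n + r + 1) ≤ Real.sqrt ((n + 1) * (r + 1)) := by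
      apply Real.sqrt_le_sqrt
      nlinarith [mul_nonneg (Nat.cast_nonneg n : (0:ℝ) ≤ n) (Nat.cast_nonneg r : (0:ℝ) ≤ r)]
    refine (mul_le_mul_of_nonneg_left h2 hc).trans ?_
    refine abs_le_of_sq_le_sq' ?_ (by positivity) |>.2
    rw [mul_pow, Real.sq_sqrt (by positivity)]
    nlinarith [(Nat.cast_nonneg r : (0:ℝ) ≤ r)]
  rw [Finset.prod_range_succ, Nat.factorial_succ, norm_div, norm_div, norm_mul]
  have h3 : ‖c * Real.sqrt (n + r + 1)‖ = c * Real.sqrt (n + r + 1) :=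
    Real.norm_of_nonneg (by positivity)
  rw [h3]
  simp only [Nat.cast_mul, norm_mul, RCLike.norm_natCast]
  rw [div_le_iff₀ (by positivity)]
  have h4 : ((r + 1 : ℕ) : ℝ) = r + 1 := by push_cast; rfl
  rw [h4]
  have h5 : (r.factorial : ℝ) ≠ 0 := by positivity
  field_simp
  nlinarith [mul_le_mul_of_nonneg_left h1
    (norm_nonneg (∏ s ∈ Finset.range r, (c * Real.sqrt (n + s + 1))))]

lemma summable_pow_mul_displacementTerm (l : ι → ℂ) (m n : ι → ℕ) (c : ℝ) (hc : 0 ≤ c) :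
    Summable fun r : ℕ => c ^ r * ‖displacementTerm l r m n‖ / r.factorial := by
  refine Summable.of_nonneg_of_le (fun r => by positivity) (fun r => ?_)
    (summable_prod_sqrt_div_factorial (c * (2 * ∑ p, ‖l p‖)) (by positivity) (size n))
  gcongr
  simp only [mul_assoc c, Finset.prod_mul_distrib (f := fun _ => c), Finset.prod_const,
    Finset.card_range]
  gcongr
  simpa [mul_assoc] using (displacementTerm_bound l r n).2 m

lemma summable_displacementTerm (l : ι → ℂ) (m n : ι → ℕ) :
    Summable fun r : ℕ => displacementTerm l r m n / (r.factorial : ℂ) := by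
  refine Summable.of_norm ?_
  simpa using summable_pow_mul_displacementTerm l m n 1 zero_le_one

lemma hasSum_displacementElem (l : ι → ℂ) (m n : ι → ℕ) :
    HasSum (fun r : ℕ => displacementTerm l r m n / (r.factorial : ℂ)) (displacementElem l m n) :=
  (summable_displacementTerm l m n).hasSum

lemma hasSum_mul_displacementTerm_pred (l : ι → ℂ) (c : ℂ) (m n : ι → ℕ) :
    HasSum (fun r : ℕ => ((r + 1 : ℂ) * c) * displacementTerm l r m n / ((r + 1).factorial : ℂ))
      (c * displacementElem l m n) := by
  refine ((hasSum_displacementElem l m n).mul_left c).congr_fun fun r => ?_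
  have h1 : (r.factorial : ℂ) ≠ 0 := by exact_mod_cast r.factorial_ne_zero
  have h2 : (r + 1 : ℂ) ≠ 0 := by exact_mod_cast r.succ_ne_zero
  rw [Nat.factorial_succ]
  push_cast
  field_simp

/-- The relation `a_p D = D a_p + l_p D`. -/
lemma lower_displacementElem (l : ι → ℂ) (p : ι) (m n : ι → ℕ) :
    lower p (fun k => displacementElem l k n) m =
      raise p (fun k => displacementElem l m k) n + l p * displacementElem l m n := by
  have h1 : HasSum (fun r : ℕ => lower p (fun k => displacementTerm l r k n) m / (r.factorial : ℂ))
      (lower p (fun k => displacementElem l k n) m) := by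
    simp only [lower_apply, mul_div_assoc]
    exact (hasSum_displacementElem l _ n).mul_left _
  have h2 : HasSum (fun r : ℕ => raise p (fun k => displacementTerm l r m k) n / (r.factorial : ℂ))
      (raise p (fun k => displacementElem l m k) n) := by
    simp only [raise_apply, mul_div_assoc]
    exact (hasSum_displacementElem l m _).mul_left _
  have h0 : lower p (fun k => displacementTerm l 0 k n) m =
      raise p (fun k => displacementTerm l 0 m k) n := by
    have := congrFun (lower_single p n) m
    simp only [displacementTerm, pow_zero, Module.End.one_apply]
    exact this
  rw [← hasSum_nat_add_iff' 1] at h1 h2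
  have h3 := h2.add (hasSum_mul_displacementTerm_pred l (l p) m n)
  have h4 := h1.unique (h3.congr_fun fun r => by rw [lower_displacementTerm]; ring)
  simp only [Finset.range_one, Finset.sum_singleton, h0] at h4
  linear_combination h4

/-- The relation `a_p† D = D a_p† + l_p^* D`. -/
lemma raise_displacementElem (l : ι → ℂ) (p : ι) (m n : ι → ℕ) :
    raise p (fun k => displacementElem l k n) m =
      lower p (fun k => displacementElem l m k) n + conj (l p) * displacementElem l m n := by
  have h1 : HasSum (fun r : ℕ => raise p (fun k => displacementTerm l r k n) m / (r.factorial : ℂ))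
      (raise p (fun k => displacementElem l k n) m) := by
    simp only [raise_apply, mul_div_assoc]
    exact (hasSum_displacementElem l _ n).mul_left _
  have h2 : HasSum (fun r : ℕ => lower p (fun k => displacementTerm l r m k) n / (r.factorial : ℂ))
      (lower p (fun k => displacementElem l m k) n) := by
    simp only [lower_apply, mul_div_assoc]
    exact (hasSum_displacementElem l m _).mul_left _
  have h0 : raise p (fun k => displacementTerm l 0 k n) m =
      lower p (fun k => displacementTerm l 0 m k) n := by
    have := congrFun (raise_single p n) m
    simp only [displacementTerm, pow_zero, Module.End.one_apply]
    exact this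
  rw [← hasSum_nat_add_iff' 1] at h1 h2
  have h3 := h2.add (hasSum_mul_displacementTerm_pred l (conj (l p)) m n)
  have h4 := h1.unique (h3.congr_fun fun r => by rw [raise_displacementTerm]; ring)
  simp only [Finset.range_one, Finset.sum_singleton, h0] at h4
  linear_combination h4

/-! #### The vacuum expectation value -/

/-- The recursion for the vacuum expectation values of the powers of the generator, from the
commutator `[a_p, G ^ r]`. -/
lemma displacementTerm_add_two_zero_zero (l : ι → ℂ) (r : ℕ) :
    displacementTerm l (r + 2) 0 0 =
      -(r + 1) * (∑ p, (‖l p‖ ^ 2 : ℝ) : ℂ) * displacementTerm l r 0 0 := by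
  rw [displacementTerm_succ_apply]
  simp only [lower_displacementTerm, raise_apply_of_eq_zero (Pi.zero_apply _)]
  push_cast
  rw [Finset.mul_sum, Finset.sum_mul]
  refine Finset.sum_congr rfl fun p _ => ?_
  rw [← Complex.conj_mul']
  ring

lemma even_displacementTerm_zero_zero {t : ℕ → ℂ} {s : ℂ} (h0 : t 0 = 1)
    (hrec : ∀ r : ℕ, t (r + 2) = -(r + 1) * s * t r) (k : ℕ) :
    t (2 * k) / ((2 * k).factorial : ℂ) = (-s / 2) ^ k / (k.factorial : ℂ) := by
  induction k with
  | zero => simp [h0]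
  | succ k ih =>
    have h2 : ((2 * k).factorial : ℂ) ≠ 0 := by exact_mod_cast Nat.factorial_ne_zero _
    have h3 : (k.factorial : ℂ) ≠ 0 := by exact_mod_cast Nat.factorial_ne_zero _
    have h4 : (k + 1 : ℂ) ≠ 0 := by exact_mod_cast k.succ_ne_zero
    have h5 : (2 * k + 1 : ℂ) ≠ 0 := by exact_mod_cast (2 * k).succ_ne_zero
    have h6 : (2 * k + 1 + 1 : ℂ) ≠ 0 := by exact_mod_cast (2 * k + 1).succ_ne_zero
    rw [show 2 * (k + 1) = 2 * k + 2 by ring, hrec, Nat.factorial_succ, Nat.factorial_succ,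
      Nat.factorial_succ k, pow_succ]
    rw [div_eq_div_iff h2 h3] at ih
    push_cast
    rw [div_eq_div_iff (mul_ne_zero h6 (mul_ne_zero h5 h2)) (mul_ne_zero h4 h3)]
    linear_combination (-(2 * (k : ℂ) + 1) * s * (k + 1)) * ih

lemma odd_displacementTerm_zero_zero (l : ι → ℂ) (k : ℕ) :
    displacementTerm l (2 * k + 1) 0 0 = 0 := by
  induction k with
  | zero =>
    rw [displacementTerm_succ_apply]
    refine Finset.sum_eq_zero fun p _ => ?_
    simp [raise_apply, lower_apply, displacementTerm]
  | succ k ih =>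
    rw [show 2 * (k + 1) + 1 = 2 * k + 1 + 2 by ring, displacementTerm_add_two_zero_zero, ih,
      mul_zero]

lemma displacementElem_zero_zero (l : ι → ℂ) :
    displacementElem l 0 0 = Complex.exp (-(∑ p, (‖l p‖ ^ 2 : ℝ) : ℂ) / 2) := by
  have h3 : HasSum (fun k : ℕ => displacementTerm l (2 * k) 0 0 / ((2 * k).factorial : ℂ))
      (Complex.exp (-(∑ p, (‖l p‖ ^ 2 : ℝ) : ℂ) / 2)) := by
    have h := NormedSpace.exp_series_hasSum_exp' (𝕂 := ℂ) (-(∑ p, (‖l p‖ ^ 2 : ℝ) : ℂ) / 2)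
    rw [← Complex.exp_eq_exp_ℂ] at h
    refine h.congr_fun fun k => ?_
    rw [even_displacementTerm_zero_zero (t := fun r => displacementTerm l r 0 0)
      (by simp [displacementTerm]) (displacementTerm_add_two_zero_zero l), smul_eq_mul,
      div_eq_inv_mul]
  have h4 : HasSum (fun k : ℕ => displacementTerm l (2 * k + 1) 0 0 / ((2 * k + 1).factorial : ℂ))
      0 := by
    simp only [odd_displacementTerm_zero_zero, zero_div]
    exact hasSum_zero
  have h5 := HasSum.even_add_odd
    (f := fun r : ℕ => displacementTerm l r 0 0 / (r.factorial : ℂ)) h3 h4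
  rw [add_zero] at h5
  exact (hasSum_displacementElem l 0 0).unique h5

/-! #### Unitarity -/

lemma finite_support_lower (p : ι) {f : (ι → ℕ) → ℂ} (hf : f.support.Finite) :
    (lower p f).support.Finite := by
  refine (hf.preimage (add_left_injective (Pi.single p 1 : ι → ℕ)).injOn).subset fun N hN => ?_
  rw [Function.mem_support, lower_apply] at hN
  exact right_ne_zero_of_mul hN

lemma finite_support_raise (p : ι) {f : (ι → ℕ) → ℂ} (hf : f.support.Finite) :
    (raise p f).support.Finite := by
  refine (hf.image fun N => N + Pi.single p 1).subset fun N hN => ?_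
  have h0 : N p ≠ 0 := fun h => hN (raise_apply_of_eq_zero h f)
  obtain ⟨N, rfl⟩ := exists_eq_add_single h0
  rw [Function.mem_support, raise_apply_add_single] at hN
  exact ⟨N, right_ne_zero_of_mul hN, rfl⟩

lemma finite_support_displacementGen (l : ι → ℂ) {f : (ι → ℕ) → ℂ} (hf : f.support.Finite) :
    (displacementGen l f).support.Finite := by
  refine (Set.finite_iUnion fun p => (finite_support_raise p hf).union
    (finite_support_lower p hf)).subset fun N hN => ?_
  by_contra h
  simp only [Set.mem_iUnion, Set.mem_union, Function.mem_support, not_exists, not_or,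
    not_not] at h
  refine hN ?_
  rw [displacementGen_apply]
  exact Finset.sum_eq_zero fun p _ => by simp [h p]

lemma finite_support_displacementTerm (l : ι → ℂ) (r : ℕ) (n : ι → ℕ) :
    (Function.support fun m => displacementTerm l r m n).Finite := by
  induction r with
  | zero =>
    refine (Set.finite_singleton n).subset fun m hm => ?_
    by_contra h
    rw [Set.mem_singleton_iff] at h
    exact hm (by simp [displacementTerm, h])
  | succ r ih =>
    have := finite_support_displacementGen l ih
    convert this using 2
    ext m
    rw [displacementTerm_succ_apply, displacementGen_apply]

/-- The generator is skew-adjoint. -/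
lemma tsum_conj_displacementGen_mul (l : ι → ℂ) {f : (ι → ℕ) → ℂ} (hf : f.support.Finite)
    (g : (ι → ℕ) → ℂ) :
    ∑' m, conj (displacementGen l f m) * g m = -∑' m, conj (f m) * displacementGen l g m := by
  have hs : ∀ (u v : (ι → ℕ) → ℂ), u.support.Finite → Summable fun m => u m * v m := by
    intro u v hu
    exact summable_of_hasFiniteSupport (hu.subset fun m hm => left_ne_zero_of_mul hm)
  set f' : (ι → ℕ) → ℂ := fun m => conj (f m) with hf'
  have hfs : f'.support.Finite := hf.subset fun m hm h => hm (by simp [hf', h])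
  have e1 : ∀ p m, conj (raise p f m) = raise p f' m := by
    intro p m; simp [raise_apply, hf']
  have e2 : ∀ p m, conj (lower p f m) = lower p f' m := by
    intro p m; simp [lower_apply, hf']
  simp only [displacementGen_apply, map_sum, map_sub, map_mul, e1, e2, Complex.conj_conj,
    Finset.sum_mul, Finset.mul_sum, sub_mul, mul_sub]
  have hA : ∀ p, Summable fun m => conj (l p) * raise p f' m * g m := fun p => by
    simpa only [mul_assoc] using (hs _ g (finite_support_raise p hfs)).mul_left (conj (l p))
  have hB : ∀ p, Summable fun m => l p * lower p f' m * g m := fun p => by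
    simpa only [mul_assoc] using (hs _ g (finite_support_lower p hfs)).mul_left (l p)
  have hC : ∀ p, Summable fun m => f' m * (l p * raise p g m) := fun p => hs _ _ hfs
  have hD : ∀ p, Summable fun m => f' m * (conj (l p) * lower p g m) := fun p => hs _ _ hfs
  rw [Summable.tsum_finsetSum fun p _ => (hA p).sub (hB p),
    Summable.tsum_finsetSum fun p _ => (hC p).sub (hD p), ← Finset.sum_neg_distrib]
  refine Finset.sum_congr rfl fun p _ => ?_
  rw [(hA p).tsum_sub (hB p), (hC p).tsum_sub (hD p)]
  simp only [mul_assoc, mul_left_comm (f' _), tsum_mul_left, tsum_raise_mul, tsum_lower_mul]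
  ring

/-- As `G` is skew-adjoint, `⟨G ^ r n, G ^ s n⟩ = (-1) ^ r ⟨n, G ^ (r + s) n⟩`. -/
lemma tsum_conj_displacementTerm_mul (l : ι → ℂ) (r s : ℕ) (n : ι → ℕ) :
    ∑' m, conj (displacementTerm l r m n) * displacementTerm l s m n =
      (-1) ^ r * displacementTerm l (r + s) n n := by
  induction r generalizing s with
  | zero =>
    rw [tsum_eq_single n fun m hm => by simp [displacementTerm, hm]]
    simp [displacementTerm]
  | succ r ih =>
    have h : ∀ t m, displacementTerm l (t + 1) m n =
        displacementGen l (fun k => displacementTerm l t k n) m := fun t m => by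
      rw [displacementTerm_succ_apply, displacementGen_apply]
    simp only [h r]
    rw [tsum_conj_displacementGen_mul l (finite_support_displacementTerm l r n)]
    simp only [← h s]
    rw [ih, show r + (s + 1) = r + 1 + s by ring, pow_succ]
    ring

/-- The columns of the displacement operator are unit vectors; here, in the form of the double
series `∑_{r,s} ⟨G ^ r n, G ^ s n⟩ / (r! s!) = 1`. -/
lemma hasSum_displacementTerm_diag (l : ι → ℂ) (n : ι → ℕ) :
    HasSum (fun q : ℕ × ℕ => (-1) ^ q.1 * displacementTerm l (q.1 + q.2) n n /
      ((q.1.factorial : ℂ) * (q.2.factorial : ℂ))) 1 := by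
  set F : ℕ × ℕ → ℂ := fun q => (-1) ^ q.1 * displacementTerm l (q.1 + q.2) n n /
      ((q.1.factorial : ℂ) * (q.2.factorial : ℂ)) with hF
  have hchoose : ∀ t : ℕ, ∀ q ∈ Finset.HasAntidiagonal.antidiagonal t,
      ((t.choose q.1 : ℂ)) / t.factorial = 1 / ((q.1.factorial : ℂ) * (q.2.factorial : ℂ)) := by
    intro t q hq
    rw [Finset.HasAntidiagonal.mem_antidiagonal] at hq
    subst hq
    have h1 : (q.1.factorial : ℂ) ≠ 0 := by exact_mod_cast Nat.factorial_ne_zero _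
    have h2 : (q.2.factorial : ℂ) ≠ 0 := by exact_mod_cast Nat.factorial_ne_zero _
    have h3 : ((q.1 + q.2).factorial : ℂ) ≠ 0 := by exact_mod_cast Nat.factorial_ne_zero _
    rw [div_eq_div_iff h3 (mul_ne_zero h1 h2), one_mul, ← mul_assoc]
    have h4 := Nat.choose_mul_factorial_mul_factorial (Nat.le_add_right q.1 q.2)
    rw [Nat.add_sub_cancel_left] at h4
    exact_mod_cast h4
  have hsumm : Summable F := by
    refine Summable.of_norm ?_
    rw [← Finset.HasAntidiagonal.sigmaAntidiagonalEquivProd.summable_iff]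
    refine (summable_sigma_of_nonneg fun _ => norm_nonneg _).2 ⟨fun t => ?_, ?_⟩
    · exact Summable.of_finite
    · refine (summable_pow_mul_displacementTerm l n n 2 (by norm_num)).congr fun t => ?_
      rw [tsum_fintype]
      change _ = ∑ b : Finset.HasAntidiagonal.antidiagonal t, ‖F b‖
      rw [Finset.sum_coe_sort (Finset.HasAntidiagonal.antidiagonal t) (fun q => ‖F q‖)]
      have : ∀ q ∈ Finset.HasAntidiagonal.antidiagonal t, ‖F q‖ =
          (t.choose q.1 : ℝ) * (‖displacementTerm l t n n‖ / t.factorial) := by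
        intro q hq
        have h1 := congrArg norm (hchoose t q hq)
        rw [Finset.HasAntidiagonal.mem_antidiagonal] at hq
        simp only [norm_div, RCLike.norm_natCast, norm_mul, norm_one] at h1
        simp only [hF, hq, norm_div, norm_mul, norm_pow, norm_neg, norm_one, one_pow, one_mul,
          RCLike.norm_natCast]
        rw [div_eq_mul_one_div, ← h1]; ring
      rw [Finset.sum_congr rfl this, ← Finset.sum_mul,
        Finset.Nat.sum_antidiagonal_eq_sum_range_succ_mk]
      have h2 := Nat.sum_range_choose t
      rw [mul_div_assoc]
      congr 1
      exact_mod_cast h2.symm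
  have h1 := hsumm.hasSum
  rw [← Finset.HasAntidiagonal.sigmaAntidiagonalEquivProd.hasSum_iff] at h1
  have h2 := h1.sigma (g := fun t : ℕ => if t = 0 then 1 else 0) fun t => by
    have h3 : ∑ q ∈ Finset.HasAntidiagonal.antidiagonal t, F q = if t = 0 then 1 else 0 := by
      have : ∀ q ∈ Finset.HasAntidiagonal.antidiagonal t, F q =
          ((-1) ^ q.1 * (t.choose q.1 : ℂ)) * (displacementTerm l t n n / t.factorial) := by
        intro q hq
        have h1 := hchoose t q hq
        rw [Finset.HasAntidiagonal.mem_antidiagonal] at hq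
        simp only [hF, hq]
        rw [div_eq_mul_one_div, ← h1]; ring
      rw [Finset.sum_congr rfl this, ← Finset.sum_mul,
        Finset.Nat.sum_antidiagonal_eq_sum_range_succ_mk]
      have h2 := Int.alternating_sum_range_choose (n := t)
      have h3 : ∑ k ∈ Finset.range t.succ, (-1 : ℂ) ^ k * (t.choose k : ℂ) =
          if t = 0 then 1 else 0 := by exact_mod_cast congrArg (Int.cast : ℤ → ℂ) h2
      rw [h3]
      split_ifs with h
      · subst h; simp [displacementTerm]
      · simp
    rw [← h3, ← Finset.sum_coe_sort]
    exact hasSum_fintype _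
  rw [h2.unique (hasSum_ite_eq 0 1)] at h1
  rwa [← Finset.HasAntidiagonal.sigmaAntidiagonalEquivProd.hasSum_iff]

lemma tsum_norm_sq_partial_sum (l : ι → ℂ) (n : ι → ℕ) (s : Finset ℕ) :
    ∑' k, conj (∑ r ∈ s, displacementTerm l r k n / (r.factorial : ℂ)) *
        ∑ r ∈ s, displacementTerm l r k n / (r.factorial : ℂ) =
      ∑ q ∈ s ×ˢ s, (-1) ^ q.1 * displacementTerm l (q.1 + q.2) n n /
        ((q.1.factorial : ℂ) * (q.2.factorial : ℂ)) := by
  have hs : ∀ q ∈ s ×ˢ s, Summable fun k =>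
      conj (displacementTerm l q.1 k n) * displacementTerm l q.2 k n /
        ((q.1.factorial : ℂ) * (q.2.factorial : ℂ)) := fun q _ => by
    refine summable_of_hasFiniteSupport ((finite_support_displacementTerm l q.2 n).subset
      fun k hk h => hk ?_)
    simp only [h, mul_zero, zero_div]
  have h1 : ∀ k, conj (∑ r ∈ s, displacementTerm l r k n / (r.factorial : ℂ)) *
        ∑ r ∈ s, displacementTerm l r k n / (r.factorial : ℂ) =
      ∑ q ∈ s ×ˢ s, conj (displacementTerm l q.1 k n) * displacementTerm l q.2 k n /
        ((q.1.factorial : ℂ) * (q.2.factorial : ℂ)) := fun k => by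
    rw [map_sum, Finset.sum_mul_sum, ← Finset.sum_product']
    refine Finset.sum_congr rfl fun q _ => ?_
    rw [map_div₀, Complex.conj_natCast, div_mul_div_comm]
  rw [tsum_congr h1, Summable.tsum_finsetSum hs]
  refine Finset.sum_congr rfl fun q _ => ?_
  rw [tsum_div_const, tsum_conj_displacementTerm_mul]

/-- Matrix elements of the unitary displacement operator are bounded by one. -/
lemma norm_displacementElem_le_one (l : ι → ℂ) (m n : ι → ℕ) : ‖displacementElem l m n‖ ≤ 1 := by
  -- partial sums of the column have square norms tending to one
  have hD := (hasSum_displacementElem l m n).tendsto_sum_nat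
  have hsq : Tendsto (fun K : ℕ => ((Finset.range K) ×ˢ (Finset.range K) : Finset (ℕ × ℕ)))
      atTop atTop := by
    refine tendsto_atTop_finset_of_monotone (fun a b hab => ?_) fun q => ?_
    · exact Finset.product_subset_product (Finset.range_mono hab) (Finset.range_mono hab)
    · exact ⟨max q.1 q.2 + 1, by simp⟩
  have h1 := (hasSum_displacementTerm_diag l n).comp hsq
  have h2 : ∀ K : ℕ, ((‖∑ r ∈ Finset.range K, displacementTerm l r m n / (r.factorial : ℂ)‖ ^ 2)) ≤
      (∑ q ∈ (Finset.range K) ×ˢ (Finset.range K),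
        (-1) ^ q.1 * displacementTerm l (q.1 + q.2) n n /
          ((q.1.factorial : ℂ) * (q.2.factorial : ℂ))).re := by
    intro K
    rw [← tsum_norm_sq_partial_sum]
    simp only [Complex.conj_mul', ← Complex.ofReal_pow, ← Complex.ofReal_tsum, Complex.ofReal_re]
    have hfin : (Function.support fun k => ‖∑ r ∈ Finset.range K,
        displacementTerm l r k n / (r.factorial : ℂ)‖ ^ 2).Finite := by
      refine ((Finset.range K).finite_toSet.biUnion fun r _ =>
        finite_support_displacementTerm l r n).subset fun k hk => ?_
      by_contra h
      simp only [Set.mem_iUnion, Function.mem_support, not_exists, not_not] at h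
      have h0 : ∑ r ∈ Finset.range K, displacementTerm l r k n / (r.factorial : ℂ) = 0 :=
        Finset.sum_eq_zero fun r hr => by rw [h r hr, zero_div]
      exact hk (by simp [h0])
    exact (summable_of_hasFiniteSupport hfin).le_tsum m fun k _ => by positivity
  have h3 := le_of_tendsto_of_tendsto' (hD.norm.pow 2)
    ((Complex.continuous_re.tendsto 1).comp h1) h2
  simpa using h3

end Displacement

/-! ### Wirtinger calculus on phase space -/

section Wirtinger

variable {C : ℕ} {M : Fin C → ℕ}

/-- The modes of all components. -/
abbrev Mode (M : Fin C → ℕ) := Σ j : Fin C, Fin (M j)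

/-- The amplitude of a mode, as a linear functional on phase space. -/
def coord (i : Mode M) : Phase M →L[ℝ] ℂ :=
  (ContinuousLinearMap.proj i.2 : (Fin (M i.1) → ℂ) →L[ℝ] ℂ).comp (ContinuousLinearMap.proj i.1)

/-- The complex conjugate of the amplitude of a mode. -/
def coordBar (i : Mode M) : Phase M →L[ℝ] ℂ :=
  (Complex.conjCLE : ℂ →L[ℝ] ℂ).comp (coord i)

@[simp] lemma coord_apply (i : Mode M) (z : Phase M) : coord i z = z i.1 i.2 := rfl

@[simp] lemma coordBar_apply (i : Mode M) (z : Phase M) : coordBar i z = conj (z i.1 i.2) := rfl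

/-- The real-linear form `∑ i, (a i dα_i + b i dα_i^*)`. -/
def wirtingerForm (a b : Mode M → ℂ) : Phase M →L[ℝ] ℂ :=
  ∑ i, (a i • coord i + b i • coordBar i)

lemma wirtingerForm_apply (a b : Mode M → ℂ) (v : Phase M) :
    wirtingerForm a b v = ∑ i : Mode M, (a i * v i.1 i.2 + b i * conj (v i.1 i.2)) := by
  simp [wirtingerForm]

/-- `F` is real differentiable at `z`, with Wirtinger derivatives `∂F/∂α_i = a i` and
`∂F/∂α_i^* = b i`. -/
def HasWirtinger (F : Phase M → ℂ) (a b : Mode M → ℂ) (z : Phase M) : Prop :=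
  HasFDerivAt F (wirtingerForm a b) z

lemma modeVec_apply (i k : Mode M) (c : ℂ) :
    (modeVec i.1 i.2 c : Phase M) k.1 k.2 = if k = i then c else 0 := by
  obtain ⟨j, p⟩ := i
  obtain ⟨j', p'⟩ := k
  by_cases h : j' = j
  · subst h
    by_cases h2 : p' = p <;> simp [modeVec, h2]
  · simp [modeVec, h]

lemma wirtingerForm_modeVec (a b : Mode M → ℂ) (i : Mode M) (c : ℂ) :
    wirtingerForm a b (modeVec i.1 i.2 c) = a i * c + b i * conj c := by
  rw [wirtingerForm_apply, Finset.sum_eq_single i]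
  · simp only [modeVec_apply, if_true]
  · intro k _ hk
    simp only [modeVec_apply, if_neg hk, map_zero, mul_zero, add_zero]
  · simp

namespace HasWirtinger

variable {F G : Phase M → ℂ} {a b c d : Mode M → ℂ} {z : Phase M}

lemma congr_deriv (h : HasWirtinger F a b z) (ha : ∀ i, a i = c i) (hb : ∀ i, b i = d i) :
    HasWirtinger F c d z := by
  rwa [← funext ha, ← funext hb]

lemma const (x : ℂ) : HasWirtinger (fun _ => x) (fun _ => 0) (fun _ => 0) z := by
  have : wirtingerForm (fun _ : Mode M => (0 : ℂ)) (fun _ => 0) = 0 := by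
    ext v; simp [wirtingerForm_apply]
  rw [HasWirtinger, this]
  exact hasFDerivAt_const x z

lemma add (h : HasWirtinger F a b z) (h' : HasWirtinger G c d z) :
    HasWirtinger (fun y => F y + G y) (fun i => a i + c i) (fun i => b i + d i) z := by
  refine (HasFDerivAt.add h h').congr_fderiv ?_
  ext v
  simp only [ContinuousLinearMap.add_apply, wirtingerForm_apply, ← Finset.sum_add_distrib]
  exact Finset.sum_congr rfl fun i _ => by ring

lemma mul (h : HasWirtinger F a b z) (h' : HasWirtinger G c d z) :
    HasWirtinger (fun y => F y * G y) (fun i => a i * G z + F z * c i)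
      (fun i => b i * G z + F z * d i) z := by
  refine (HasFDerivAt.mul h h').congr_fderiv ?_
  ext v
  simp only [ContinuousLinearMap.add_apply, ContinuousLinearMap.smul_apply, smul_eq_mul,
    wirtingerForm_apply, Finset.mul_sum, ← Finset.sum_add_distrib]
  exact Finset.sum_congr rfl fun i _ => by ring

lemma const_mul (x : ℂ) (h : HasWirtinger F a b z) :
    HasWirtinger (fun y => x * F y) (fun i => x * a i) (fun i => x * b i) z :=
  ((const x).mul h).congr_deriv (fun i => by ring) (fun i => by ring)

lemma sum {κ : Type*} {s : Finset κ} {F : κ → Phase M → ℂ} {a b : κ → Mode M → ℂ}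
    (h : ∀ k ∈ s, HasWirtinger (F k) (a k) (b k) z) :
    HasWirtinger (fun y => ∑ k ∈ s, F k y) (fun i => ∑ k ∈ s, a k i)
      (fun i => ∑ k ∈ s, b k i) z := by
  refine (HasFDerivAt.fun_sum h).congr_fderiv ?_
  ext v
  simp only [ContinuousLinearMap.sum_apply, wirtingerForm_apply, Finset.sum_mul]
  rw [Finset.sum_comm]
  simp only [Finset.sum_add_distrib]

lemma coord (k : Mode M) : HasWirtinger (fun y : Phase M => y k.1 k.2)
    (fun i => if i = k then 1 else 0) (fun _ => 0) z := by
  refine (FunctionalWigner.coord k).hasFDerivAt.congr_fderiv ?_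
  ext v
  simp [wirtingerForm_apply]

lemma coordBar (k : Mode M) : HasWirtinger (fun y : Phase M => conj (y k.1 k.2))
    (fun _ => 0) (fun i => if i = k then 1 else 0) z := by
  refine (FunctionalWigner.coordBar k).hasFDerivAt.congr_fderiv ?_
  ext v
  simp [wirtingerForm_apply]

lemma cexp (h : HasWirtinger F a b z) :
    HasWirtinger (fun y => Complex.exp (F y)) (fun i => Complex.exp (F z) * a i)
      (fun i => Complex.exp (F z) * b i) z := by
  refine (HasFDerivAt.cexp h).congr_fderiv ?_
  ext v
  simp only [ContinuousLinearMap.smul_apply, smul_eq_mul, wirtingerForm_apply, Finset.mul_sum]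
  exact Finset.sum_congr rfl fun i _ => by ring

lemma starRingEnd (h : HasWirtinger F a b z) :
    HasWirtinger (fun y => conj (F y)) (fun i => conj (b i))
      (fun i => conj (a i)) z := by
  refine ((Complex.conjCLE : ℂ →L[ℝ] ℂ).hasFDerivAt.comp z h).congr_fderiv ?_
  ext v
  simp only [ContinuousLinearMap.comp_apply, ContinuousLinearEquiv.coe_coe, Complex.conjCLE_apply,
    wirtingerForm_apply, map_sum, map_add, map_mul, Complex.conj_conj]
  exact Finset.sum_congr rfl fun i _ => by ring

lemma wirtinger_eq (h : HasWirtinger F a b z) (i : Mode M) : wirtinger i.1 i.2 F z = a i := by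
  rw [wirtinger, (HasFDerivAt.hasLineDerivAt h _).lineDeriv,
    (HasFDerivAt.hasLineDerivAt h _).lineDeriv, wirtingerForm_modeVec, wirtingerForm_modeVec]
  simp only [map_one, mul_one, Complex.conj_I]
  linear_combination (-(a i) / 2 + b i / 2) * Complex.I_mul_I

lemma wirtingerBar_eq (h : HasWirtinger F a b z) (i : Mode M) :
    wirtingerBar i.1 i.2 F z = b i := by
  rw [wirtingerBar, (HasFDerivAt.hasLineDerivAt h _).lineDeriv,
    (HasFDerivAt.hasLineDerivAt h _).lineDeriv, wirtingerForm_modeVec, wirtingerForm_modeVec]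
  simp only [map_one, mul_one, Complex.conj_I]
  linear_combination ((a i) / 2 - b i / 2) * Complex.I_mul_I

/-- Integration by parts for Wirtinger derivatives. -/
lemma integral_mul_eq_neg {A B A' B' : Phase M → Mode M → ℂ}
    (hF : ∀ z, HasWirtinger F (A z) (B z) z) (hG : ∀ z, HasWirtinger G (A' z) (B' z) z)
    (i : Mode M) (hFG : Integrable fun z => F z * G z)
    (hA : Integrable fun z => A z i * G z) (hB : Integrable fun z => B z i * G z)
    (hA' : Integrable fun z => F z * A' z i) (hB' : Integrable fun z => F z * B' z i) :
    (∫ z, F z * A' z i = -∫ z, A z i * G z) ∧ ∫ z, F z * B' z i = -∫ z, B z i * G z := by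
  have key : ∀ c : ℂ, c * (∫ z, F z * A' z i) + conj c * (∫ z, F z * B' z i) =
      -(c * (∫ z, A z i * G z) + conj c * (∫ z, B z i * G z)) := by
    intro c
    have h1 : ∀ z, F z * wirtingerForm (A' z) (B' z) (modeVec i.1 i.2 c) =
        c * (F z * A' z i) + conj c * (F z * B' z i) := fun z => by
      rw [wirtingerForm_modeVec]; ring
    have h2 : ∀ z, wirtingerForm (A z) (B z) (modeVec i.1 i.2 c) * G z =
        c * (A z i * G z) + conj c * (B z i * G z) := fun z => by
      rw [wirtingerForm_modeVec]; ring
    have h3 := integral_bilinear_hasFDerivAt_right_eq_neg_left_of_integrable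
      (B := ContinuousLinearMap.mul ℝ ℂ) (v := modeVec i.1 i.2 c)
      (μ := (volume : Measure (Phase M)))
      (f := F) (g := G)
      (f' := fun z => wirtingerForm (A z) (B z)) (g' := fun z => wirtingerForm (A' z) (B' z))
      (by simp only [ContinuousLinearMap.mul_apply', h2]
          exact (hA.const_mul _).add (hB.const_mul _))
      (by simp only [ContinuousLinearMap.mul_apply', h1]
          exact (hA'.const_mul _).add (hB'.const_mul _))
      (by simpa using hFG) (fun z _ => hF z) (fun z _ => hG z)
    simp only [ContinuousLinearMap.mul_apply', h1, h2] at h3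
    rwa [integral_add (hA'.const_mul _) (hB'.const_mul _),
      integral_add (hA.const_mul _) (hB.const_mul _), integral_const_mul, integral_const_mul,
      integral_const_mul, integral_const_mul] at h3
  have k1 := key 1
  have k2 := key Complex.I
  simp only [map_one, one_mul, Complex.conj_I] at k1 k2
  have hI := Complex.I_mul_I
  constructor
  · linear_combination (1 / 2 : ℂ) * k1 - (Complex.I / 2) * k2
      + ((1 / 2 : ℂ) * ((∫ z, F z * A' z i) + ∫ z, A z i * G z)
        - (1 / 2 : ℂ) * ((∫ z, F z * B' z i) + ∫ z, B z i * G z)) * hI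
  · linear_combination (1 / 2 : ℂ) * k1 + (Complex.I / 2) * k2
      - ((1 / 2 : ℂ) * ((∫ z, F z * A' z i) + ∫ z, A z i * G z)
        - (1 / 2 : ℂ) * ((∫ z, F z * B' z i) + ∫ z, B z i * G z)) * hI

end HasWirtinger

end Wirtinger

/-! ### Displacement operators of all components -/

section Characteristic

variable {C : ℕ} {M : Fin C → ℕ}

/-- Labels of pairs of number states: `inl i` counts the particles of mode `i` in the first state
(row), `inr i` those in the second state (column). -/
abbrev Label (M : Fin C → ℕ) := Mode M ⊕ Mode M

/-- The first number state of a pair. -/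
def rowOcc (N : Label M → ℕ) : MultiOcc M := fun j p => N (Sum.inl ⟨j, p⟩)

/-- The second number state of a pair. -/
def colOcc (N : Label M → ℕ) : MultiOcc M := fun j p => N (Sum.inr ⟨j, p⟩)

/-- Expectations of the displacement operators: `charElem l N = ⟨n| ∏ j, D̂_j(l_j) |m⟩` is
`Tr {|m⟩⟨n| ∏ j, D̂_j(l_j)}` for the pair `N` of the number states `m` and `n`. -/
def charElem (l : Phase M) (N : Label M → ℕ) : ℂ :=
  ∏ j, displacementElem (l j) (colOcc N j) (rowOcc N j)

lemma rowOcc_add_inl (N : Label M → ℕ) (i : Mode M) :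
    rowOcc (N + Pi.single (Sum.inl i) 1) =
      rowOcc N + Pi.single i.1 (Pi.single i.2 1) := by
  obtain ⟨j, p⟩ := i
  ext j' p'
  by_cases h : j' = j
  · subst h
    by_cases h2 : p' = p <;> simp [rowOcc, h2]
  · simp [rowOcc, h]

lemma rowOcc_sub_inl (N : Label M → ℕ) (i : Mode M) :
    rowOcc (N - Pi.single (Sum.inl i) 1) =
      rowOcc N - Pi.single i.1 (Pi.single i.2 1) := by
  obtain ⟨j, p⟩ := i
  ext j' p'
  by_cases h : j' = j
  · subst h
    by_cases h2 : p' = p <;> simp [rowOcc, h2]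
  · simp [rowOcc, h]

lemma colOcc_add_inr (N : Label M → ℕ) (i : Mode M) :
    colOcc (N + Pi.single (Sum.inr i) 1) =
      colOcc N + Pi.single i.1 (Pi.single i.2 1) := by
  obtain ⟨j, p⟩ := i
  ext j' p'
  by_cases h : j' = j
  · subst h
    by_cases h2 : p' = p <;> simp [colOcc, h2]
  · simp [colOcc, h]

lemma colOcc_sub_inr (N : Label M → ℕ) (i : Mode M) :
    colOcc (N - Pi.single (Sum.inr i) 1) =
      colOcc N - Pi.single i.1 (Pi.single i.2 1) := by
  obtain ⟨j, p⟩ := i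
  ext j' p'
  by_cases h : j' = j
  · subst h
    by_cases h2 : p' = p <;> simp [colOcc, h2]
  · simp [colOcc, h]

@[simp] lemma colOcc_add_inl (N : Label M → ℕ) (i : Mode M) :
    colOcc (N + Pi.single (Sum.inl i) 1) = colOcc N := by
  ext j p; simp [colOcc]

@[simp] lemma colOcc_sub_inl (N : Label M → ℕ) (i : Mode M) :
    colOcc (N - Pi.single (Sum.inl i) 1) = colOcc N := by
  ext j p; simp [colOcc]

@[simp] lemma rowOcc_add_inr (N : Label M → ℕ) (i : Mode M) :
    rowOcc (N + Pi.single (Sum.inr i) 1) = rowOcc N := by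
  ext j p; simp [rowOcc]

@[simp] lemma rowOcc_sub_inr (N : Label M → ℕ) (i : Mode M) :
    rowOcc (N - Pi.single (Sum.inr i) 1) = rowOcc N := by
  ext j p; simp [rowOcc]

/-- The factor of `charElem` from the components other than `j`. -/
def charRest (j : Fin C) (l : Phase M) (m n : MultiOcc M) : ℂ :=
  ∏ j' ∈ Finset.univ.erase j, displacementElem (l j') (n j') (m j')

lemma charElem_eq (j : Fin C) (l : Phase M) (N : Label M → ℕ) :
    charElem l N = displacementElem (l j) (colOcc N j) (rowOcc N j) *
      charRest j l (rowOcc N) (colOcc N) :=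
  (Finset.mul_prod_erase _ _ (Finset.mem_univ j)).symm

lemma charRest_congr {j : Fin C} (l : Phase M) {m n m' n' : MultiOcc M}
    (hm : ∀ k ≠ j, m k = m' k) (hn : ∀ k ≠ j, n k = n' k) :
    charRest j l m n = charRest j l m' n' := by
  refine Finset.prod_congr rfl fun k hk => ?_
  rw [hm k (Finset.ne_of_mem_erase hk), hn k (Finset.ne_of_mem_erase hk)]

lemma lower_inr_charElem (l : Phase M) (i : Mode M) (N : Label M → ℕ) :
    lower (Sum.inr i) (charElem l) N =
      lower i.2 (fun k => displacementElem (l i.1) k (rowOcc N i.1)) (colOcc N i.1) *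
        charRest i.1 l (rowOcc N) (colOcc N) := by
  rw [lower_apply, lower_apply, charElem_eq i.1, colOcc_add_inr, rowOcc_add_inr, mul_assoc,
    charRest_congr (m' := rowOcc N) (n' := colOcc N) l (fun _ _ => rfl)
      (fun k hk => by simp [hk])]
  simp [colOcc]

lemma raise_inr_charElem (l : Phase M) (i : Mode M) (N : Label M → ℕ) :
    raise (Sum.inr i) (charElem l) N =
      raise i.2 (fun k => displacementElem (l i.1) k (rowOcc N i.1)) (colOcc N i.1) *
        charRest i.1 l (rowOcc N) (colOcc N) := by
  rw [raise_apply, raise_apply, charElem_eq i.1, colOcc_sub_inr, rowOcc_sub_inr, mul_assoc,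
    charRest_congr (m' := rowOcc N) (n' := colOcc N) l (fun _ _ => rfl)
      (fun k hk => by simp [hk])]
  simp [colOcc]

lemma lower_inl_charElem (l : Phase M) (i : Mode M) (N : Label M → ℕ) :
    lower (Sum.inl i) (charElem l) N =
      lower i.2 (fun k => displacementElem (l i.1) (colOcc N i.1) k) (rowOcc N i.1) *
        charRest i.1 l (rowOcc N) (colOcc N) := by
  rw [lower_apply, lower_apply, charElem_eq i.1, colOcc_add_inl, rowOcc_add_inl, mul_assoc,
    charRest_congr (m' := rowOcc N) (n' := colOcc N) l (fun k hk => by simp [hk])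
      (fun _ _ => rfl)]
  simp [rowOcc]

lemma raise_inl_charElem (l : Phase M) (i : Mode M) (N : Label M → ℕ) :
    raise (Sum.inl i) (charElem l) N =
      raise i.2 (fun k => displacementElem (l i.1) (colOcc N i.1) k) (rowOcc N i.1) *
        charRest i.1 l (rowOcc N) (colOcc N) := by
  rw [raise_apply, raise_apply, charElem_eq i.1, colOcc_sub_inl, rowOcc_sub_inl, mul_assoc,
    charRest_congr (m' := rowOcc N) (n' := colOcc N) l (fun k hk => by simp [hk])
      (fun _ _ => rfl)]
  simp [rowOcc]

/-- Multiplication by an amplitude: `l_i D = [a_i, D]`. -/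
lemma coord_smul_charElem (i : Mode M) (l : Phase M) :
    l i.1 i.2 • charElem l = lower (Sum.inr i) (charElem l) - raise (Sum.inl i) (charElem l) := by
  ext N
  rw [Pi.sub_apply, lower_inr_charElem, raise_inl_charElem,
    lower_displacementElem, Pi.smul_apply, charElem_eq i.1, smul_eq_mul]
  ring

/-- Multiplication by a conjugate amplitude: `l_i^* D = [a_i†, D]`. -/
lemma coordBar_smul_charElem (i : Mode M) (l : Phase M) :
    conj (l i.1 i.2) • charElem l =
      raise (Sum.inr i) (charElem l) - lower (Sum.inl i) (charElem l) := by
  ext N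
  rw [Pi.sub_apply, raise_inr_charElem, lower_inl_charElem,
    raise_displacementElem, Pi.smul_apply, charElem_eq i.1, smul_eq_mul]
  ring

lemma norm_charElem_le_one (l : Phase M) (N : Label M → ℕ) : ‖charElem l N‖ ≤ 1 := by
  rw [charElem, norm_prod]
  exact Finset.prod_le_one (fun _ _ => norm_nonneg _) fun j _ => norm_displacementElem_le_one _ _ _

lemma charElem_zero (l : Phase M) :
    charElem l 0 = Complex.exp (∑ i : Mode M, -1 / 2 * (l i.1 i.2 * conj (l i.1 i.2))) := by
  have h : ∀ j, displacementElem (l j) (colOcc (0 : Label M → ℕ) j) (rowOcc (0 : Label M → ℕ) j) =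
      Complex.exp (∑ p, -1 / 2 * (l j p * conj (l j p))) := fun j => by
    have h0 := displacementElem_zero_zero (l j)
    rw [show rowOcc (0 : Label M → ℕ) j = 0 from rfl, show colOcc (0 : Label M → ℕ) j = 0 from rfl,
      h0, neg_div, Finset.sum_div, ← Finset.sum_neg_distrib]
    congr 1
    refine Finset.sum_congr rfl fun p _ => ?_
    rw [Complex.mul_conj']; push_cast; ring
  rw [charElem, Finset.prod_congr rfl fun j _ => h j, ← Complex.exp_sum, Fintype.sum_sigma]

/-- The ladder operator that represents `∂/∂l_i` on displacement operators,
`∂D/∂l_i = (a_i† D + D a_i†) / 2`. -/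
def charDeriv (i : Mode M) : Module.End ℂ ((Label M → ℕ) → ℂ) :=
  (1 / 2 : ℂ) • (raise (Sum.inr i) + lower (Sum.inl i))

/-- The ladder operator that represents `∂/∂l_i^*` on displacement operators,
`∂D/∂l_i^* = -(a_i D + D a_i) / 2`. -/
def charDerivBar (i : Mode M) : Module.End ℂ ((Label M → ℕ) → ℂ) :=
  (-1 / 2 : ℂ) • (lower (Sum.inr i) + raise (Sum.inl i))

lemma lower_inr_mul_charDeriv (i k : Mode M) : lower (Sum.inr i) * charDeriv k =
    charDeriv k * lower (Sum.inr i) + if i = k then (1 / 2 : ℂ) • (1 : Module.End ℂ _) else 0 := by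
  simp only [charDeriv, mul_smul_comm, smul_mul_assoc, mul_add, add_mul, lower_mul_raise,
    lower_mul_lower (Sum.inr i), Sum.inr.injEq]
  split_ifs <;> module

lemma raise_inl_mul_charDeriv (i k : Mode M) : raise (Sum.inl i) * charDeriv k =
    charDeriv k * raise (Sum.inl i) - if i = k then (1 / 2 : ℂ) • (1 : Module.End ℂ _) else 0 := by
  simp only [charDeriv, mul_smul_comm, smul_mul_assoc, mul_add, add_mul, lower_mul_raise,
    raise_mul_raise (Sum.inl i), Sum.inl.injEq, eq_comm (a := k)]
  split_ifs <;> module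

lemma lower_inr_mul_charDerivBar (i k : Mode M) : lower (Sum.inr i) * charDerivBar k =
    charDerivBar k * lower (Sum.inr i) := by
  simp only [charDerivBar, mul_smul_comm, smul_mul_assoc, mul_add, add_mul, lower_mul_raise,
    lower_mul_lower (Sum.inr i), reduceCtorEq, if_false, add_zero]

lemma raise_inl_mul_charDerivBar (i k : Mode M) : raise (Sum.inl i) * charDerivBar k =
    charDerivBar k * raise (Sum.inl i) := by
  simp only [charDerivBar, mul_smul_comm, smul_mul_assoc, mul_add, add_mul, lower_mul_raise,
    raise_mul_raise (Sum.inl i), reduceCtorEq, if_false, add_zero]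

lemma lower_inl_mul_charDeriv (i k : Mode M) : lower (Sum.inl i) * charDeriv k =
    charDeriv k * lower (Sum.inl i) := by
  simp only [charDeriv, mul_smul_comm, smul_mul_assoc, mul_add, add_mul, lower_mul_raise,
    lower_mul_lower (Sum.inl i), reduceCtorEq, if_false, add_zero]

lemma raise_inr_mul_charDeriv (i k : Mode M) : raise (Sum.inr i) * charDeriv k =
    charDeriv k * raise (Sum.inr i) := by
  simp only [charDeriv, mul_smul_comm, smul_mul_assoc, mul_add, add_mul, lower_mul_raise,
    raise_mul_raise (Sum.inr i), reduceCtorEq, if_false, add_zero]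

lemma lower_inl_mul_charDerivBar (i k : Mode M) : lower (Sum.inl i) * charDerivBar k =
    charDerivBar k * lower (Sum.inl i) -
      if i = k then (1 / 2 : ℂ) • (1 : Module.End ℂ _) else 0 := by
  simp only [charDerivBar, mul_smul_comm, smul_mul_assoc, mul_add, add_mul, lower_mul_raise,
    lower_mul_lower (Sum.inl i), Sum.inl.injEq]
  split_ifs <;> module

lemma raise_inr_mul_charDerivBar (i k : Mode M) : raise (Sum.inr i) * charDerivBar k =
    charDerivBar k * raise (Sum.inr i) +
      if i = k then (1 / 2 : ℂ) • (1 : Module.End ℂ _) else 0 := by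
  simp only [charDerivBar, mul_smul_comm, smul_mul_assoc, mul_add, add_mul, lower_mul_raise,
    raise_mul_raise (Sum.inr i), Sum.inr.injEq, eq_comm (a := k)]
  split_ifs <;> module

lemma lower_inr_charDeriv_charElem (i k : Mode M) (l : Phase M) (N : Label M → ℕ) :
    lower (Sum.inr i) (charDeriv k (charElem l)) N =
      raise (Sum.inl i) (charDeriv k (charElem l)) N
        + (if k = i then 1 else 0) * charElem l N + l i.1 i.2 * charDeriv k (charElem l) N := by
  have h1 := LinearMap.congr_fun (lower_inr_mul_charDeriv i k) (charElem l)
  have h2 := LinearMap.congr_fun (raise_inl_mul_charDeriv i k) (charElem l)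
  have h3 := congrArg (charDeriv k) (coord_smul_charElem i l)
  rw [map_smul, map_sub] at h3
  simp only [Module.End.mul_apply, LinearMap.add_apply, LinearMap.sub_apply] at h1 h2
  have h1 := congrFun h1 N
  have h2 := congrFun h2 N
  have h3 := congrFun h3 N
  simp only [Pi.add_apply, Pi.sub_apply, Pi.smul_apply, smul_eq_mul] at h1 h2 h3
  rw [h1, h2, h3]
  by_cases h : i = k
  · simp only [h, if_true, LinearMap.smul_apply, Module.End.one_apply, Pi.smul_apply, smul_eq_mul]
    ring
  · simp only [h, Ne.symm h, if_false, LinearMap.zero_apply, Pi.zero_apply]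
    ring

lemma lower_inr_charDerivBar_charElem (i k : Mode M) (l : Phase M) (N : Label M → ℕ) :
    lower (Sum.inr i) (charDerivBar k (charElem l)) N =
      raise (Sum.inl i) (charDerivBar k (charElem l)) N
        + l i.1 i.2 * charDerivBar k (charElem l) N := by
  have h1 := LinearMap.congr_fun (lower_inr_mul_charDerivBar i k) (charElem l)
  have h2 := LinearMap.congr_fun (raise_inl_mul_charDerivBar i k) (charElem l)
  have h3 := congrArg (charDerivBar k) (coord_smul_charElem i l)
  rw [map_smul, map_sub] at h3
  simp only [Module.End.mul_apply] at h1 h2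
  have h3 := congrFun h3 N
  simp only [Pi.sub_apply, Pi.smul_apply, smul_eq_mul] at h3
  rw [h1, h2, h3]
  ring

lemma lower_inl_charDeriv_charElem (i k : Mode M) (l : Phase M) (N : Label M → ℕ) :
    lower (Sum.inl i) (charDeriv k (charElem l)) N =
      raise (Sum.inr i) (charDeriv k (charElem l)) N
        - conj (l i.1 i.2) * charDeriv k (charElem l) N := by
  have h1 := LinearMap.congr_fun (lower_inl_mul_charDeriv i k) (charElem l)
  have h2 := LinearMap.congr_fun (raise_inr_mul_charDeriv i k) (charElem l)
  have h3 := congrArg (charDeriv k) (coordBar_smul_charElem i l)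
  rw [map_smul, map_sub] at h3
  simp only [Module.End.mul_apply] at h1 h2
  have h3 := congrFun h3 N
  simp only [Pi.sub_apply, Pi.smul_apply, smul_eq_mul] at h3
  rw [h1, h2, h3]
  ring

lemma lower_inl_charDerivBar_charElem (i k : Mode M) (l : Phase M) (N : Label M → ℕ) :
    lower (Sum.inl i) (charDerivBar k (charElem l)) N =
      raise (Sum.inr i) (charDerivBar k (charElem l)) N
        - (if k = i then 1 else 0) * charElem l N
        - conj (l i.1 i.2) * charDerivBar k (charElem l) N := by
  have h1 := LinearMap.congr_fun (lower_inl_mul_charDerivBar i k) (charElem l)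
  have h2 := LinearMap.congr_fun (raise_inr_mul_charDerivBar i k) (charElem l)
  have h3 := congrArg (charDerivBar k) (coordBar_smul_charElem i l)
  rw [map_smul, map_sub] at h3
  simp only [Module.End.mul_apply, LinearMap.add_apply, LinearMap.sub_apply] at h1 h2
  have h1 := congrFun h1 N
  have h2 := congrFun h2 N
  have h3 := congrFun h3 N
  simp only [Pi.add_apply, Pi.sub_apply, Pi.smul_apply, smul_eq_mul] at h1 h2 h3
  rw [h1, h2, h3]
  by_cases h : i = k
  · simp only [h, if_true, LinearMap.smul_apply, Module.End.one_apply, Pi.smul_apply, smul_eq_mul]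
    ring
  · simp only [h, Ne.symm h, if_false, LinearMap.zero_apply, Pi.zero_apply]
    ring

/-- Differentiation of displacement operators. The vacuum element is a Gaussian, and the
commutators with creation and annihilation operators determine all others from it. -/
lemma hasWirtinger_charElem (N : Label M → ℕ) (l : Phase M) :
    HasWirtinger (fun y => charElem y N) (fun k => charDeriv k (charElem l) N)
      (fun k => charDerivBar k (charElem l) N) l := by
  induction hn : size N using Nat.strong_induction_on generalizing N with
  | _ n ih =>
  by_cases h0 : N = 0
  · subst h0
    have hz : ∀ (i : Label M) (f : (Label M → ℕ) → ℂ), raise i f 0 = 0 :=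
      fun i f => raise_apply_of_eq_zero (i := i) (N := 0) rfl f
    simp only [charElem_zero]
    refine (HasWirtinger.cexp (HasWirtinger.sum fun i _ =>
      ((HasWirtinger.coord i).mul (HasWirtinger.coordBar i)).const_mul (-1 / 2))).congr_deriv
      (fun k => ?_) fun k => ?_
    · have h := congrFun (coordBar_smul_charElem k l) 0
      rw [Pi.sub_apply, hz, Pi.smul_apply, smul_eq_mul] at h
      simp only [charDeriv, LinearMap.smul_apply, LinearMap.add_apply, Pi.smul_apply, Pi.add_apply,
        hz, smul_eq_mul]
      rw [← charElem_zero l]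
      simp only [mul_zero, add_zero, mul_ite, ite_mul, one_mul, zero_mul, Finset.sum_ite_eq,
        Finset.mem_univ, if_true]
      linear_combination (-1 / 2 : ℂ) * h
    · have h := congrFun (coord_smul_charElem k l) 0
      rw [Pi.sub_apply, hz, Pi.smul_apply, smul_eq_mul] at h
      simp only [charDerivBar, LinearMap.smul_apply, LinearMap.add_apply, Pi.smul_apply,
        Pi.add_apply, hz, smul_eq_mul]
      rw [← charElem_zero l]
      simp only [zero_mul, zero_add, mul_one, mul_zero, mul_ite, Finset.sum_ite_eq,
        Finset.mem_univ, if_true]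
      linear_combination (-1 / 2 : ℂ) * h
  · obtain ⟨i, hi⟩ : ∃ i, N i ≠ 0 := by
      by_contra! h
      exact h0 (funext h)
    obtain ⟨N, rfl⟩ := exists_eq_add_single hi
    rw [size_add_single] at hn
    have ihN := ih (size N) (by omega) N rfl
    have hs : (Real.sqrt (N i + 1) : ℂ) ≠ 0 := by
      rw [Complex.ofReal_ne_zero]; positivity
    rcases i with i | i
    · have ih' := ih (size (N - Pi.single (Sum.inr i) 1))
        (by have := size_sub_single_le N (Sum.inr i); omega) _ rfl
      have hrec : ∀ y : Phase M, charElem y (N + Pi.single (Sum.inl i) 1) =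
          (Real.sqrt (N (Sum.inl i) + 1) : ℂ)⁻¹ * ((Real.sqrt (N (Sum.inr i)) : ℂ) *
            charElem y (N - Pi.single (Sum.inr i) 1) +
              (-1) * (conj (y i.1 i.2) * charElem y N)) := by
        intro y
        have h := congrFun (coordBar_smul_charElem i y) N
        rw [Pi.sub_apply, lower_apply, raise_apply, Pi.smul_apply, smul_eq_mul] at h
        rw [eq_inv_mul_iff_mul_eq₀ hs]
        linear_combination h
      simp only [hrec]
      refine (((ih'.const_mul _).add (((HasWirtinger.coordBar i).mul ihN).const_mul
        (-1))).const_mul _).congr_deriv (fun k => ?_) fun k => ?_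
      · rw [inv_mul_eq_iff_eq_mul₀ hs]
        have h := lower_inl_charDeriv_charElem i k l N
        rw [lower_apply, raise_apply] at h
        linear_combination -h
      · rw [inv_mul_eq_iff_eq_mul₀ hs]
        have h := lower_inl_charDerivBar_charElem i k l N
        rw [lower_apply, raise_apply] at h
        linear_combination -h
    · have ih' := ih (size (N - Pi.single (Sum.inl i) 1))
        (by have := size_sub_single_le N (Sum.inl i); omega) _ rfl
      have hrec : ∀ y : Phase M, charElem y (N + Pi.single (Sum.inr i) 1) =
          (Real.sqrt (N (Sum.inr i) + 1) : ℂ)⁻¹ * ((Real.sqrt (N (Sum.inl i)) : ℂ) *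
            charElem y (N - Pi.single (Sum.inl i) 1) + y i.1 i.2 * charElem y N) := by
        intro y
        have h := congrFun (coord_smul_charElem i y) N
        rw [Pi.sub_apply, lower_apply, raise_apply, Pi.smul_apply, smul_eq_mul] at h
        rw [eq_inv_mul_iff_mul_eq₀ hs]
        linear_combination -h
      simp only [hrec]
      refine (((ih'.const_mul _).add ((HasWirtinger.coord i).mul ihN)).const_mul _).congr_deriv
        (fun k => ?_) fun k => ?_
      · rw [inv_mul_eq_iff_eq_mul₀ hs]
        have h := lower_inr_charDeriv_charElem i k l N
        rw [lower_apply, raise_apply] at h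
        linear_combination -h
      · rw [inv_mul_eq_iff_eq_mul₀ hs]
        have h := lower_inr_charDerivBar_charElem i k l N
        rw [lower_apply, raise_apply] at h
        linear_combination -h

end Characteristic

/-! ### Decay on phase space from ladder relations -/

section Decay

variable {C : ℕ} {M : Fin C → ℕ}

/-- A family of functions on phase space that decays faster than every power of the amplitudes,
with constants that grow at most polynomially in the number of particles. -/
def UniformDecay (g : Phase M → (Label M → ℕ) → ℂ) : Prop :=
  ∀ K : ℕ, PolyBounded fun z => ((‖z‖ ^ K : ℝ) : ℂ) • g z

/-- Linear operators on functions of occupation numbers that preserve polynomial growth. -/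
def PreservesPolyBounded (A : Module.End ℂ ((Label M → ℕ) → ℂ)) : Prop :=
  ∀ h : Phase M → (Label M → ℕ) → ℂ, PolyBounded h → PolyBounded fun z => A (h z)

lemma preservesPolyBounded_lower (i : Label M) : PreservesPolyBounded (lower i) :=
  fun _ h => h.lower i

lemma preservesPolyBounded_raise (i : Label M) : PreservesPolyBounded (raise i) :=
  fun _ h => h.raise i

namespace PreservesPolyBounded

variable {A B : Module.End ℂ ((Label M → ℕ) → ℂ)}

lemma add (hA : PreservesPolyBounded A) (hB : PreservesPolyBounded B) :
    PreservesPolyBounded (A + B) := fun h hh => (hA h hh).add (hB h hh)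

lemma smul (c : ℂ) (hA : PreservesPolyBounded A) : PreservesPolyBounded (c • A) :=
  fun h hh => (hA h hh).smul c

lemma sub (hA : PreservesPolyBounded A) (hB : PreservesPolyBounded B) :
    PreservesPolyBounded (A - B) := by
  rw [sub_eq_add_neg, ← neg_one_smul ℂ]; exact hA.add (hB.smul _)

end PreservesPolyBounded

lemma norm_sq_le_sum_modes (z : Phase M) : ‖z‖ ^ 2 ≤ ∑ i : Mode M, ‖z i.1 i.2‖ ^ 2 := by
  have h : ‖z‖ ≤ Real.sqrt (∑ i : Mode M, ‖z i.1 i.2‖ ^ 2) := by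
    rw [pi_norm_le_iff_of_nonneg (Real.sqrt_nonneg _)]
    intro j
    rw [pi_norm_le_iff_of_nonneg (Real.sqrt_nonneg _)]
    intro p
    refine Real.le_sqrt_of_sq_le ?_
    exact Finset.single_le_sum (f := fun i : Mode M => ‖z i.1 i.2‖ ^ 2)
      (fun _ _ => by positivity) (Finset.mem_univ (⟨j, p⟩ : Mode M))
  calc ‖z‖ ^ 2 ≤ Real.sqrt (∑ i : Mode M, ‖z i.1 i.2‖ ^ 2) ^ 2 := by gcongr
    _ = _ := Real.sq_sqrt (Finset.sum_nonneg fun _ _ => by positivity)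

/-- If multiplication by every amplitude and its conjugate acts through operators that preserve
polynomial growth, then boundedness improves to decay. -/
lemma UniformDecay.of_ladder {g : Phase M → (Label M → ℕ) → ℂ} (hg : PolyBounded g)
    {X XBar : Mode M → Module.End ℂ ((Label M → ℕ) → ℂ)}
    (hX : ∀ i, PreservesPolyBounded (X i)) (hXBar : ∀ i, PreservesPolyBounded (XBar i))
    (h : ∀ i z, z i.1 i.2 • g z = X i (g z)) (hBar : ∀ i z, conj (z i.1 i.2) • g z = XBar i (g z)) :
    UniformDecay g := by
  have hw : ∀ K : ℕ, PolyBounded fun z : Phase M =>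
      (1 + ∑ i : Mode M, conj (z i.1 i.2) * z i.1 i.2) ^ K • g z := by
    intro K
    induction K with
    | zero => simpa using hg
    | succ K ih =>
      have h1 : ∀ z : Phase M, (1 + ∑ i : Mode M, conj (z i.1 i.2) * z i.1 i.2) ^ (K + 1) • g z =
          (1 + ∑ i : Mode M, conj (z i.1 i.2) * z i.1 i.2) ^ K • g z +
          ∑ i, X i (XBar i ((1 + ∑ i : Mode M, conj (z i.1 i.2) * z i.1 i.2) ^ K • g z)) := by
        intro z
        simp only [map_smul, ← hBar, ← h]
        rw [pow_succ, mul_smul, add_smul, one_smul, smul_add, Finset.sum_smul, Finset.smul_sum]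
        simp only [mul_smul]
      simp only [h1]
      exact ih.add (PolyBounded.sum _ fun i _ => hX i _ (hXBar i _ ih))
  intro K
  obtain ⟨c, k, hc⟩ := hw K
  refine ⟨c, k, fun z N => le_trans ?_ (hc z N)⟩
  have h2 : (1 + ∑ i : Mode M, conj (z i.1 i.2) * z i.1 i.2) =
      ((1 + ∑ i : Mode M, ‖z i.1 i.2‖ ^ 2 : ℝ) : ℂ) := by
    push_cast
    simp only [Complex.conj_mul']
  simp only [h2, ← Complex.ofReal_pow, Pi.smul_apply, norm_smul, Complex.norm_real]
  rw [Real.norm_of_nonneg (by positivity), Real.norm_of_nonneg (by positivity)]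
  gcongr
  nlinarith [norm_sq_le_sum_modes z, sq_nonneg (‖z‖ - 1)]

namespace UniformDecay

variable {g : Phase M → (Label M → ℕ) → ℂ}

lemma polyBounded (hg : UniformDecay g) : PolyBounded g := by simpa using hg 0

lemma exists_bound (hg : UniformDecay g) (K : ℕ) : ∃ (c : ℝ) (k : ℕ), 0 ≤ c ∧
    ∀ z N, ‖z‖ ^ K * ‖g z N‖ ≤ c * (1 + size N : ℝ) ^ k := by
  obtain ⟨c, k, hc0, hc⟩ := (hg K).exists_nonneg
  refine ⟨c, k, hc0, fun z N => le_trans (le_of_eq ?_) (hc z N)⟩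
  rw [Pi.smul_apply, norm_smul, Complex.norm_real, Real.norm_of_nonneg (by positivity)]

lemma integrable (hg : UniformDecay g) {N : Label M → ℕ} (hc : Continuous fun z => g z N) :
    Integrable fun z => g z N := by
  obtain ⟨c, k, -, h1⟩ := hg.exists_bound 0
  obtain ⟨d, l, -, h2⟩ := hg.exists_bound (0 + (volume : Measure (Phase M)).integrablePower)
  have := integrable_of_le_of_pow_mul_le (μ := (volume : Measure (Phase M))) (k := 0)
    (fun z => by simpa using h1 z N) (fun z => h2 z N) hc.aestronglyMeasurable
  simp only [pow_zero, one_mul] at this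
  exact (integrable_norm_iff hc.aestronglyMeasurable).1 this

lemma integral_norm_le (hg : UniformDecay g) : ∃ (c : ℝ) (k : ℕ), 0 ≤ c ∧
    ∀ N, ∫ z, ‖g z N‖ ≤ c * (1 + size N : ℝ) ^ k := by
  obtain ⟨c, k, hc0, h1⟩ := hg.exists_bound 0
  obtain ⟨d, l, hd0, h2⟩ := hg.exists_bound (0 + (volume : Measure (Phase M)).integrablePower)
  set I := 2 ^ (volume : Measure (Phase M)).integrablePower * ∫ z : Phase M,
    (1 + ‖z‖) ^ (-((volume : Measure (Phase M)).integrablePower : ℝ)) with hI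
  have hI0 : 0 ≤ I := mul_nonneg (by positivity) (integral_nonneg fun z => by positivity)
  refine ⟨I * (c + d), max k l, by positivity, fun N => ?_⟩
  have h3 := integral_pow_mul_le_of_le_of_pow_mul_le (μ := (volume : Measure (Phase M))) (k := 0)
    (fun z => by simpa using h1 z N) (fun z => h2 z N)
  simp only [pow_zero, one_mul] at h3
  rw [← hI] at h3
  refine h3.trans ?_
  rw [mul_assoc I]
  refine mul_le_mul_of_nonneg_left ?_ hI0
  have e1 : (1 + size N : ℝ) ^ k ≤ (1 + size N : ℝ) ^ (max k l) := by gcongr <;> simp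
  have e2 : (1 + size N : ℝ) ^ l ≤ (1 + size N : ℝ) ^ (max k l) := by gcongr <;> simp
  rw [add_mul]
  exact add_le_add (mul_le_mul_of_nonneg_left e1 hc0) (mul_le_mul_of_nonneg_left e2 hd0)

end UniformDecay

/-- The series `∑ N, T N g N`, which is the trace of the product for `g = charElem`. -/
def pairing (T : (Label M → ℕ) → ℂ) (g : Phase M → (Label M → ℕ) → ℂ) (z : Phase M) : ℂ :=
  ∑' N, T N * g z N

section Pairing

variable {T : (Label M → ℕ) → ℂ} {g : Phase M → (Label M → ℕ) → ℂ}

lemma continuous_pairing (hT : RapidDecay T) (hg : PolyBounded g)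
    (hc : ∀ N, Continuous fun z => g z N) : Continuous (pairing T g) := by
  obtain ⟨c, k, hck⟩ := hg
  refine continuous_tsum (fun N => (hc N).const_mul (T N))
    ((hT.summable_mul_pow k).mul_left c) fun N z => ?_
  rw [norm_mul, mul_left_comm]
  gcongr
  exact hck z N

lemma exists_pow_mul_pairing_le (hT : RapidDecay T) (hg : UniformDecay g) (K : ℕ) :
    ∃ c : ℝ, ∀ z, ‖z‖ ^ K * ‖pairing T g z‖ ≤ c := by
  obtain ⟨c, k, hc0, hc⟩ := hg.exists_bound K
  have hs := (hT.summable_mul_pow k).mul_left c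
  refine ⟨∑' N, c * (‖T N‖ * (1 + size N : ℝ) ^ k), fun z => ?_⟩
  have h1 : ‖z‖ ^ K * ‖pairing T g z‖ = ‖∑' N, ((‖z‖ ^ K : ℝ) : ℂ) * (T N * g z N)‖ := by
    rw [tsum_mul_left, norm_mul, Complex.norm_real, Real.norm_of_nonneg (by positivity)]
    rfl
  rw [h1]
  refine tsum_of_norm_bounded hs.hasSum fun N => ?_
  rw [norm_mul, norm_mul, Complex.norm_real, Real.norm_of_nonneg (by positivity)]
  calc _ = ‖T N‖ * (‖z‖ ^ K * ‖g z N‖) := by ring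
    _ ≤ ‖T N‖ * (c * (1 + size N : ℝ) ^ k) :=
        mul_le_mul_of_nonneg_left (hc z N) (norm_nonneg _)
    _ = _ := by ring

lemma integrable_pairing (hT : RapidDecay T) (hg : UniformDecay g)
    (hc : ∀ N, Continuous fun z => g z N) : Integrable (pairing T g) := by
  have hcont := continuous_pairing hT hg.polyBounded hc
  obtain ⟨c, h1⟩ := exists_pow_mul_pairing_le hT hg 0
  obtain ⟨d, h2⟩ := exists_pow_mul_pairing_le hT hg
    (0 + (volume : Measure (Phase M)).integrablePower)
  have := integrable_of_le_of_pow_mul_le (μ := (volume : Measure (Phase M))) (k := 0)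
    (fun z => by simpa using h1 z) h2 hcont.aestronglyMeasurable
  simp only [pow_zero, one_mul] at this
  exact (integrable_norm_iff hcont.aestronglyMeasurable).1 this

end Pairing

/-- Multiplication of the bounded matrix elements of the displacement operators by an amplitude is a
combination of ladder operators, hence they decay. -/
lemma uniformDecay_charElem : UniformDecay (charElem (M := M)) := by
  refine UniformDecay.of_ladder (X := fun i => lower (Sum.inr i) - raise (Sum.inl i))
    (XBar := fun i => raise (Sum.inr i) - lower (Sum.inl i))
    ⟨1, 0, fun z N => by simpa using norm_charElem_le_one z N⟩
    (fun i => (preservesPolyBounded_lower _).sub (preservesPolyBounded_raise _))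
    (fun i => (preservesPolyBounded_raise _).sub (preservesPolyBounded_lower _))
    coord_smul_charElem coordBar_smul_charElem

lemma continuous_charElem (N : Label M → ℕ) : Continuous fun z : Phase M => charElem z N :=
  continuous_iff_continuousAt.2 fun z => (hasWirtinger_charElem N z).continuousAt

end Decay

/-! ### Wigner functions of transitions between number states -/

section WignerElem

variable {C : ℕ} {M : Fin C → ℕ}

/-- The product of the displacement functionals of all components, a phase. -/
def phaseFactor (l α : Phase M) : ℂ :=
  Complex.exp (∑ i : Mode M, (-(l i.1 i.2) * conj (α i.1 i.2) + conj (l i.1 i.2) * α i.1 i.2))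

lemma norm_phaseFactor (l α : Phase M) : ‖phaseFactor l α‖ = 1 := by
  rw [phaseFactor, Complex.norm_exp, Complex.re_sum, Finset.sum_eq_zero, Real.exp_zero]
  intro i _
  simp [mul_comm]

lemma hasWirtinger_phaseFactor_left (l α : Phase M) :
    HasWirtinger (fun y => phaseFactor y α) (fun i => -conj (α i.1 i.2) * phaseFactor l α)
      (fun i => α i.1 i.2 * phaseFactor l α) l := by
  have h : ∀ i ∈ (Finset.univ : Finset (Mode M)), HasWirtinger
      (fun y : Phase M => -(y i.1 i.2) * conj (α i.1 i.2) + conj (y i.1 i.2) * α i.1 i.2)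
      (fun k => if i = k then -conj (α i.1 i.2) else 0) (fun k => if i = k then α i.1 i.2 else 0)
      l := by
    intro i _
    have h := (((HasWirtinger.coord (z := l) i).const_mul (-1)).mul (.const (conj (α i.1 i.2)))).add
      ((HasWirtinger.coordBar i).mul (.const (α i.1 i.2)))
    simp only [neg_one_mul] at h
    refine h.congr_deriv (fun k => ?_) fun k => ?_ <;> by_cases hk : i = k <;>
      simp [hk, eq_comm (a := k)]
  refine (HasWirtinger.sum h).cexp.congr_deriv (fun k => ?_) fun k => ?_ <;>
    simp [phaseFactor, mul_comm]

lemma hasWirtinger_phaseFactor_right (l α : Phase M) :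
    HasWirtinger (fun y => phaseFactor l y) (fun i => conj (l i.1 i.2) * phaseFactor l α)
      (fun i => -l i.1 i.2 * phaseFactor l α) α := by
  have h : ∀ i ∈ (Finset.univ : Finset (Mode M)), HasWirtinger
      (fun y : Phase M => -(l i.1 i.2) * conj (y i.1 i.2) + conj (l i.1 i.2) * y i.1 i.2)
      (fun k => if i = k then conj (l i.1 i.2) else 0) (fun k => if i = k then -(l i.1 i.2) else 0)
      α := by
    intro i _
    have h := ((HasWirtinger.coordBar (z := α) i).const_mul (-(l i.1 i.2))).add
      ((HasWirtinger.coord i).const_mul (conj (l i.1 i.2)))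
    refine h.congr_deriv (fun k => ?_) fun k => ?_ <;> by_cases hk : i = k <;>
      simp [hk, eq_comm (a := k)]
  refine (HasWirtinger.sum h).cexp.congr_deriv (fun k => ?_) fun k => ?_ <;>
    simp [phaseFactor, mul_comm]

lemma continuous_phaseFactor_left (α : Phase M) : Continuous fun l => phaseFactor l α :=
  continuous_iff_continuousAt.2 fun l => (hasWirtinger_phaseFactor_left l α).continuousAt

/-- The transform of a family of functions by the kernel of the Wigner transformation. -/
def wignerIntegral (h : Phase M → (Label M → ℕ) → ℂ) (α : Phase M) (N : Label M → ℕ) : ℂ :=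
  1 / (Real.pi : ℂ) ^ (2 * ∑ j, M j) * ∫ l, phaseFactor l α * h l N

/-- The Wigner function of the transition operator `|m⟩⟨n|`, for the pair `N` of the number states
`m` and `n`. -/
def wignerElem (α : Phase M) (N : Label M → ℕ) : ℂ := wignerIntegral charElem α N

lemma wignerIntegral_lower (i : Label M) (h : Phase M → (Label M → ℕ) → ℂ) (α : Phase M) :
    wignerIntegral (fun l => lower i (h l)) α = lower i (wignerIntegral h α) := by
  ext N
  simp only [wignerIntegral, lower_apply, mul_left_comm (phaseFactor _ _),
    integral_const_mul]
  ring

lemma wignerIntegral_raise (i : Label M) (h : Phase M → (Label M → ℕ) → ℂ) (α : Phase M) :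
    wignerIntegral (fun l => raise i (h l)) α = raise i (wignerIntegral h α) := by
  ext N
  simp only [wignerIntegral, raise_apply, mul_left_comm (phaseFactor _ _),
    integral_const_mul]
  ring

lemma integrable_phaseFactor_mul (α : Phase M) {F : Phase M → ℂ} (hF : Integrable F) :
    Integrable fun l => phaseFactor l α * F l := by
  refine (integrable_norm_iff ?_).1 ?_
  · exact (continuous_phaseFactor_left α).aestronglyMeasurable.mul hF.aestronglyMeasurable
  · simpa [norm_phaseFactor] using hF.norm

lemma integrable_charElem (N : Label M → ℕ) : Integrable fun l : Phase M => charElem l N :=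
  uniformDecay_charElem.integrable (continuous_charElem N)

lemma integrable_lower_charElem (i : Label M) (N : Label M → ℕ) :
    Integrable fun l : Phase M => lower i (charElem l) N := by
  simp only [lower_apply]
  exact (integrable_charElem _).const_mul _

lemma integrable_raise_charElem (i : Label M) (N : Label M → ℕ) :
    Integrable fun l : Phase M => raise i (charElem l) N := by
  simp only [raise_apply]
  exact (integrable_charElem _).const_mul _

lemma wignerIntegral_raise_sub_lower (i k : Label M) (α : Phase M) :
    wignerIntegral (fun l => raise i (charElem l) - lower k (charElem l)) α =
      raise i (wignerElem α) - lower k (wignerElem α) := by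
  have h1 := wignerIntegral_raise i charElem α
  have h2 := wignerIntegral_lower k charElem α
  ext N
  have h1 := congrFun h1 N
  have h2 := congrFun h2 N
  change _ = raise i (wignerIntegral charElem α) N - lower k (wignerIntegral charElem α) N
  rw [← h1, ← h2]
  simp only [wignerIntegral, Pi.sub_apply, mul_sub]
  rw [integral_sub (integrable_phaseFactor_mul α (integrable_raise_charElem i N))
    (integrable_phaseFactor_mul α (integrable_lower_charElem k N)), mul_sub]

lemma wignerIntegral_raise_add_lower (i k : Label M) (α : Phase M) :
    wignerIntegral (fun l => raise i (charElem l) + lower k (charElem l)) α =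
      raise i (wignerElem α) + lower k (wignerElem α) := by
  have h1 := wignerIntegral_raise i charElem α
  have h2 := wignerIntegral_lower k charElem α
  ext N
  have h1 := congrFun h1 N
  have h2 := congrFun h2 N
  change _ = raise i (wignerIntegral charElem α) N + lower k (wignerIntegral charElem α) N
  rw [← h1, ← h2]
  simp only [wignerIntegral, Pi.add_apply, mul_add]
  rw [integral_add (integrable_phaseFactor_mul α (integrable_raise_charElem i N))
    (integrable_phaseFactor_mul α (integrable_lower_charElem k N)), mul_add]

lemma polyBounded_wignerElem : PolyBounded (wignerElem (M := M)) := by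
  obtain ⟨c, k, hc0, hc⟩ := (uniformDecay_charElem (M := M)).integral_norm_le
  refine ⟨‖1 / (Real.pi : ℂ) ^ (2 * ∑ j, M j)‖ * c, k, fun α N => ?_⟩
  rw [wignerElem, wignerIntegral, norm_mul, mul_assoc]
  gcongr
  refine (norm_integral_le_integral_norm _).trans ?_
  simpa [norm_phaseFactor] using hc N

lemma integral_phaseFactor_mul_charDeriv (α : Phase M) (i : Mode M) (N : Label M → ℕ) :
    (∫ l, phaseFactor l α * charDeriv i (charElem l) N =
      -∫ l, -conj (α i.1 i.2) * phaseFactor l α * charElem l N) ∧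
    ∫ l, phaseFactor l α * charDerivBar i (charElem l) N =
      -∫ l, α i.1 i.2 * phaseFactor l α * charElem l N := by
  have h0 := integrable_phaseFactor_mul α (integrable_charElem N)
  refine HasWirtinger.integral_mul_eq_neg (fun l => hasWirtinger_phaseFactor_left l α)
    (fun l => hasWirtinger_charElem N l) i h0 ?_ ?_ ?_ ?_
  · simpa only [mul_assoc] using h0.const_mul (-conj (α i.1 i.2))
  · simpa only [mul_assoc] using h0.const_mul (α i.1 i.2)
  · refine integrable_phaseFactor_mul α ?_
    exact ((integrable_raise_charElem _ N).add (integrable_lower_charElem _ N)).const_mul _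
  · refine integrable_phaseFactor_mul α ?_
    exact ((integrable_lower_charElem _ N).add (integrable_raise_charElem _ N)).const_mul _

/-- Multiplication of Wigner functions by an amplitude: `α_i 𝒲[T] = 𝒲[a_i T + T a_i] / 2`. -/
lemma coord_smul_wignerElem (i : Mode M) (α : Phase M) :
    α i.1 i.2 • wignerElem α =
      ((1 / 2 : ℂ) • (raise (Sum.inl i) + lower (Sum.inr i) :
        Module.End ℂ ((Label M → ℕ) → ℂ))) (wignerElem α) := by
  ext N
  have h1 := (integral_phaseFactor_mul_charDeriv α i N).2
  have h2 := congrFun (wignerIntegral_raise_add_lower (Sum.inl i) (Sum.inr i) α) N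
  have h3 : ∀ l : Phase M, phaseFactor l α * charDerivBar i (charElem l) N = (-1 / 2) *
      (phaseFactor l α * (raise (Sum.inl i) (charElem l) + lower (Sum.inr i) (charElem l)) N) := by
    intro l
    simp only [charDerivBar, LinearMap.smul_apply, LinearMap.add_apply, Pi.smul_apply, Pi.add_apply,
      smul_eq_mul]
    ring
  simp only [h3, integral_const_mul, mul_assoc] at h1
  rw [wignerIntegral] at h2
  simp only [Pi.smul_apply, smul_eq_mul, LinearMap.smul_apply, LinearMap.add_apply, ← h2]
  rw [wignerElem, wignerIntegral]
  linear_combination (1 / (Real.pi : ℂ) ^ (2 * ∑ j, M j)) * h1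

/-- Multiplication of Wigner functions by a conjugate amplitude:
`α_i^* 𝒲[T] = 𝒲[a_i† T + T a_i†] / 2`. -/
lemma coordBar_smul_wignerElem (i : Mode M) (α : Phase M) :
    conj (α i.1 i.2) • wignerElem α =
      ((1 / 2 : ℂ) • (raise (Sum.inr i) + lower (Sum.inl i) :
        Module.End ℂ ((Label M → ℕ) → ℂ))) (wignerElem α) := by
  ext N
  have h1 := (integral_phaseFactor_mul_charDeriv α i N).1
  have h2 := congrFun (wignerIntegral_raise_add_lower (Sum.inr i) (Sum.inl i) α) N
  have h3 : ∀ l : Phase M, phaseFactor l α * charDeriv i (charElem l) N = (1 / 2) *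
      (phaseFactor l α * (raise (Sum.inr i) (charElem l) + lower (Sum.inl i) (charElem l)) N) := by
    intro l
    simp only [charDeriv, LinearMap.smul_apply, LinearMap.add_apply, Pi.smul_apply, Pi.add_apply,
      smul_eq_mul]
    ring
  simp only [h3, integral_const_mul, mul_assoc] at h1
  rw [wignerIntegral] at h2
  simp only [Pi.smul_apply, smul_eq_mul, LinearMap.smul_apply, LinearMap.add_apply, ← h2]
  rw [wignerElem, wignerIntegral]
  linear_combination (-1 / (Real.pi : ℂ) ^ (2 * ∑ j, M j)) * h1

lemma uniformDecay_wignerElem : UniformDecay (wignerElem (M := M)) :=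
  UniformDecay.of_ladder polyBounded_wignerElem
    (fun i => ((preservesPolyBounded_raise _).add (preservesPolyBounded_lower _)).smul _)
    (fun i => ((preservesPolyBounded_raise _).add (preservesPolyBounded_lower _)).smul _)
    coord_smul_wignerElem coordBar_smul_wignerElem

lemma norm_wirtingerForm_le (a b : Mode M → ℂ) :
    ‖wirtingerForm a b‖ ≤ ∑ i, (‖a i‖ + ‖b i‖) := by
  refine ContinuousLinearMap.opNorm_le_bound _ (Finset.sum_nonneg fun _ _ => by positivity)
    fun v => ?_
  rw [wirtingerForm_apply, Finset.sum_mul]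
  refine (norm_sum_le _ _).trans (Finset.sum_le_sum fun i _ => (norm_add_le _ _).trans ?_)
  have hv : ‖v i.1 i.2‖ ≤ ‖v‖ := (norm_le_pi_norm (v i.1) i.2).trans (norm_le_pi_norm v i.1)
  rw [norm_mul, norm_mul, RCLike.norm_conj, ← add_mul]
  gcongr

/-- Differentiation of Wigner functions: `∂/∂α_i 𝒲[T] = 𝒲[T a_i† - a_i† T]` and
`∂/∂α_i^* 𝒲[T] = 𝒲[a_i T - T a_i]`. -/
lemma hasWirtinger_wignerElem (N : Label M → ℕ) (α : Phase M) :
    HasWirtinger (fun β => wignerElem β N)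
      (fun i => raise (Sum.inr i) (wignerElem α) N - lower (Sum.inl i) (wignerElem α) N)
      (fun i => raise (Sum.inl i) (wignerElem α) N - lower (Sum.inr i) (wignerElem α) N) α := by
  set κ : ℂ := 1 / (Real.pi : ℂ) ^ (2 * ∑ j, M j) with hκ
  have hia : ∀ i : Mode M, Integrable fun l : Phase M => conj (l i.1 i.2) * charElem l N := by
    intro i
    have : ∀ l : Phase M, conj (l i.1 i.2) * charElem l N =
        raise (Sum.inr i) (charElem l) N - lower (Sum.inl i) (charElem l) N :=
      fun l => congrFun (coordBar_smul_charElem i l) N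
    simp only [this]
    exact (integrable_raise_charElem _ N).sub (integrable_lower_charElem _ N)
  have hib : ∀ i : Mode M, Integrable fun l : Phase M => -(l i.1 i.2) * charElem l N := by
    intro i
    have : ∀ l : Phase M, -(l i.1 i.2) * charElem l N =
        raise (Sum.inl i) (charElem l) N - lower (Sum.inr i) (charElem l) N := fun l => by
      have := congrFun (coord_smul_charElem i l) N
      simp only [Pi.smul_apply, Pi.sub_apply, smul_eq_mul] at this
      linear_combination -this
    simp only [this]
    exact (integrable_raise_charElem _ N).sub (integrable_lower_charElem _ N)
  have hc : ∀ i : Mode M, Continuous fun l : Phase M => l i.1 i.2 := fun i => (coord i).continuous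
  have hform_cont : Continuous fun l : Phase M => wirtingerForm
      (fun i => conj (l i.1 i.2) * phaseFactor l α * charElem l N)
      (fun i => -(l i.1 i.2) * phaseFactor l α * charElem l N) := by
    have h1 := continuous_phaseFactor_left α
    have h2 := continuous_charElem N
    refine continuous_finsetSum _ fun i _ => Continuous.add ?_ ?_
    · exact (((Complex.continuous_conj.comp (hc i)).mul h1).mul h2).smul continuous_const
    · exact (((hc i).neg.mul h1).mul h2).smul continuous_const
  have hbound : ∀ l β : Phase M, ‖wirtingerForm
      (fun i => conj (l i.1 i.2) * phaseFactor l β * charElem l N)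
      (fun i => -(l i.1 i.2) * phaseFactor l β * charElem l N)‖ ≤
      ∑ i : Mode M, (‖conj (l i.1 i.2) * charElem l N‖ + ‖-(l i.1 i.2) * charElem l N‖) := by
    intro l β
    refine (norm_wirtingerForm_le _ _).trans (le_of_eq (Finset.sum_congr rfl fun i _ => ?_))
    simp only [norm_mul, norm_phaseFactor, mul_one]
  have hbound_int : Integrable fun l : Phase M =>
      ∑ i : Mode M, (‖conj (l i.1 i.2) * charElem l N‖ + ‖-(l i.1 i.2) * charElem l N‖) :=
    integrable_finsetSum _ fun i _ => (hia i).norm.add (hib i).norm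
  have hmain := hasFDerivAt_integral_of_dominated_of_fderiv_le
    (μ := (volume : Measure (Phase M))) (x₀ := α) (s := Set.univ)
    (F := fun β l => phaseFactor l β * charElem l N)
    (F' := fun β l => wirtingerForm
      (fun i => conj (l i.1 i.2) * phaseFactor l β * charElem l N)
      (fun i => -(l i.1 i.2) * phaseFactor l β * charElem l N))
    (bound := fun l => ∑ i : Mode M, (‖conj (l i.1 i.2) * charElem l N‖
      + ‖-(l i.1 i.2) * charElem l N‖))
    univ_mem
    (Eventually.of_forall fun β =>
      (integrable_phaseFactor_mul β (integrable_charElem N)).aestronglyMeasurable)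
    (integrable_phaseFactor_mul α (integrable_charElem N))
    hform_cont.aestronglyMeasurable
    (Eventually.of_forall fun l β _ => hbound l β)
    hbound_int
    (Eventually.of_forall fun l β _ =>
      ((hasWirtinger_phaseFactor_right l β).mul (.const (charElem l N))).congr_deriv
        (fun i => by ring) fun i => by ring)
  refine (hmain.const_mul κ).congr_fderiv ?_
  have hform_int := hbound_int.mono' hform_cont.aestronglyMeasurable
    (Eventually.of_forall fun l => hbound l α)
  ext v
  rw [ContinuousLinearMap.smul_apply, ContinuousLinearMap.integral_apply hform_int]
  simp only [wirtingerForm_apply]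
  have ha := fun i => (integrable_phaseFactor_mul α (hia i)).mul_const (v i.1 i.2)
  have hb := fun i => (integrable_phaseFactor_mul α (hib i)).mul_const (conj (v i.1 i.2))
  have hrw : ∀ (l : Phase M) (i : Mode M),
      conj (l i.1 i.2) * phaseFactor l α * charElem l N * v i.1 i.2 +
        -(l i.1 i.2) * phaseFactor l α * charElem l N * conj (v i.1 i.2) =
      phaseFactor l α * (conj (l i.1 i.2) * charElem l N) * v i.1 i.2 +
        phaseFactor l α * (-(l i.1 i.2) * charElem l N) * conj (v i.1 i.2) := fun l i => by ring
  simp only [hrw]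
  have hab : ∀ i ∈ (Finset.univ : Finset (Mode M)), Integrable fun l : Phase M =>
      phaseFactor l α * (conj (l i.1 i.2) * charElem l N) * v i.1 i.2 +
        phaseFactor l α * (-(l i.1 i.2) * charElem l N) * conj (v i.1 i.2) :=
    fun i _ => (ha i).add (hb i)
  rw [integral_finsetSum _ hab, Finset.smul_sum]
  refine Finset.sum_congr rfl fun i _ => ?_
  rw [integral_add (ha i) (hb i), integral_mul_const, integral_mul_const, smul_add, smul_eq_mul,
    smul_eq_mul, ← mul_assoc, ← mul_assoc]
  congr 2
  · have h := congrFun (wignerIntegral_raise_sub_lower (Sum.inr i) (Sum.inl i) α) N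
    rw [Pi.sub_apply] at h
    rw [← h, wignerIntegral]
    refine congrArg (κ * ·) (integral_congr_ae (Eventually.of_forall fun l => ?_))
    exact congrArg (phaseFactor l α * ·) (congrFun (coordBar_smul_charElem i l) N)
  · have h := congrFun (wignerIntegral_raise_sub_lower (Sum.inl i) (Sum.inr i) α) N
    rw [Pi.sub_apply] at h
    rw [← h, wignerIntegral]
    refine congrArg (κ * ·) (integral_congr_ae (Eventually.of_forall fun l => ?_))
    have := congrFun (coord_smul_charElem i l) N
    simp only [Pi.smul_apply, Pi.sub_apply, smul_eq_mul] at this ⊢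
    linear_combination (-phaseFactor l α) * this

end WignerElem

/-! ### Wigner functions of rapidly decreasing operators -/

section WignerSeries

variable {C : ℕ} {M : Fin C → ℕ}

/-- The Wigner function of the operator with matrix elements `T`, as a superposition of the Wigner
functions of the transitions between number states. -/
def wignerSeries (T : (Label M → ℕ) → ℂ) : Phase M → ℂ := pairing T wignerElem

variable {T T' : (Label M → ℕ) → ℂ}

lemma summable_mul_wignerElem (hT : RapidDecay T) (α : Phase M) :
    Summable fun N => T N * wignerElem α N :=
  hT.summable_mul polyBounded_wignerElem α

lemma wignerSeries_add (hT : RapidDecay T) (hT' : RapidDecay T') :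
    wignerSeries (T + T') = wignerSeries T + wignerSeries T' := by
  ext α
  simp only [wignerSeries, pairing, Pi.add_apply, add_mul]
  exact (summable_mul_wignerElem hT α).tsum_add (summable_mul_wignerElem hT' α)

lemma wignerSeries_smul (c : ℂ) (T : (Label M → ℕ) → ℂ) :
    wignerSeries (c • T) = c • wignerSeries T := by
  ext α
  simp only [wignerSeries, pairing, Pi.smul_apply, smul_eq_mul, mul_assoc, tsum_mul_left]

lemma wignerSeries_zero : wignerSeries (0 : (Label M → ℕ) → ℂ) = 0 := by
  simpa using wignerSeries_smul 0 (0 : (Label M → ℕ) → ℂ)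

lemma wignerSeries_neg (T : (Label M → ℕ) → ℂ) : wignerSeries (-T) = -wignerSeries T := by
  simpa using wignerSeries_smul (-1) T

lemma wignerSeries_sub (hT : RapidDecay T) (hT' : RapidDecay T') :
    wignerSeries (T - T') = wignerSeries T - wignerSeries T' := by
  rw [sub_eq_add_neg, wignerSeries_add hT hT'.neg, wignerSeries_neg, sub_eq_add_neg]

lemma wignerSeries_sum {κ : Type*} (s : Finset κ) {T : κ → (Label M → ℕ) → ℂ}
    (hT : ∀ i ∈ s, RapidDecay (T i)) :
    wignerSeries (∑ i ∈ s, T i) = ∑ i ∈ s, wignerSeries (T i) := by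
  classical
  induction s using Finset.induction_on with
  | empty => simpa using wignerSeries_zero
  | insert a s ha ih =>
    rw [Finset.sum_insert ha, Finset.sum_insert ha,
      wignerSeries_add (hT a (by simp)) (RapidDecay.sum s fun i hi => hT i (by simp [hi])),
      ih fun i hi => hT i (by simp [hi])]

/-- The ladder operator that represents `∂/∂α_i`: `T ↦ T a_i† - a_i† T`. -/
def derivOp (i : Mode M) : Module.End ℂ ((Label M → ℕ) → ℂ) :=
  lower (Sum.inr i) - raise (Sum.inl i)

/-- The ladder operator that represents `∂/∂α_i^*`: `T ↦ a_i T - T a_i`. -/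
def derivBarOp (i : Mode M) : Module.End ℂ ((Label M → ℕ) → ℂ) :=
  lower (Sum.inl i) - raise (Sum.inr i)

/-- The ladder operator that represents multiplication by `α_i`: `T ↦ (a_i T + T a_i) / 2`. -/
def coordOp (i : Mode M) : Module.End ℂ ((Label M → ℕ) → ℂ) :=
  (1 / 2 : ℂ) • (lower (Sum.inl i) + raise (Sum.inr i))

/-- The ladder operator that represents multiplication by `α_i^*`:
`T ↦ (a_i† T + T a_i†) / 2`. -/
def coordBarOp (i : Mode M) : Module.End ℂ ((Label M → ℕ) → ℂ) :=
  (1 / 2 : ℂ) • (raise (Sum.inl i) + lower (Sum.inr i))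

/-- Linear operators on functions of occupation numbers that preserve rapid decay. -/
def PreservesRapidDecay (A : Module.End ℂ ((Label M → ℕ) → ℂ)) : Prop :=
  ∀ T, RapidDecay T → RapidDecay (A T)

namespace PreservesRapidDecay

variable {A B : Module.End ℂ ((Label M → ℕ) → ℂ)}

lemma lower (i : Label M) : PreservesRapidDecay (lower i) := fun _ h => h.lower i

lemma raise (i : Label M) : PreservesRapidDecay (raise i) := fun _ h => h.raise i

lemma one : PreservesRapidDecay (1 : Module.End ℂ ((Label M → ℕ) → ℂ)) := fun _ h => h

lemma add (hA : PreservesRapidDecay A) (hB : PreservesRapidDecay B) :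
    PreservesRapidDecay (A + B) := fun T h => (hA T h).add (hB T h)

lemma sub (hA : PreservesRapidDecay A) (hB : PreservesRapidDecay B) :
    PreservesRapidDecay (A - B) := fun T h => (hA T h).sub (hB T h)

lemma smul (c : ℂ) (hA : PreservesRapidDecay A) : PreservesRapidDecay (c • A) :=
  fun T h => (hA T h).smul c

lemma mul (hA : PreservesRapidDecay A) (hB : PreservesRapidDecay B) :
    PreservesRapidDecay (A * B) := fun T h => hA _ (hB T h)

lemma sum {κ : Type*} {s : Finset κ} {A : κ → Module.End ℂ ((Label M → ℕ) → ℂ)}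
    (hA : ∀ i, PreservesRapidDecay (A i)) : PreservesRapidDecay (∑ i ∈ s, A i) := fun T h => by
  rw [LinearMap.sum_apply]; exact RapidDecay.sum s fun i _ => hA i T h

lemma derivOp (i : Mode M) : PreservesRapidDecay (derivOp i) := (lower _).sub (raise _)

lemma derivBarOp (i : Mode M) : PreservesRapidDecay (derivBarOp i) := (lower _).sub (raise _)

lemma coordOp (i : Mode M) : PreservesRapidDecay (coordOp i) := ((lower _).add (raise _)).smul _

lemma coordBarOp (i : Mode M) : PreservesRapidDecay (coordBarOp i) :=
  ((raise _).add (lower _)).smul _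

end PreservesRapidDecay

lemma tsum_mul_raise_sub_lower (hT : RapidDecay T) (i k : Label M) (α : Phase M) :
    ∑' N, T N * (raise i (wignerElem α) N - lower k (wignerElem α) N) =
      wignerSeries (lower i T - raise k T) α := by
  rw [wignerSeries_sub (hT.lower i) (hT.raise k), Pi.sub_apply]
  simp only [wignerSeries, pairing, tsum_lower_mul, tsum_raise_mul, mul_sub]
  exact (hT.summable_mul (polyBounded_wignerElem.raise i) α).tsum_sub
    (hT.summable_mul (polyBounded_wignerElem.lower k) α)

lemma tsum_mul_raise_add_lower (hT : RapidDecay T) (i k : Label M) (α : Phase M) :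
    ∑' N, T N * (raise i (wignerElem α) N + lower k (wignerElem α) N) =
      wignerSeries (lower i T + raise k T) α := by
  rw [wignerSeries_add (hT.lower i) (hT.raise k), Pi.add_apply]
  simp only [wignerSeries, pairing, tsum_lower_mul, tsum_raise_mul, mul_add]
  exact (hT.summable_mul (polyBounded_wignerElem.raise i) α).tsum_add
    (hT.summable_mul (polyBounded_wignerElem.lower k) α)

lemma wignerSeries_coordOp (hT : RapidDecay T) (i : Mode M) (α : Phase M) :
    wignerSeries (coordOp i T) α = α i.1 i.2 * wignerSeries T α := by
  have h : ∀ N, α i.1 i.2 * wignerElem α N = (1 / 2 : ℂ) *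
      (raise (Sum.inl i) (wignerElem α) N + lower (Sum.inr i) (wignerElem α) N) :=
    fun N => congrFun (coord_smul_wignerElem i α) N
  have h2 : ∀ N, α i.1 i.2 * (T N * wignerElem α N) = (1 / 2 : ℂ) * (T N *
      (raise (Sum.inl i) (wignerElem α) N + lower (Sum.inr i) (wignerElem α) N)) := fun N => by
    rw [mul_left_comm, h]; ring
  rw [coordOp, LinearMap.smul_apply, wignerSeries_smul, LinearMap.add_apply, Pi.smul_apply,
    ← tsum_mul_raise_add_lower hT, wignerSeries, pairing, ← tsum_mul_left, smul_eq_mul,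
    ← tsum_mul_left]
  exact tsum_congr fun N => (h2 N).symm

lemma wignerSeries_coordBarOp (hT : RapidDecay T) (i : Mode M) (α : Phase M) :
    wignerSeries (coordBarOp i T) α = conj (α i.1 i.2) * wignerSeries T α := by
  have h : ∀ N, conj (α i.1 i.2) * wignerElem α N = (1 / 2 : ℂ) *
      (raise (Sum.inr i) (wignerElem α) N + lower (Sum.inl i) (wignerElem α) N) :=
    fun N => congrFun (coordBar_smul_wignerElem i α) N
  have h2 : ∀ N, conj (α i.1 i.2) * (T N * wignerElem α N) = (1 / 2 : ℂ) * (T N *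
      (raise (Sum.inr i) (wignerElem α) N + lower (Sum.inl i) (wignerElem α) N)) := fun N => by
    rw [mul_left_comm, h]; ring
  rw [coordBarOp, LinearMap.smul_apply, wignerSeries_smul, LinearMap.add_apply, Pi.smul_apply,
    add_comm, ← tsum_mul_raise_add_lower hT, wignerSeries, pairing, ← tsum_mul_left, smul_eq_mul,
    ← tsum_mul_left]
  exact tsum_congr fun N => (h2 N).symm

/-- The Wirtinger derivatives of `𝒲[T]` are `𝒲[T a_i† - a_i† T]` and `𝒲[a_i T - T a_i]`: the series is
differentiated term by term, and `lower` and `raise` are transposed to the coefficients. -/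
lemma hasWirtinger_wignerSeries (hT : RapidDecay T) (α : Phase M) :
    HasWirtinger (wignerSeries T) (fun i => wignerSeries (derivOp i T) α)
      (fun i => wignerSeries (derivBarOp i T) α) α := by
  let a : Phase M → (Label M → ℕ) → Mode M → ℂ := fun β N i =>
    raise (Sum.inr i) (wignerElem β) N - lower (Sum.inl i) (wignerElem β) N
  let b : Phase M → (Label M → ℕ) → Mode M → ℂ := fun β N i =>
    raise (Sum.inl i) (wignerElem β) N - lower (Sum.inr i) (wignerElem β) N
  have hpa : ∀ i k : Label M, PolyBounded fun β : Phase M =>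
      raise i (wignerElem β) - lower k (wignerElem β) := fun i k =>
    (preservesPolyBounded_raise i).sub (preservesPolyBounded_lower k) _ polyBounded_wignerElem
  -- a summable bound for the norms of the derivatives
  have hbound : ∃ B : (Label M → ℕ) → ℝ, Summable B ∧
      ∀ N β, ‖wirtingerForm (fun i => T N * a β N i) (fun i => T N * b β N i)‖ ≤ B N := by
    choose ca ka hca using fun i : Mode M => hpa (Sum.inr i) (Sum.inl i)
    choose cb kb hcb using fun i : Mode M => hpa (Sum.inl i) (Sum.inr i)
    refine ⟨fun N => ∑ i, (ca i * (‖T N‖ * (1 + size N : ℝ) ^ ka i) +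
      cb i * (‖T N‖ * (1 + size N : ℝ) ^ kb i)),
      summable_sum fun i _ => ((hT.summable_mul_pow _).mul_left _).add
        ((hT.summable_mul_pow _).mul_left _), fun N β => ?_⟩
    refine (norm_wirtingerForm_le _ _).trans (Finset.sum_le_sum fun i _ => add_le_add ?_ ?_)
    · rw [norm_mul, mul_left_comm]
      exact mul_le_mul_of_nonneg_left (hca i β N) (norm_nonneg _)
    · rw [norm_mul, mul_left_comm]
      exact mul_le_mul_of_nonneg_left (hcb i β N) (norm_nonneg _)
  obtain ⟨B, hB, hB'⟩ := hbound
  have hd : ∀ N β, HasFDerivAt (fun β => T N * wignerElem β N)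
      (wirtingerForm (fun i => T N * a β N i) (fun i => T N * b β N i)) β := fun N β =>
    (hasWirtinger_wignerElem N β).const_mul (T N)
  have h := hasFDerivAt_tsum hB hd hB' (summable_mul_wignerElem hT α) α
  refine HasFDerivAt.congr_fderiv h ?_
  have hs : Summable fun N => wirtingerForm (fun i => T N * a α N i) (fun i => T N * b α N i) :=
    Summable.of_norm_bounded hB fun N => hB' N α
  ext v
  have hv := (ContinuousLinearMap.apply ℝ ℂ v).map_tsum hs
  simp only [ContinuousLinearMap.apply_apply] at hv
  rw [hv]
  simp only [wirtingerForm_apply]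
  have hsa : ∀ i : Mode M, Summable fun N => T N * a α N i * v i.1 i.2 := fun i =>
    (hT.summable_mul (hpa (Sum.inr i) (Sum.inl i)) α).mul_right (v i.1 i.2)
  have hsb : ∀ i : Mode M, Summable fun N => T N * b α N i * conj (v i.1 i.2) := fun i =>
    (hT.summable_mul (hpa (Sum.inl i) (Sum.inr i)) α).mul_right (conj (v i.1 i.2))
  rw [Summable.tsum_finsetSum fun i _ => (hsa i).add (hsb i)]
  refine Finset.sum_congr rfl fun i _ => ?_
  rw [(hsa i).tsum_add (hsb i), tsum_mul_right, tsum_mul_right]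
  congr 2
  · exact tsum_mul_raise_sub_lower hT _ _ _
  · exact tsum_mul_raise_sub_lower hT _ _ _

/-- The ladder operators that represent the Wirtinger derivatives. -/
def gradOp : Label M → Module.End ℂ ((Label M → ℕ) → ℂ) := Sum.elim derivOp derivBarOp

/-- The real-linear forms `dα_i` and `dα_i^*`. -/
def gradForm : Label M → Phase M →L[ℝ] ℂ := Sum.elim coord coordBar

lemma PreservesRapidDecay.gradOp (s : Label M) : PreservesRapidDecay (gradOp s) := by
  cases s with
  | inl i => exact .derivOp i
  | inr i => exact .derivBarOp i

lemma differentiable_wignerSeries (hT : RapidDecay T) : Differentiable ℝ (wignerSeries T) :=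
  fun α => HasFDerivAt.differentiableAt (hasWirtinger_wignerSeries hT α)

lemma fderiv_wignerSeries (hT : RapidDecay T) :
    fderiv ℝ (wignerSeries T) = fun α => ∑ s : Label M,
      ((ContinuousLinearMap.id ℝ ℂ).smulRight (gradForm s)) (wignerSeries (gradOp s T) α) := by
  ext1 α
  rw [HasFDerivAt.fderiv (hasWirtinger_wignerSeries hT α), wirtingerForm, Fintype.sum_sum_type,
    Finset.sum_add_distrib]
  rfl

lemma contDiff_wignerSeries_nat (n : ℕ) : ∀ {T : (Label M → ℕ) → ℂ}, RapidDecay T →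
    ContDiff ℝ n (wignerSeries T) := by
  induction n with
  | zero =>
    intro T hT
    exact contDiff_zero.2 (differentiable_wignerSeries hT).continuous
  | succ n ih =>
    intro T hT
    rw [Nat.cast_succ, contDiff_succ_iff_fderiv]
    refine ⟨differentiable_wignerSeries hT, by simp, ?_⟩
    rw [fderiv_wignerSeries hT]
    exact ContDiff.sum fun s _ => (ContinuousLinearMap.contDiff _).comp
      (ih (PreservesRapidDecay.gradOp s T hT))

lemma contDiff_wignerSeries (hT : RapidDecay T) : ContDiff ℝ ∞ (wignerSeries T) :=
  contDiff_infty.2 fun n => contDiff_wignerSeries_nat n hT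

lemma exists_decay_wignerSeries (k n : ℕ) : ∀ {T : (Label M → ℕ) → ℂ}, RapidDecay T →
    ∃ c : ℝ, ∀ α, ‖α‖ ^ k * ‖iteratedFDeriv ℝ n (wignerSeries T) α‖ ≤ c := by
  induction n with
  | zero =>
    intro T hT
    simp only [norm_iteratedFDeriv_zero]
    exact exists_pow_mul_pairing_le hT uniformDecay_wignerElem k
  | succ n ih =>
    intro T hT
    choose c hc using fun s : Label M => ih (PreservesRapidDecay.gradOp s T hT)
    have hcd := fun s : Label M => contDiff_wignerSeries_nat n (PreservesRapidDecay.gradOp s T hT)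
    refine ⟨∑ s : Label M, ‖(ContinuousLinearMap.id ℝ ℂ).smulRight (gradForm s)‖ * c s,
      fun α => ?_⟩
    have hcd' : ∀ s ∈ (Finset.univ : Finset (Label M)), ContDiff ℝ n fun α =>
        ((ContinuousLinearMap.id ℝ ℂ).smulRight (gradForm s)) (wignerSeries (gradOp s T) α) :=
      fun s _ => (ContinuousLinearMap.contDiff _).comp (hcd s)
    rw [← norm_iteratedFDeriv_fderiv, fderiv_wignerSeries hT, iteratedFDeriv_sum hcd',
      Finset.sum_apply]
    calc _ ≤ ‖α‖ ^ k * ∑ s : Label M, ‖(ContinuousLinearMap.id ℝ ℂ).smulRight (gradForm s)‖ *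
          ‖iteratedFDeriv ℝ n (wignerSeries (gradOp s T)) α‖ := by
          refine mul_le_mul_of_nonneg_left ((norm_sum_le _ _).trans
            (Finset.sum_le_sum fun s _ => ?_)) (by positivity)
          exact ContinuousLinearMap.norm_iteratedFDeriv_comp_left _ (hcd s).contDiffAt le_rfl
      _ ≤ _ := by
          rw [Finset.mul_sum]
          refine Finset.sum_le_sum fun s _ => ?_
          rw [mul_left_comm]
          exact mul_le_mul_of_nonneg_left (hc s α) (by positivity)

/-- The Wigner function of a rapidly decreasing operator, as a Schwartz function. -/
def wignerSchwartz (hT : RapidDecay T) : 𝓢(Phase M, ℂ) where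
  toFun := wignerSeries T
  smooth' := contDiff_wignerSeries hT
  decay' k n := exists_decay_wignerSeries k n hT

end WignerSeries

/-! ### The Wigner transformation as a series -/

section SingleComponent

variable {D N : ℕ}

lemma hasSum_annihilation_mul (p : Fin N) (f : Occ N → ℂ) (m : Occ N) :
    HasSum (fun k => annihilation p m k * f k) (lower p f m) := by
  have h := hasSum_single (f := fun k => annihilation p m k * f k) (m + Pi.single p 1)
    fun k hk => by simp [annihilation, hk]
  simpa [annihilation, lower_apply] using h

lemma hasSum_annihilation_mul' (p : Fin N) (f : Occ N → ℂ) (m : Occ N) :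
    HasSum (fun k => annihilation p k m * f k) (raise p f m) := by
  have h := hasSum_single (f := fun k => annihilation p k m * f k) (m - Pi.single p 1)
    fun k hk => by
      have : m ≠ k + Pi.single p 1 := fun h => hk (by simp [h])
      simp [annihilation, this]
  convert h using 1
  by_cases h0 : m p = 0
  · rw [raise_apply_of_eq_zero h0]
    have : m ≠ m - Pi.single p 1 + Pi.single p 1 := fun h => by
      have := congrFun h p
      simp [h0] at this
    simp [annihilation, this]
  · obtain ⟨m', rfl⟩ := exists_eq_add_single h0
    simp [annihilation, raise_apply]

variable {S : Set (Space D)} {φ : Fin N → Space D → ℂ}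

lemma integrable_conj_mul (hφ2 : ∀ p, MemLp (φ p) 2 (volume.restrict S)) (p q : Fin N) :
    Integrable (fun x => conj (φ p x) * φ q x) (volume.restrict S) :=
  (hφ2 p).star.integrable_mul (hφ2 q)

/-- Coefficients with respect to the orthonormal modes. -/
lemma integral_sum_sum_mul (hφ2 : ∀ p, MemLp (φ p) 2 (volume.restrict S))
    (hφ : ∀ p q, ∫ x in S, conj (φ p x) * φ q x = if p = q then 1 else 0)
    (c d : Fin N → Fin N → ℂ) :
    ∫ x in S, (∑ p, ∑ q, (c p q * (conj (φ p x) * φ q x) + d p q * (conj (φ p x) * φ q x))) =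
      ∑ p, (c p p + d p p) := by
  have hi := fun p q (a : ℂ) => (integrable_conj_mul hφ2 p q).const_mul a
  simp only [← add_mul]
  rw [integral_finsetSum _ fun p _ => integrable_finsetSum _ fun q _ => hi p q _]
  refine Finset.sum_congr rfl fun p _ => ?_
  rw [integral_finsetSum _ fun q _ => hi p q _]
  simp only [integral_const_mul, hφ]
  simp

lemma displacementFunctional_eq (hφ2 : ∀ p, MemLp (φ p) 2 (volume.restrict S))
    (hφ : ∀ p q, ∫ x in S, conj (φ p x) * φ q x = if p = q then 1 else 0) (l α : Fin N → ℂ) :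
    displacementFunctional S φ l α =
      Complex.exp (∑ p, (-(l p) * conj (α p) + conj (l p) * α p)) := by
  rw [displacementFunctional, ← integral_sum_sum_mul hφ2 hφ (fun p q => -(l q) * conj (α p))
    fun p q => conj (l p) * α q]
  congr 2
  ext x
  simp only [compose, map_sum, map_mul, Finset.sum_add_distrib, neg_mul, Finset.sum_neg_distrib,
    Finset.sum_mul_sum]
  congr 1
  · rw [Finset.sum_comm]
    simp only [neg_inj]
    exact Finset.sum_congr rfl fun p _ => Finset.sum_congr rfl fun q _ => by ring
  · exact Finset.sum_congr rfl fun p _ => Finset.sum_congr rfl fun q _ => by ring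

lemma integral_displacementGen (hφ2 : ∀ p, MemLp (φ p) 2 (volume.restrict S))
    (hφ : ∀ p q, ∫ x in S, conj (φ p x) * φ q x = if p = q then 1 else 0) (l : Fin N → ℂ)
    (m n : Occ N) :
    ∫ x in S, (compose φ l x * opAdj (fieldOp φ x) m n - conj (compose φ l x) * fieldOp φ x m n) =
      ∑ p, (l p * annihilation p n m - conj (l p) * annihilation p m n) := by
  have hconj : ∀ p : Fin N, conj (annihilation p n m) = annihilation p n m := fun p => by
    simp only [annihilation]
    split_ifs <;> simp
  simp only [sub_eq_add_neg]
  rw [← integral_sum_sum_mul hφ2 hφ (fun p q => l q * annihilation p n m)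
    fun p q => -(conj (l p) * annihilation q m n)]
  congr 1
  ext x
  simp only [compose, fieldOp, opAdj, Finset.sum_apply, Pi.smul_apply, smul_eq_mul, map_sum,
    map_mul, hconj, Finset.sum_add_distrib, neg_mul, Finset.sum_neg_distrib, Finset.sum_mul_sum]
  congr 1
  · rw [Finset.sum_comm]
    exact Finset.sum_congr rfl fun p _ => Finset.sum_congr rfl fun q _ => by ring
  · simp only [neg_inj]
    exact Finset.sum_congr rfl fun p _ => Finset.sum_congr rfl fun q _ => by ring

lemma opMul_gen (l : Fin N → ℂ) (K : Kernel (Occ N)) (m n : Occ N) :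
    opMul (fun m n => ∑ p, (l p * annihilation p n m - conj (l p) * annihilation p m n)) K m n =
      displacementGen l (fun k => K k n) m := by
  rw [displacementGen_apply, opMul]
  refine HasSum.tsum_eq ?_
  have h := hasSum_sum fun p (_ : p ∈ Finset.univ) =>
    ((hasSum_annihilation_mul' p (fun k => K k n) m).mul_left (l p)).sub
      ((hasSum_annihilation_mul p (fun k => K k n) m).mul_left (conj (l p)))
  refine h.congr_fun fun k => ?_
  rw [Finset.sum_mul]
  exact Finset.sum_congr rfl fun p _ => by ring

lemma displacementOp_eq (hφ2 : ∀ p, MemLp (φ p) 2 (volume.restrict S))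
    (hφ : ∀ p q, ∫ x in S, conj (φ p x) * φ q x = if p = q then 1 else 0) (l : Fin N → ℂ) :
    displacementOp S φ l = displacementElem l := by
  have hpow : ∀ r, opPow (fun m n =>
      ∑ p, (l p * annihilation p n m - conj (l p) * annihilation p m n)) r =
        displacementTerm l r := by
    intro r
    induction r with
    | zero =>
      ext m n
      simp [opPow, displacementTerm, Pi.single_apply]
    | succ r ih =>
      ext m n
      rw [opPow, ih, opMul_gen, displacementTerm, pow_succ', Module.End.mul_apply]
      rfl
  ext m n
  simp only [displacementOp, integral_displacementGen hφ2 hφ, opExp, hpow, displacementElem]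

end SingleComponent

section Transform

variable {D C : ℕ} {M : Fin C → ℕ}

/-- Pairs of number states. -/
def occEquiv : (Label M → ℕ) ≃ MultiOcc M × MultiOcc M where
  toFun N := (rowOcc N, colOcc N)
  invFun q := Sum.elim (fun i => q.1 i.1 i.2) fun i => q.2 i.1 i.2
  left_inv N := by ext (i | i) <;> rfl
  right_inv q := rfl

lemma size_eq_totalNumber (N : Label M → ℕ) :
    size N = totalNumber (rowOcc N) + totalNumber (colOcc N) := by
  simp only [size, totalNumber, Fintype.sum_sum_type, Fintype.sum_sigma]
  rfl

/-- Matrix elements as a function of the pair of number states. -/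
def flatten (K : Kernel (MultiOcc M)) (N : Label M → ℕ) : ℂ := K (rowOcc N) (colOcc N)

lemma RapidlyDecreasing.flatten {K : Kernel (MultiOcc M)} (hK : RapidlyDecreasing K) :
    RapidDecay (flatten K) := by
  intro r
  obtain ⟨c, hc⟩ := hK r
  refine ⟨c, fun N => ?_⟩
  have := hc (rowOcc N) (colOcc N)
  rwa [size_eq_totalNumber, Nat.cast_add, ← add_assoc]

variable {S : Set (Space D)} {φ : (j : Fin C) → Fin (M j) → Space D → ℂ}

lemma displacement_eq_charElem (hφ2 : ∀ j p, MemLp (φ j p) 2 (volume.restrict S))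
    (hφ : ∀ j p q, ∫ x in S, conj (φ j p x) * φ j q x = if p = q then 1 else 0) (l : Phase M)
    (N : Label M → ℕ) : displacement S φ l (colOcc N) (rowOcc N) = charElem l N := by
  simp only [displacement, componentProduct, charElem, displacementOp_eq (hφ2 _) (hφ _)]

lemma prod_displacementFunctional (hφ2 : ∀ j p, MemLp (φ j p) 2 (volume.restrict S))
    (hφ : ∀ j p q, ∫ x in S, conj (φ j p x) * φ j q x = if p = q then 1 else 0) (l α : Phase M) :
    ∏ j, displacementFunctional S (φ j) (l j) (α j) = phaseFactor l α := by
  simp only [displacementFunctional_eq (hφ2 _) (hφ _), phaseFactor, Fintype.sum_sigma,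
    Complex.exp_sum]

lemma summable_displacement {K : Kernel (MultiOcc M)}
    (hφ2 : ∀ j p, MemLp (φ j p) 2 (volume.restrict S))
    (hφ : ∀ j p q, ∫ x in S, conj (φ j p x) * φ j q x = if p = q then 1 else 0)
    (hK : RapidDecay (flatten K)) (l : Phase M) :
    Summable fun q : MultiOcc M × MultiOcc M => K q.1 q.2 * displacement S φ l q.2 q.1 := by
  rw [← occEquiv.summable_iff]
  refine (hK.summable_mul uniformDecay_charElem.polyBounded l).congr fun N => ?_
  rw [← displacement_eq_charElem hφ2 hφ]
  rfl

lemma opTrace_displacement {K : Kernel (MultiOcc M)}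
    (hφ2 : ∀ j p, MemLp (φ j p) 2 (volume.restrict S))
    (hφ : ∀ j p q, ∫ x in S, conj (φ j p x) * φ j q x = if p = q then 1 else 0)
    (hK : RapidDecay (flatten K)) (l : Phase M) :
    opTrace (opMul K (displacement S φ l)) = pairing (flatten K) charElem l := by
  simp only [opTrace, opMul]
  rw [← (summable_displacement hφ2 hφ hK l).tsum_prod (f := fun q : MultiOcc M × MultiOcc M =>
    K q.1 q.2 * displacement S φ l q.2 q.1), ← occEquiv.tsum_eq]
  refine tsum_congr fun N => ?_
  rw [← displacement_eq_charElem hφ2 hφ]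
  rfl

lemma wignerConverges_of_rapidDecay {K : Kernel (MultiOcc M)}
    (hφ2 : ∀ j p, MemLp (φ j p) 2 (volume.restrict S))
    (hφ : ∀ j p q, ∫ x in S, conj (φ j p x) * φ j q x = if p = q then 1 else 0)
    (hK : RapidDecay (flatten K)) : WignerConverges S φ K := by
  refine ⟨summable_displacement hφ2 hφ hK, fun α => ?_⟩
  simp only [prod_displacementFunctional hφ2 hφ, opTrace_displacement hφ2 hφ hK]
  exact integrable_phaseFactor_mul α
    (integrable_pairing hK uniformDecay_charElem continuous_charElem)

lemma wigner_eq_wignerSeries {K : Kernel (MultiOcc M)}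
    (hφ2 : ∀ j p, MemLp (φ j p) 2 (volume.restrict S))
    (hφ : ∀ j p q, ∫ x in S, conj (φ j p x) * φ j q x = if p = q then 1 else 0)
    (hK : RapidDecay (flatten K)) : wigner S φ K = wignerSeries (flatten K) := by
  ext α
  simp only [wigner, prod_displacementFunctional hφ2 hφ, opTrace_displacement hφ2 hφ hK]
  obtain ⟨c, k, hc0, hc⟩ := (uniformDecay_charElem (M := M)).integral_norm_le
  have h := integral_tsum_of_summable_integral_norm (μ := (volume : Measure (Phase M)))
    (F := fun N l => phaseFactor l α * (flatten K N * charElem l N))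
    (fun N => integrable_phaseFactor_mul α ((integrable_charElem N).const_mul _)) ?_
  · simp only [pairing, ← tsum_mul_left (a := phaseFactor _ α)]
    rw [← h, wignerSeries, pairing, ← tsum_mul_left]
    refine tsum_congr fun N => ?_
    simp only [wignerElem, wignerIntegral, mul_left_comm (phaseFactor _ _), integral_const_mul]
    ring
  · refine Summable.of_nonneg_of_le (fun N => integral_nonneg fun _ => norm_nonneg _)
      (fun N => ?_) ((hK.summable_mul_pow k).mul_left c)
    simp only [norm_mul, norm_phaseFactor, one_mul, integral_const_mul]
    rw [mul_left_comm]
    exact mul_le_mul_of_nonneg_left (hc N) (norm_nonneg _)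

end Transform

/-! ### Commutators with the interaction operator -/

section FlatMul

variable {C : ℕ} {M : Fin C → ℕ}

/-- The product of operators, in terms of pairs of number states. -/
def flatMul (T T' : (Label M → ℕ) → ℂ) (N : Label M → ℕ) : ℂ :=
  ∑' l, T (occEquiv.symm (rowOcc N, l)) * T' (occEquiv.symm (l, colOcc N))

lemma flatten_opMul (K L : Kernel (MultiOcc M)) :
    flatten (opMul K L) = flatMul (flatten K) (flatten L) := rfl

lemma occEquiv_symm_apply_inl (m n : MultiOcc M) (i : Mode M) :
    occEquiv.symm (m, n) (Sum.inl i) = m i.1 i.2 := rfl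

lemma occEquiv_symm_apply_inr (m n : MultiOcc M) (i : Mode M) :
    occEquiv.symm (m, n) (Sum.inr i) = n i.1 i.2 := rfl

lemma occEquiv_symm_rowOcc_add (N : Label M → ℕ) (i : Mode M) (l : MultiOcc M) :
    occEquiv.symm (rowOcc (N + Pi.single (Sum.inl i) 1), l) =
      occEquiv.symm (rowOcc N, l) + Pi.single (Sum.inl i) 1 := by
  ext (k | k)
  · simp only [occEquiv_symm_apply_inl, Pi.add_apply]; rfl
  · simp [occEquiv_symm_apply_inr]

lemma occEquiv_symm_rowOcc_sub (N : Label M → ℕ) (i : Mode M) (l : MultiOcc M) :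
    occEquiv.symm (rowOcc (N - Pi.single (Sum.inl i) 1), l) =
      occEquiv.symm (rowOcc N, l) - Pi.single (Sum.inl i) 1 := by
  ext (k | k)
  · simp only [occEquiv_symm_apply_inl, Pi.sub_apply]; rfl
  · simp [occEquiv_symm_apply_inr]

lemma occEquiv_symm_colOcc_add (N : Label M → ℕ) (i : Mode M) (l : MultiOcc M) :
    occEquiv.symm (l, colOcc (N + Pi.single (Sum.inr i) 1)) =
      occEquiv.symm (l, colOcc N) + Pi.single (Sum.inr i) 1 := by
  ext (k | k)
  · simp [occEquiv_symm_apply_inl]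
  · simp only [occEquiv_symm_apply_inr, Pi.add_apply]; rfl

lemma occEquiv_symm_colOcc_sub (N : Label M → ℕ) (i : Mode M) (l : MultiOcc M) :
    occEquiv.symm (l, colOcc (N - Pi.single (Sum.inr i) 1)) =
      occEquiv.symm (l, colOcc N) - Pi.single (Sum.inr i) 1 := by
  ext (k | k)
  · simp [occEquiv_symm_apply_inl]
  · simp only [occEquiv_symm_apply_inr, Pi.sub_apply]; rfl

variable (T T' : (Label M → ℕ) → ℂ) (i : Mode M)

lemma flatMul_lower_inl : flatMul (lower (Sum.inl i) T) T' = lower (Sum.inl i) (flatMul T T') := by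
  ext N
  simp only [flatMul, lower_apply, ← tsum_mul_left, occEquiv_symm_rowOcc_add, ← mul_assoc]
  have : colOcc (N + Pi.single (Sum.inl i) 1) = colOcc N := by ext j p; simp [colOcc]
  rw [this]; rfl

lemma flatMul_raise_inl : flatMul (raise (Sum.inl i) T) T' = raise (Sum.inl i) (flatMul T T') := by
  ext N
  simp only [flatMul, raise_apply, ← tsum_mul_left, occEquiv_symm_rowOcc_sub, ← mul_assoc]
  have : colOcc (N - Pi.single (Sum.inl i) 1) = colOcc N := by ext j p; simp [colOcc]
  rw [this]; rfl

lemma flatMul_lower_inr : flatMul T (lower (Sum.inr i) T') = lower (Sum.inr i) (flatMul T T') := by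
  ext N
  simp only [flatMul, lower_apply, ← tsum_mul_left, occEquiv_symm_colOcc_add]
  have : rowOcc (N + Pi.single (Sum.inr i) 1) = rowOcc N := by ext j p; simp [rowOcc]
  rw [this]
  exact tsum_congr fun l => mul_left_comm _ _ _

lemma flatMul_raise_inr : flatMul T (raise (Sum.inr i) T') = raise (Sum.inr i) (flatMul T T') := by
  ext N
  simp only [flatMul, raise_apply, ← tsum_mul_left, occEquiv_symm_colOcc_sub]
  have : rowOcc (N - Pi.single (Sum.inr i) 1) = rowOcc N := by ext j p; simp [rowOcc]
  rw [this]
  exact tsum_congr fun l => mul_left_comm _ _ _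

/-- The matrix elements of the identity operator. -/
def idElem (N : Label M → ℕ) : ℂ := if rowOcc N = colOcc N then 1 else 0

lemma idElem_flatMul : flatMul idElem T = T := by
  ext N
  rw [flatMul, tsum_eq_single (rowOcc N)]
  · have : idElem (occEquiv.symm (rowOcc N, rowOcc N)) = 1 := if_pos rfl
    rw [this, one_mul]
    exact congrArg T (occEquiv.symm_apply_apply N)
  · intro l hl
    have : idElem (occEquiv.symm (rowOcc N, l)) = 0 := if_neg (Ne.symm hl)
    rw [this, zero_mul]

lemma flatMul_idElem : flatMul T idElem = T := by
  ext N
  rw [flatMul, tsum_eq_single (colOcc N)]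
  · have : idElem (occEquiv.symm (colOcc N, colOcc N)) = 1 := if_pos rfl
    rw [this, mul_one]
    exact congrArg T (occEquiv.symm_apply_apply N)
  · intro l hl
    have : idElem (occEquiv.symm (l, colOcc N)) = 0 := if_neg hl
    rw [this, mul_zero]

lemma lower_inl_idElem : lower (Sum.inl i) idElem = raise (Sum.inr i) (idElem (M := M)) := by
  ext N
  by_cases h : N (Sum.inr i) = 0
  · rw [raise_apply_of_eq_zero h, lower_apply, idElem, if_neg, mul_zero]
    intro h2
    have := congrFun (congrFun h2 i.1) i.2
    simp [rowOcc, colOcc, h] at this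
  · obtain ⟨N, rfl⟩ := exists_eq_add_single h
    have h1 : rowOcc (N + Pi.single (Sum.inr i) 1 + Pi.single (Sum.inl i) 1) =
        colOcc (N + Pi.single (Sum.inr i) 1 + Pi.single (Sum.inl i) 1) ↔ rowOcc N = colOcc N := by
      rw [add_right_comm, colOcc_add_inr, colOcc_add_inl, add_right_comm, rowOcc_add_inl]
      have : rowOcc (N + Pi.single (Sum.inr i) 1) = rowOcc N := by ext j p; simp [rowOcc]
      rw [this, add_left_inj]
    rw [raise_apply_add_single, lower_apply, idElem, idElem]
    by_cases h2 : rowOcc N = colOcc N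
    · have h3 : N (Sum.inl i) = N (Sum.inr i) := congrFun (congrFun h2 i.1) i.2
      rw [if_pos h2, if_pos (h1.2 h2)]
      simp [h3]
    · rw [if_neg h2, if_neg (h1.not.2 h2), mul_zero, mul_zero]

lemma raise_inl_idElem : raise (Sum.inl i) idElem = lower (Sum.inr i) (idElem (M := M)) := by
  ext N
  by_cases h : N (Sum.inl i) = 0
  · rw [raise_apply_of_eq_zero h, lower_apply, idElem, if_neg, mul_zero]
    intro h2
    have := congrFun (congrFun h2 i.1) i.2
    simp [rowOcc, colOcc, h] at this
  · obtain ⟨N, rfl⟩ := exists_eq_add_single h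
    have h1 : rowOcc (N + Pi.single (Sum.inl i) 1 + Pi.single (Sum.inr i) 1) =
        colOcc (N + Pi.single (Sum.inl i) 1 + Pi.single (Sum.inr i) 1) ↔ rowOcc N = colOcc N := by
      rw [colOcc_add_inr, colOcc_add_inl, add_right_comm, rowOcc_add_inl]
      have : rowOcc (N + Pi.single (Sum.inr i) 1) = rowOcc N := by ext j p; simp [rowOcc]
      rw [this, add_left_inj]
    rw [raise_apply_add_single, lower_apply, idElem, idElem]
    by_cases h2 : rowOcc N = colOcc N
    · have h3 : N (Sum.inl i) = N (Sum.inr i) := congrFun (congrFun h2 i.1) i.2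
      rw [if_pos h2, if_pos (h1.2 h2)]
      simp [h3]
    · rw [if_neg h2, if_neg (h1.not.2 h2), mul_zero, mul_zero]

/-- Matrices whose rows have finitely many nonzero elements. -/
def RowFinite (T : (Label M → ℕ) → ℂ) : Prop :=
  ∀ m, {l | T (occEquiv.symm (m, l)) ≠ 0}.Finite

/-- Matrices whose columns have finitely many nonzero elements. -/
def ColFinite (T : (Label M → ℕ) → ℂ) : Prop :=
  ∀ n, {l | T (occEquiv.symm (l, n)) ≠ 0}.Finite

variable {T T'}

lemma rowFinite_idElem : RowFinite (idElem (M := M)) := fun m =>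
  (Set.finite_singleton m).subset fun l hl => by
    by_contra h
    exact hl (if_neg (Ne.symm h))

lemma colFinite_idElem : ColFinite (idElem (M := M)) := fun m =>
  (Set.finite_singleton m).subset fun l hl => by
    by_contra h
    exact hl (if_neg h)

lemma RowFinite.lower (hT : RowFinite T) : RowFinite (lower (Sum.inl i) T) := fun m => by
  refine (hT (rowOcc (occEquiv.symm (m, 0) + Pi.single (Sum.inl i) 1))).subset fun l hl => ?_
  rw [Set.mem_ofPred_eq, occEquiv_symm_rowOcc_add]
  exact right_ne_zero_of_mul hl

lemma RowFinite.raise (hT : RowFinite T) : RowFinite (raise (Sum.inl i) T) := fun m => by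
  refine (hT (rowOcc (occEquiv.symm (m, 0) - Pi.single (Sum.inl i) 1))).subset fun l hl => ?_
  rw [Set.mem_ofPred_eq, occEquiv_symm_rowOcc_sub]
  exact right_ne_zero_of_mul hl

lemma ColFinite.lower (hT : ColFinite T) : ColFinite (lower (Sum.inr i) T) := fun m => by
  refine (hT (colOcc (occEquiv.symm (0, m) + Pi.single (Sum.inr i) 1))).subset fun l hl => ?_
  rw [Set.mem_ofPred_eq, occEquiv_symm_colOcc_add]
  exact right_ne_zero_of_mul hl

lemma ColFinite.raise (hT : ColFinite T) : ColFinite (raise (Sum.inr i) T) := fun m => by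
  refine (hT (colOcc (occEquiv.symm (0, m) - Pi.single (Sum.inr i) 1))).subset fun l hl => ?_
  rw [Set.mem_ofPred_eq, occEquiv_symm_colOcc_sub]
  exact right_ne_zero_of_mul hl

lemma sum_smul_flatMul {κ : Type*} {s : Finset κ} (c : κ → ℂ) {T : κ → (Label M → ℕ) → ℂ}
    (hT : ∀ t, RowFinite (T t)) (T' : (Label M → ℕ) → ℂ) :
    flatMul (∑ t ∈ s, c t • T t) T' = ∑ t ∈ s, c t • flatMul (T t) T' := by
  ext N
  have hs : ∀ t, Summable fun l => c t * (T t (occEquiv.symm (rowOcc N, l)) *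
      T' (occEquiv.symm (l, colOcc N))) := fun t =>
    (summable_of_hasFiniteSupport ((hT t (rowOcc N)).subset fun l hl =>
      left_ne_zero_of_mul hl)).mul_left _
  simp only [flatMul, Finset.sum_apply, Pi.smul_apply, smul_eq_mul, Finset.sum_mul, mul_assoc]
  rw [Summable.tsum_finsetSum fun t _ => hs t]
  simp only [tsum_mul_left]

lemma flatMul_sum_smul {κ : Type*} {s : Finset κ} (c : κ → ℂ) {T : κ → (Label M → ℕ) → ℂ}
    (hT : ∀ t, ColFinite (T t)) (T' : (Label M → ℕ) → ℂ) :
    flatMul T' (∑ t ∈ s, c t • T t) = ∑ t ∈ s, c t • flatMul T' (T t) := by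
  ext N
  have hs : ∀ t, Summable fun l => c t * (T' (occEquiv.symm (rowOcc N, l)) *
      T t (occEquiv.symm (l, colOcc N))) := fun t =>
    (summable_of_hasFiniteSupport ((hT t (colOcc N)).subset fun l hl =>
      right_ne_zero_of_mul hl)).mul_left _
  simp only [flatMul, Finset.sum_apply, Pi.smul_apply, smul_eq_mul, Finset.mul_sum,
    mul_left_comm (T' _)]
  rw [Summable.tsum_finsetSum fun t _ => hs t]
  simp only [tsum_mul_left]

end FlatMul

section Interaction

variable {D C : ℕ} {M : Fin C → ℕ} {j k : Fin C}

/-- The quadruples of modes in the expansion of the interaction between two components. -/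
abbrev Quad (M : Fin C → ℕ) (j k : Fin C) := Fin (M j) × Fin (M k) × Fin (M j) × Fin (M k)

/-- Left multiplication by `a_{j,p}† a_{k,q}† a_{j,r} a_{k,s}`. -/
def leftQuad (t : Quad M j k) : Module.End ℂ ((Label M → ℕ) → ℂ) :=
  raise (Sum.inl ⟨j, t.1⟩) * raise (Sum.inl ⟨k, t.2.1⟩) *
    lower (Sum.inl ⟨j, t.2.2.1⟩) * lower (Sum.inl ⟨k, t.2.2.2⟩)

/-- Right multiplication by `a_{j,p}† a_{k,q}† a_{j,r} a_{k,s}`. -/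
def rightQuad (t : Quad M j k) : Module.End ℂ ((Label M → ℕ) → ℂ) :=
  raise (Sum.inr ⟨k, t.2.2.2⟩) * raise (Sum.inr ⟨j, t.2.2.1⟩) *
    lower (Sum.inr ⟨k, t.2.1⟩) * lower (Sum.inr ⟨j, t.1⟩)

lemma flatMul_leftQuad (t : Quad M j k) (T : (Label M → ℕ) → ℂ) :
    flatMul (leftQuad t idElem) T = leftQuad t T := by
  simp only [leftQuad, Module.End.mul_apply, flatMul_lower_inl, flatMul_raise_inl, idElem_flatMul]

lemma flatMul_rightQuad (t : Quad M j k) (T : (Label M → ℕ) → ℂ) :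
    flatMul T (rightQuad t idElem) = rightQuad t T := by
  simp only [rightQuad, Module.End.mul_apply, flatMul_lower_inr, flatMul_raise_inr, flatMul_idElem]

/-- Normal ordered products have the same matrix elements whether they act on the identity from
the left or from the right. -/
lemma leftQuad_idElem (t : Quad M j k) : leftQuad t idElem = rightQuad t (idElem (M := M)) := by
  have hlr : ∀ (a b : Mode M) f, lower (Sum.inl a) (raise (Sum.inr b) f) =
      raise (Sum.inr b) (lower (Sum.inl a) f) := fun a b => lower_raise_of_ne (by simp)
  have hrl : ∀ (a b : Mode M) f, raise (Sum.inl a) (lower (Sum.inr b) f) =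
      lower (Sum.inr b) (raise (Sum.inl a) f) := fun a b f => (lower_raise_of_ne (by simp) f).symm
  simp only [leftQuad, rightQuad, Module.End.mul_apply, lower_inl_idElem, hlr,
    raise_raise (Sum.inl _) (Sum.inr _), raise_inl_idElem, hrl]

lemma rowFinite_leftQuad (t : Quad M j k) : RowFinite (leftQuad t idElem) :=
  (((rowFinite_idElem.lower _).lower _).raise _).raise _

lemma colFinite_leftQuad (t : Quad M j k) : ColFinite (leftQuad t idElem) := by
  rw [leftQuad_idElem]
  exact (((colFinite_idElem.lower _).lower _).raise _).raise _

lemma PreservesRapidDecay.leftQuad (t : Quad M j k) : PreservesRapidDecay (leftQuad t) :=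
  (((raise _).mul (raise _)).mul (lower _)).mul (lower _)

lemma PreservesRapidDecay.rightQuad (t : Quad M j k) : PreservesRapidDecay (rightQuad t) :=
  (((raise _).mul (raise _)).mul (lower _)).mul (lower _)

variable (S : Set (Space D)) (φ : (j : Fin C) → Fin (M j) → Space D → ℂ)

/-- The coefficients of `Ψ̃_j† Ψ̃_k† Ψ̃_j Ψ̃_k` at `x` in terms of the modes. -/
def quadCoeff (x : Space D) (t : Quad M j k) : ℂ :=
  conj (φ j t.1 x) * conj (φ k t.2.1 x) * φ j t.2.2.1 x * φ k t.2.2.2 x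

lemma opMul_field (j : Fin C) (x : Space D) (K : Kernel (MultiOcc M)) :
    flatten (opMul (field φ j x) K) = ∑ p, φ j p x • lower (Sum.inl ⟨j, p⟩) (flatten K) := by
  ext N
  rw [Finset.sum_apply]
  refine HasSum.tsum_eq ?_
  have h : ∀ p : Fin (M j), HasSum (fun l => (if ∀ i, i ≠ j → rowOcc N i = l i then
      φ j p x * annihilation p (rowOcc N j) (l j) else 0) * K l (colOcc N))
      (φ j p x * lower (Sum.inl ⟨j, p⟩) (flatten K) N) := by
    intro p
    set N' := N + Pi.single (Sum.inl ⟨j, p⟩) 1 with hN'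
    have hrow := rowOcc_add_inl N ⟨j, p⟩
    have hcol := colOcc_add_inl N ⟨j, p⟩
    rw [← hN'] at hrow hcol
    convert hasSum_single (rowOcc N') fun l hl => ?_ using 1
    · rw [lower_apply, ← hN', flatten, hcol, hrow, if_pos fun i hi => by simp [hi]]
      simp [annihilation, rowOcc]
      ring
    · split_ifs with h
      · rw [annihilation, if_neg, mul_zero, zero_mul]
        intro h2
        refine hl ?_
        rw [hrow]
        ext i q
        by_cases hi : i = j
        · subst hi; simp [h2]
        · simp [hi, h i hi]
      · exact zero_mul _
  refine (hasSum_sum fun p _ => h p).congr_fun fun l => ?_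
  rw [← Finset.sum_mul]
  congr 1
  simp only [field, onComponent, fieldOp, Finset.sum_apply, Pi.smul_apply, smul_eq_mul]
  split_ifs <;> simp

lemma opMul_opAdj_field (j : Fin C) (x : Space D) (K : Kernel (MultiOcc M)) :
    flatten (opMul (opAdj (field φ j x)) K) =
      ∑ p, conj (φ j p x) • raise (Sum.inl ⟨j, p⟩) (flatten K) := by
  ext N
  rw [Finset.sum_apply]
  refine HasSum.tsum_eq ?_
  have h : ∀ p : Fin (M j), HasSum (fun l => (if ∀ i, i ≠ j → l i = rowOcc N i then
      conj (φ j p x) * annihilation p (l j) (rowOcc N j) else 0) * K l (colOcc N))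
      (conj (φ j p x) * raise (Sum.inl ⟨j, p⟩) (flatten K) N) := by
    intro p
    by_cases h0 : N (Sum.inl ⟨j, p⟩) = 0
    · rw [raise_apply_of_eq_zero h0, mul_zero]
      convert hasSum_zero with l
      have : annihilation p (l j) (rowOcc N j) = 0 := by
        rw [annihilation, if_neg]
        intro h
        have := congrFun h p
        simp [rowOcc, h0] at this
      simp [this]
    · obtain ⟨N', rfl⟩ := exists_eq_add_single h0
      rw [raise_apply_add_single]
      have hrow := rowOcc_add_inl N' ⟨j, p⟩
      have hcol := colOcc_add_inl N' ⟨j, p⟩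
      convert hasSum_single (rowOcc N') fun l hl => ?_ using 1
      · rw [flatten, hcol, hrow, if_pos fun i hi => by simp [hi]]
        simp [annihilation, rowOcc]
        ring
      · split_ifs with h
        · rw [annihilation, if_neg, mul_zero, zero_mul]
          intro h2
          refine hl ?_
          ext i q
          by_cases hi : i = j
          · subst hi
            rw [hrow] at h2
            have := congrFun h2 q
            simpa using this.symm
          · rw [h i hi, hrow]; simp [hi]
        · exact zero_mul _
  refine (hasSum_sum fun p _ => h p).congr_fun fun l => ?_
  rw [← Finset.sum_mul]
  congr 1
  have hconj : ∀ p : Fin (M j), conj (annihilation p (l j) (rowOcc N j)) =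
      annihilation p (l j) (rowOcc N j) := fun p => by
    simp only [annihilation]
    split_ifs <;> simp
  simp only [field, onComponent, fieldOp, opAdj, Finset.sum_apply, Pi.smul_apply, smul_eq_mul]
  split_ifs <;> simp [hconj]

/-- The density `Ψ̃_j† Ψ̃_k† Ψ̃_j Ψ̃_k` at `x` in terms of the modes. -/
lemma flatten_quartic (x : Space D) :
    flatten (opMul (opAdj (field φ j x)) (opMul (opAdj (field φ k x))
      (opMul (field φ j x) (field φ k x)))) =
      ∑ t : Quad M j k, quadCoeff φ x t • leftQuad t idElem := by
  have h1 : flatten (field φ k x) = ∑ p, φ k p x • lower (Sum.inl ⟨k, p⟩) (idElem (M := M)) := by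
    have := opMul_field φ k x (fun m n => idElem (occEquiv.symm (m, n)))
    have h2 : flatten (fun m n => idElem (occEquiv.symm (m, n))) = idElem (M := M) := rfl
    rwa [flatten_opMul, h2, flatMul_idElem] at this
  rw [opMul_opAdj_field, opMul_opAdj_field, opMul_field, h1]
  simp only [map_sum, map_smul, Finset.smul_sum, smul_smul, Fintype.sum_prod_type, quadCoeff,
    mul_assoc, leftQuad, Module.End.mul_apply]

variable {S φ}

lemma integrable_quadCoeff (hφ4 : ∀ j p, MemLp (φ j p) 4 (volume.restrict S)) (t : Quad M j k) :
    Integrable (fun x => quadCoeff φ x t) (volume.restrict S) := by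
  have : ENNReal.HolderTriple 4 4 2 := ⟨by
    rw [← two_mul, show (4 : ℝ≥0∞) = 2 * 2 by norm_num, ENNReal.mul_inv (by simp) (by simp),
      ← mul_assoc, ENNReal.mul_inv_cancel (by simp) (by simp), one_mul]⟩
  have h1 : MemLp (fun x => conj (φ j t.1 x) * conj (φ k t.2.1 x)) 2 (volume.restrict S) :=
    (hφ4 k t.2.1).star.mul' (hφ4 j t.1).star
  have h2 : MemLp (fun x => φ j t.2.2.1 x * φ k t.2.2.2 x) 2 (volume.restrict S) :=
    (hφ4 k t.2.2.2).mul' (hφ4 j t.2.2.1)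
  refine (h1.integrable_mul h2).congr (Eventually.of_forall fun x => ?_)
  simp only [quadCoeff, Pi.mul_apply, mul_assoc]

lemma flatten_interaction (hφ4 : ∀ j p, MemLp (φ j p) 4 (volume.restrict S)) :
    flatten (interaction S φ j k) =
      ∑ t : Quad M j k, (∫ x in S, quadCoeff φ x t) • leftQuad t idElem := by
  ext N
  have h : ∀ x, opMul (opAdj (field φ j x)) (opMul (opAdj (field φ k x))
      (opMul (field φ j x) (field φ k x))) (rowOcc N) (colOcc N) =
      ∑ t : Quad M j k, quadCoeff φ x t * leftQuad t idElem N := fun x => by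
    have := congrFun (flatten_quartic (j := j) (k := k) φ x) N
    rw [Finset.sum_apply] at this
    exact this
  simp only [flatten, interaction, h]
  rw [integral_finsetSum _ fun t _ => (integrable_quadCoeff hφ4 t).mul_const _]
  simp only [integral_mul_const, Finset.sum_apply, Pi.smul_apply, smul_eq_mul]

/-- The commutator with `∑ t, c t a_{j,p}† a_{k,q}† a_{j,r} a_{k,s}`. -/
def commOp (c : Quad M j k → ℂ) : Module.End ℂ ((Label M → ℕ) → ℂ) :=
  ∑ t, c t • (leftQuad t - rightQuad t)

lemma PreservesRapidDecay.commOp (c : Quad M j k → ℂ) : PreservesRapidDecay (commOp c) :=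
  PreservesRapidDecay.sum fun t => ((leftQuad t).sub (rightQuad t)).smul _

lemma commOp_apply (c : Quad M j k → ℂ) (T : (Label M → ℕ) → ℂ) :
    commOp c T = ∑ t, c t • (leftQuad t T - rightQuad t T) := by
  simp [commOp]

lemma flatten_opComm_interaction (hφ4 : ∀ j p, MemLp (φ j p) 4 (volume.restrict S))
    (K : Kernel (MultiOcc M)) :
    flatten (opComm (interaction S φ j k) K) =
      commOp (fun t : Quad M j k => ∫ x in S, quadCoeff φ x t) (flatten K) := by
  have h : flatten (opComm (interaction S φ j k) K) =
      flatMul (flatten (interaction S φ j k)) (flatten K) -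
        flatMul (flatten K) (flatten (interaction S φ j k)) := rfl
  rw [h, flatten_interaction hφ4, sum_smul_flatMul _ rowFinite_leftQuad,
    flatMul_sum_smul _ colFinite_leftQuad, commOp_apply, ← Finset.sum_sub_distrib]
  refine Finset.sum_congr rfl fun t _ => ?_
  rw [smul_sub, flatMul_leftQuad, leftQuad_idElem, flatMul_rightQuad]

end Interaction

/-! ### Compression to finitely many particles -/

section Truncation

variable {C : ℕ} {M : Fin C → ℕ} {j k : Fin C}

/-- Multiplication by a function of the particle numbers of the two number states. -/
def weight (g : ℤ → ℤ → ℂ) : Module.End ℂ ((Label M → ℕ) → ℂ) where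
  toFun T N := g (∑ i, (N (Sum.inl i) : ℤ)) (∑ i, (N (Sum.inr i) : ℤ)) * T N
  map_add' T T' := by ext N; simp [mul_add]
  map_smul' c T := by ext N; simp [mul_left_comm]

variable (g : ℤ → ℤ → ℂ) (T : (Label M → ℕ) → ℂ) (i : Mode M)

lemma weight_apply (N : Label M → ℕ) : weight g T N =
    g (∑ i, (N (Sum.inl i) : ℤ)) (∑ i, (N (Sum.inr i) : ℤ)) * T N := rfl

lemma lower_inl_weight : lower (Sum.inl i) (weight g T) =
    weight (fun r c => g (r + 1) c) (lower (Sum.inl i) T) := by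
  ext N
  simp [lower_apply, weight_apply, Finset.sum_add_distrib, Pi.single_apply, mul_left_comm]

lemma lower_inr_weight : lower (Sum.inr i) (weight g T) =
    weight (fun r c => g r (c + 1)) (lower (Sum.inr i) T) := by
  ext N
  simp [lower_apply, weight_apply, Finset.sum_add_distrib, Pi.single_apply, mul_left_comm]

lemma raise_inl_weight : raise (Sum.inl i) (weight g T) =
    weight (fun r c => g (r - 1) c) (raise (Sum.inl i) T) := by
  ext N
  by_cases h : N (Sum.inl i) = 0
  · rw [raise_apply_of_eq_zero h, weight_apply, raise_apply_of_eq_zero h, mul_zero]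
  · obtain ⟨N, rfl⟩ := exists_eq_add_single h
    rw [weight_apply, raise_apply_add_single, raise_apply_add_single]
    simp [weight_apply, Finset.sum_add_distrib, Pi.single_apply, mul_left_comm]

lemma raise_inr_weight : raise (Sum.inr i) (weight g T) =
    weight (fun r c => g r (c - 1)) (raise (Sum.inr i) T) := by
  ext N
  by_cases h : N (Sum.inr i) = 0
  · rw [raise_apply_of_eq_zero h, weight_apply, raise_apply_of_eq_zero h, mul_zero]
  · obtain ⟨N, rfl⟩ := exists_eq_add_single h
    rw [weight_apply, raise_apply_add_single, raise_apply_add_single]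
    simp [weight_apply, Finset.sum_add_distrib, Pi.single_apply, mul_left_comm]

/-- The interaction conserves the number of particles. -/
lemma commOp_weight (c : Quad M j k → ℂ) : commOp c (weight g T) = weight g (commOp c T) := by
  simp only [commOp_apply, map_sum, map_smul, map_sub, leftQuad, rightQuad, Module.End.mul_apply,
    lower_inl_weight, lower_inr_weight, raise_inl_weight, raise_inr_weight, sub_add_cancel]

lemma flatten_truncate (R : ℕ) (K : Kernel (MultiOcc M)) :
    flatten (truncate R K) = weight (fun r c => if r ≤ R ∧ c ≤ R then 1 else 0) (flatten K) := by
  ext N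
  have h1 : ∑ i : Mode M, (N (Sum.inl i) : ℤ) = totalNumber (rowOcc N) := by
    simp [totalNumber, rowOcc, Fintype.sum_sigma]
  have h2 : ∑ i : Mode M, (N (Sum.inr i) : ℤ) = totalNumber (colOcc N) := by
    simp [totalNumber, colOcc, Fintype.sum_sigma]
  rw [weight_apply, h1, h2, flatten, truncate]
  simp only [Nat.cast_le, ite_mul, one_mul, zero_mul]
  rfl

lemma finite_size_le (n : ℕ) : {N : Label M → ℕ | size N ≤ n}.Finite :=
  (Set.finite_Iic (fun _ : Label M => n)).subset fun _ h i => (le_size _ i).trans h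

lemma rapidDecay_flatten_truncate (R : ℕ) (K : Kernel (MultiOcc M)) :
    RapidDecay (flatten (truncate R K)) := by
  refine RapidDecay.of_finite_support ((finite_size_le (R + R)).subset fun N hN => ?_)
  rw [Set.mem_ofPred_eq, size_eq_totalNumber]
  by_contra h
  refine hN (if_neg ?_)
  omega

lemma flatten_truncate_opComm {D : ℕ} {S : Set (Space D)}
    {φ : (j : Fin C) → Fin (M j) → Space D → ℂ}
    (hφ4 : ∀ j p, MemLp (φ j p) 4 (volume.restrict S)) (R : ℕ) (K : Kernel (MultiOcc M)) :
    flatten (truncate R (opComm (interaction S φ j k) K)) =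
      commOp (fun t : Quad M j k => ∫ x in S, quadCoeff φ x t) (flatten (truncate R K)) := by
  rw [flatten_truncate, flatten_opComm_interaction hφ4, flatten_truncate, commOp_weight]

end Truncation

/-! ### The differential operator in terms of ladder operators -/

section GeneratorIdentity

variable {R : Type*} [Ring R] [Algebra ℂ R]

lemma mul_mul_of_commutator {x y : R} {t : ℂ} (h : x * y = y * x + t • 1) (z : R) :
    x * (y * z) = y * (x * z) + t • z := by
  rw [← mul_assoc, h]; simp [add_mul, mul_assoc]

/-- The commutator with `ψ† ψ† ψ ψ` in terms of `X = (a + b) / 2`, `X† = (c + e) / 2` and the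
derivations `P = e - c`, `P† = a - b`, where `a`, `c` are left multiplication and `b`, `e` right
multiplication by `ψ` and `ψ†`. -/
lemma generator_identity_same (a c b e : R) (d : ℂ)
    (h1 : a * c = c * a + d • 1) (h2 : e * b = b * e + d • 1)
    (h3 : Commute a b) (h4 : Commute a e) (h5 : Commute c b) (h6 : Commute c e)
    (X Xb P Pb : R) (hX : X = (1 / 2 : ℂ) • (a + b)) (hXb : Xb = (1 / 2 : ℂ) • (c + e))
    (hP : P = e - c) (hPb : Pb = a - b) :
    P * (-(X * X * Xb) + (d / 2) • ((1 : ℂ) • X + X))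
      + Pb * (Xb * X * Xb - (d / 2) • ((1 : ℂ) • Xb + Xb))
      + P * (-(X * X * Xb) + (d / 2) • ((1 : ℂ) • X + X))
      + Pb * (Xb * X * Xb - (d / 2) • ((1 : ℂ) • Xb + Xb))
      + P * (Pb * (P * ((1 / 4 : ℂ) • X))) - P * (Pb * (Pb * ((1 / 4 : ℂ) • Xb)))
      + P * (Pb * (P * ((1 / 4 : ℂ) • X))) - P * (Pb * (Pb * ((1 / 4 : ℂ) • Xb)))
      = c * c * a * a - b * b * e * e := by
  subst hX hXb hP hPb
  simp only [mul_assoc, mul_add, add_mul, mul_sub, sub_mul, mul_neg, smul_mul_assoc,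
    mul_smul_comm, smul_add, smul_sub, one_mul, h1, h2, h3.eq, h4.eq, h5.eq, h6.eq,
    mul_mul_of_commutator h1, mul_mul_of_commutator h2, h3.left_comm, h4.left_comm, h5.left_comm,
    h6.left_comm, mul_one, smul_smul]
  module

/-- The commutator with `ψ† ψ'† ψ ψ'` for two different components. -/
lemma generator_identity_ne (a c b e a' c' b' e' : R) (d d' : ℂ)
    (h1 : a * c = c * a + d • 1) (h2 : e * b = b * e + d • 1)
    (h4 : Commute a e) (h5 : Commute c b)
    (k1 : a' * c' = c' * a' + d' • 1) (k2 : e' * b' = b' * e' + d' • 1)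
    (k4 : Commute a' e') (k5 : Commute c' b')
    (m1 : Commute a' a) (m2 : Commute a' c) (m3 : Commute a' b) (m4 : Commute a' e)
    (m5 : Commute c' a) (m6 : Commute c' c) (m7 : Commute c' b) (m8 : Commute c' e)
    (m9 : Commute b' a) (m10 : Commute b' c) (m11 : Commute b' b) (m12 : Commute b' e)
    (m13 : Commute e' a) (m14 : Commute e' c) (m15 : Commute e' b) (m16 : Commute e' e)
    (X Xb P Pb X' Xb' P' Pb' : R)
    (hX : X = (1 / 2 : ℂ) • (a + b)) (hXb : Xb = (1 / 2 : ℂ) • (c + e))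
    (hP : P = e - c) (hPb : Pb = a - b)
    (hX' : X' = (1 / 2 : ℂ) • (a' + b')) (hXb' : Xb' = (1 / 2 : ℂ) • (c' + e'))
    (hP' : P' = e' - c') (hPb' : Pb' = a' - b') :
    P * (-(X * X' * Xb') + (d' / 2) • ((0 : ℂ) • X' + X))
      + Pb * (Xb * X' * Xb' - (d' / 2) • ((0 : ℂ) • Xb' + Xb))
      + P' * (-(X' * X * Xb) + (d / 2) • ((0 : ℂ) • X + X'))
      + Pb' * (Xb' * X * Xb - (d / 2) • ((0 : ℂ) • Xb + Xb'))
      + P * (Pb * (P' * ((1 / 4 : ℂ) • X'))) - P * (Pb * (Pb' * ((1 / 4 : ℂ) • Xb')))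
      + P' * (Pb' * (P * ((1 / 4 : ℂ) • X))) - P' * (Pb' * (Pb * ((1 / 4 : ℂ) • Xb)))
      = c * c' * a * a' - b' * b * e' * e := by
  subst hX hXb hP hPb hX' hXb' hP' hPb'
  simp only [mul_assoc, mul_add, add_mul, mul_sub, sub_mul, mul_neg,
    smul_mul_assoc, mul_smul_comm, smul_add, smul_sub, h1, h2, h4.eq,
    h5.eq, k1, k2, k4.eq, k5.eq, mul_mul_of_commutator h1,
    mul_mul_of_commutator h2, h4.left_comm, h5.left_comm,
    m1.eq, m2.eq, m3.eq, m4.eq, m5.eq, m6.eq, m7.eq, m8.eq, m9.eq,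
    m10.eq, m11.eq, m12.eq, m13.eq, m14.eq, m15.eq, m16.eq, m1.left_comm, m2.left_comm,
    m3.left_comm, m4.left_comm, m5.left_comm, m6.left_comm, m7.left_comm, m8.left_comm,
    m9.left_comm, m10.left_comm, m11.left_comm, m12.left_comm, m13.left_comm, m14.left_comm,
    m15.left_comm, m16.left_comm, mul_one, smul_smul]
  module

end GeneratorIdentity

section FieldOperators

variable {D C : ℕ} {M : Fin C → ℕ} (φ : (j : Fin C) → Fin (M j) → Space D → ℂ) (j k : Fin C)
  (x : Space D)

/-- Left multiplication by `Ψ̃_j(x)`. -/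
def leftField : Module.End ℂ ((Label M → ℕ) → ℂ) := ∑ p, φ j p x • lower (Sum.inl ⟨j, p⟩)

/-- Left multiplication by `Ψ̃_j†(x)`. -/
def leftFieldAdj : Module.End ℂ ((Label M → ℕ) → ℂ) :=
  ∑ p, conj (φ j p x) • raise (Sum.inl ⟨j, p⟩)

/-- Right multiplication by `Ψ̃_j(x)`. -/
def rightField : Module.End ℂ ((Label M → ℕ) → ℂ) := ∑ p, φ j p x • raise (Sum.inr ⟨j, p⟩)

/-- Right multiplication by `Ψ̃_j†(x)`. -/
def rightFieldAdj : Module.End ℂ ((Label M → ℕ) → ℂ) :=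
  ∑ p, conj (φ j p x) • lower (Sum.inr ⟨j, p⟩)

/-- The ladder operator that represents multiplication by `Ψ_j(x)`. -/
def psiOp : Module.End ℂ ((Label M → ℕ) → ℂ) := ∑ p, φ j p x • coordOp ⟨j, p⟩

/-- The ladder operator that represents multiplication by `Ψ_j^*(x)`. -/
def psiBarOp : Module.End ℂ ((Label M → ℕ) → ℂ) := ∑ p, conj (φ j p x) • coordBarOp ⟨j, p⟩

/-- The ladder operator that represents `δ/δΨ_j(x)`. -/
def funDerivOp : Module.End ℂ ((Label M → ℕ) → ℂ) := ∑ p, conj (φ j p x) • derivOp ⟨j, p⟩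

/-- The ladder operator that represents `δ/δΨ_j^*(x)`. -/
def funDerivBarOp : Module.End ℂ ((Label M → ℕ) → ℂ) := ∑ p, φ j p x • derivBarOp ⟨j, p⟩

lemma psiOp_eq : psiOp φ j x = (1 / 2 : ℂ) • (leftField φ j x + rightField φ j x) := by
  simp only [psiOp, leftField, rightField, coordOp, ← Finset.sum_add_distrib, Finset.smul_sum,
    ← smul_add]
  exact Finset.sum_congr rfl fun p _ => smul_comm _ _ _

lemma psiBarOp_eq : psiBarOp φ j x = (1 / 2 : ℂ) • (leftFieldAdj φ j x + rightFieldAdj φ j x) := by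
  simp only [psiBarOp, leftFieldAdj, rightFieldAdj, coordBarOp, ← Finset.sum_add_distrib,
    Finset.smul_sum, ← smul_add]
  exact Finset.sum_congr rfl fun p _ => smul_comm _ _ _

lemma funDerivOp_eq : funDerivOp φ j x = rightFieldAdj φ j x - leftFieldAdj φ j x := by
  simp only [funDerivOp, leftFieldAdj, rightFieldAdj, derivOp, ← Finset.sum_sub_distrib, smul_sub]

lemma funDerivBarOp_eq : funDerivBarOp φ j x = leftField φ j x - rightField φ j x := by
  simp only [funDerivBarOp, leftField, rightField, derivBarOp, ← Finset.sum_sub_distrib, smul_sub]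

lemma commute_sum_smul {I J R : Type*} [Fintype I] [Fintype J] [Ring R] [Algebra ℂ R]
    {u : I → ℂ} {v : J → ℂ} {X : I → R} {Y : J → R} (h : ∀ p q, Commute (X p) (Y q)) :
    Commute (∑ p, u p • X p) (∑ q, v q • Y q) :=
  Commute.sum_left _ _ _ fun p _ => Commute.sum_right _ _ _ fun q _ =>
    ((h p q).smul_left _).smul_right _

lemma commute_lower_raise {i k : Label M} (h : i ≠ k) :
    Commute (lower i : Module.End ℂ ((Label M → ℕ) → ℂ)) (raise k) := by
  have := lower_mul_raise i k
  rwa [if_neg h, add_zero] at this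

lemma commute_lower_lower (i k : Label M) :
    Commute (lower i : Module.End ℂ ((Label M → ℕ) → ℂ)) (lower k) := lower_mul_lower i k

lemma commute_raise_raise (i k : Label M) :
    Commute (raise i : Module.End ℂ ((Label M → ℕ) → ℂ)) (raise k) := raise_mul_raise i k

lemma sum_smul_lower_mul_sum_smul_raise {I : Type*} [Fintype I] [DecidableEq I] (u v : I → ℂ)
    {f : I → Label M} (hf : Function.Injective f) :
    (∑ p, u p • lower (f p)) * (∑ q, v q • raise (f q)) =
      (∑ q, v q • raise (f q)) * (∑ p, u p • lower (f p)) +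
        (∑ p, u p * v p) • (1 : Module.End ℂ ((Label M → ℕ) → ℂ)) := by
  have h : ∀ p q, (u p • lower (f p)) * (v q • raise (f q)) = (v q • raise (f q)) *
      (u p • lower (f p)) + if p = q then (u p * v p) • (1 : Module.End ℂ _) else 0 := by
    intro p q
    rw [smul_mul_smul_comm, lower_mul_raise, smul_add, smul_mul_smul_comm, mul_comm (v q)]
    by_cases hpq : p = q
    · subst hpq; simp
    · simp [hpq, hf.eq_iff]
  rw [Finset.sum_mul_sum, Finset.sum_mul_sum, Finset.sum_comm (s := Finset.univ)
    (f := fun p q => (v p • raise (f p)) * (u q • lower (f q)))]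
  simp only [h, Finset.sum_add_distrib, Finset.sum_ite_eq, Finset.mem_univ, if_true,
    Finset.sum_smul]

lemma inl_mk_injective : Function.Injective fun p : Fin (M j) => (Sum.inl ⟨j, p⟩ : Label M) :=
  fun p q h => by simpa using h

lemma inr_mk_injective : Function.Injective fun p : Fin (M j) => (Sum.inr ⟨j, p⟩ : Label M) :=
  fun p q h => by simpa using h

lemma leftField_mul_leftFieldAdj : leftField φ j x * leftFieldAdj φ j x =
    leftFieldAdj φ j x * leftField φ j x + deltaTilde φ j x • 1 := by
  rw [leftField, leftFieldAdj, sum_smul_lower_mul_sum_smul_raise _ _ (inl_mk_injective j)]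
  congr 2
  exact Finset.sum_congr rfl fun p _ => mul_comm _ _

lemma rightFieldAdj_mul_rightField : rightFieldAdj φ j x * rightField φ j x =
    rightField φ j x * rightFieldAdj φ j x + deltaTilde φ j x • 1 := by
  rw [rightField, rightFieldAdj, sum_smul_lower_mul_sum_smul_raise _ _ (inr_mk_injective j)]
  rfl

lemma commute_leftField_rightField : Commute (leftField φ j x) (rightField φ k x) :=
  commute_sum_smul fun _ _ => commute_lower_raise (by simp)

lemma commute_leftField_rightFieldAdj : Commute (leftField φ j x) (rightFieldAdj φ k x) :=
  commute_sum_smul fun _ _ => commute_lower_lower _ _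

lemma commute_leftFieldAdj_rightField : Commute (leftFieldAdj φ j x) (rightField φ k x) :=
  commute_sum_smul fun _ _ => commute_raise_raise _ _

lemma commute_leftFieldAdj_rightFieldAdj : Commute (leftFieldAdj φ j x) (rightFieldAdj φ k x) :=
  commute_sum_smul fun _ _ => (commute_lower_raise (by simp)).symm

lemma commute_leftField_leftField : Commute (leftField φ j x) (leftField φ k x) :=
  commute_sum_smul fun _ _ => commute_lower_lower _ _

lemma commute_leftFieldAdj_leftFieldAdj : Commute (leftFieldAdj φ j x) (leftFieldAdj φ k x) :=
  commute_sum_smul fun _ _ => commute_raise_raise _ _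

lemma commute_rightField_rightField : Commute (rightField φ j x) (rightField φ k x) :=
  commute_sum_smul fun _ _ => commute_raise_raise _ _

lemma commute_rightFieldAdj_rightFieldAdj : Commute (rightFieldAdj φ j x) (rightFieldAdj φ k x) :=
  commute_sum_smul fun _ _ => commute_lower_lower _ _

variable {j k} in
lemma commute_leftField_leftFieldAdj (h : j ≠ k) :
    Commute (leftField φ j x) (leftFieldAdj φ k x) :=
  commute_sum_smul fun _ _ => commute_lower_raise (by simp [h])

variable {j k} in
lemma commute_rightField_rightFieldAdj (h : j ≠ k) :
    Commute (rightField φ j x) (rightFieldAdj φ k x) :=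
  commute_sum_smul fun _ _ => (commute_lower_raise (by simp [h.symm])).symm

/-- The ladder operator that represents multiplication by `drift`. -/
def driftOp : Module.End ℂ ((Label M → ℕ) → ℂ) :=
  -(psiOp φ j x * psiOp φ k x * psiBarOp φ k x) +
    (deltaTilde φ k x / 2) • ((if j = k then 1 else 0 : ℂ) • psiOp φ k x + psiOp φ j x)

/-- The ladder operator that represents multiplication by `driftBar`. -/
def driftBarOp : Module.End ℂ ((Label M → ℕ) → ℂ) :=
  psiBarOp φ j x * psiOp φ k x * psiBarOp φ k x -
    (deltaTilde φ k x / 2) • ((if j = k then 1 else 0 : ℂ) • psiBarOp φ k x + psiBarOp φ j x)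

/-- The ladder operator that represents the differential operator at `x`. -/
def generatorOp : Module.End ℂ ((Label M → ℕ) → ℂ) :=
  funDerivOp φ j x * driftOp φ j k x
    + funDerivBarOp φ j x * driftBarOp φ j k x
    + funDerivOp φ k x * driftOp φ k j x
    + funDerivBarOp φ k x * driftBarOp φ k j x
    + funDerivOp φ j x * (funDerivBarOp φ j x * (funDerivOp φ k x * ((1 / 4 : ℂ) • psiOp φ k x)))
    - funDerivOp φ j x *
        (funDerivBarOp φ j x * (funDerivBarOp φ k x * ((1 / 4 : ℂ) • psiBarOp φ k x)))
    + funDerivOp φ k x * (funDerivBarOp φ k x * (funDerivOp φ j x * ((1 / 4 : ℂ) • psiOp φ j x)))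
    - funDerivOp φ k x *
        (funDerivBarOp φ k x * (funDerivBarOp φ j x * ((1 / 4 : ℂ) • psiBarOp φ j x)))

lemma generatorOp_eq_fields : generatorOp φ j k x =
    leftFieldAdj φ j x * leftFieldAdj φ k x * leftField φ j x * leftField φ k x -
      rightField φ k x * rightField φ j x * rightFieldAdj φ k x * rightFieldAdj φ j x := by
  by_cases h : j = k
  · subst h
    simp only [generatorOp, driftOp, driftBarOp, if_true]
    exact generator_identity_same _ _ _ _ _ (leftField_mul_leftFieldAdj φ j x)
      (rightFieldAdj_mul_rightField φ j x) (commute_leftField_rightField φ j j x)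
      (commute_leftField_rightFieldAdj φ j j x) (commute_leftFieldAdj_rightField φ j j x)
      (commute_leftFieldAdj_rightFieldAdj φ j j x) _ _ _ _ (psiOp_eq φ j x) (psiBarOp_eq φ j x)
      (funDerivOp_eq φ j x) (funDerivBarOp_eq φ j x)
  · simp only [generatorOp, driftOp, driftBarOp, if_neg h, if_neg (Ne.symm h)]
    exact generator_identity_ne _ _ _ _ _ _ _ _ _ _ (leftField_mul_leftFieldAdj φ j x)
      (rightFieldAdj_mul_rightField φ j x) (commute_leftField_rightFieldAdj φ j j x)
      (commute_leftFieldAdj_rightField φ j j x) (leftField_mul_leftFieldAdj φ k x)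
      (rightFieldAdj_mul_rightField φ k x) (commute_leftField_rightFieldAdj φ k k x)
      (commute_leftFieldAdj_rightField φ k k x)
      (commute_leftField_leftField φ k j x) (commute_leftField_leftFieldAdj φ x (Ne.symm h))
      (commute_leftField_rightField φ k j x) (commute_leftField_rightFieldAdj φ k j x)
      (commute_leftField_leftFieldAdj φ x h).symm (commute_leftFieldAdj_leftFieldAdj φ k j x)
      (commute_leftFieldAdj_rightField φ k j x) (commute_leftFieldAdj_rightFieldAdj φ k j x)
      (commute_leftField_rightField φ j k x).symm (commute_leftFieldAdj_rightField φ j k x).symm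
      (commute_rightField_rightField φ k j x) (commute_rightField_rightFieldAdj φ x (Ne.symm h))
      (commute_leftField_rightFieldAdj φ j k x).symm
      (commute_leftFieldAdj_rightFieldAdj φ j k x).symm
      (commute_rightField_rightFieldAdj φ x h).symm (commute_rightFieldAdj_rightFieldAdj φ k j x)
      _ _ _ _ _ _ _ _ (psiOp_eq φ j x) (psiBarOp_eq φ j x) (funDerivOp_eq φ j x)
      (funDerivBarOp_eq φ j x) (psiOp_eq φ k x) (psiBarOp_eq φ k x) (funDerivOp_eq φ k x)
      (funDerivBarOp_eq φ k x)

/-- Reversal of the order of summation over quadruples. -/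
lemma sum_reverse {P Q R U E : Type*} [Fintype P] [Fintype Q] [Fintype R] [Fintype U]
    [AddCommMonoid E] (f : P × Q × R × U → E) :
    ∑ t : U × R × Q × P, f (t.2.2.2, t.2.2.1, t.2.1, t.1) = ∑ t, f t :=
  Fintype.sum_equiv ⟨fun t => (t.2.2.2, t.2.2.1, t.2.1, t.1),
    fun t => (t.2.2.2, t.2.2.1, t.2.1, t.1), fun _ => rfl, fun _ => rfl⟩ _ _ fun _ => rfl

/-- The differential operator at `x` represents the commutator with `Ψ̃_j† Ψ̃_k† Ψ̃_j Ψ̃_k` at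
`x`. -/
lemma generatorOp_eq_commOp : generatorOp φ j k x = commOp (quadCoeff φ x (j := j) (k := k)) := by
  rw [generatorOp_eq_fields]
  refine LinearMap.ext fun T => ?_
  have hrev := sum_reverse fun t : Quad M j k => quadCoeff φ x t • leftQuad t T
  rw [commOp_apply]
  simp only [smul_sub, Finset.sum_sub_distrib]
  rw [← hrev, LinearMap.sub_apply]
  congr 1
  · simp only [leftFieldAdj, leftField, leftQuad, Module.End.mul_apply, LinearMap.sum_apply,
      LinearMap.smul_apply, map_sum, map_smul, Finset.smul_sum, smul_smul, Fintype.sum_prod_type,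
      quadCoeff]
    refine Finset.sum_congr rfl fun s _ => Finset.sum_congr rfl fun r _ =>
      Finset.sum_congr rfl fun q _ => Finset.sum_congr rfl fun p _ => ?_
    congr 1
    ring
  · simp only [rightFieldAdj, rightField, rightQuad, Module.End.mul_apply, LinearMap.sum_apply,
      LinearMap.smul_apply, map_sum, map_smul, Finset.smul_sum, smul_smul, Fintype.sum_prod_type,
      quadCoeff, mul_assoc]

namespace PreservesRapidDecay

lemma neg {A : Module.End ℂ ((Label M → ℕ) → ℂ)} (hA : PreservesRapidDecay A) :
    PreservesRapidDecay (-A) := fun T h => (hA T h).neg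

lemma psiOp : PreservesRapidDecay (psiOp φ j x) := .sum fun _ => (coordOp _).smul _

lemma psiBarOp : PreservesRapidDecay (psiBarOp φ j x) := .sum fun _ => (coordBarOp _).smul _

lemma funDerivOp : PreservesRapidDecay (funDerivOp φ j x) := .sum fun _ => (derivOp _).smul _

lemma funDerivBarOp : PreservesRapidDecay (funDerivBarOp φ j x) :=
  .sum fun _ => (derivBarOp _).smul _

lemma driftOp : PreservesRapidDecay (driftOp φ j k x) :=
  (((psiOp φ j x).mul (psiOp φ k x)).mul (psiBarOp φ k x)).neg.add
    ((((psiOp φ k x).smul _).add (psiOp φ j x)).smul _)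

lemma driftBarOp : PreservesRapidDecay (driftBarOp φ j k x) :=
  (((psiBarOp φ j x).mul (psiOp φ k x)).mul (psiBarOp φ k x)).sub
    ((((psiBarOp φ k x).smul _).add (psiBarOp φ j x)).smul _)

end PreservesRapidDecay

variable {T : (Label M → ℕ) → ℂ}

lemma wignerSeries_sum_smul {κ : Type*} [Fintype κ] (c : κ → ℂ)
    {A : κ → Module.End ℂ ((Label M → ℕ) → ℂ)} (hA : ∀ t, PreservesRapidDecay (A t))
    (hT : RapidDecay T) (α : Phase M) :
    wignerSeries ((∑ t, c t • A t) T) α = ∑ t, c t * wignerSeries (A t T) α := by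
  rw [LinearMap.sum_apply, wignerSeries_sum _ fun t _ => ((hA t).smul (c t)) T hT,
    Finset.sum_apply]
  refine Finset.sum_congr rfl fun t _ => ?_
  rw [LinearMap.smul_apply, wignerSeries_smul, Pi.smul_apply, smul_eq_mul]

lemma psi_mul_wignerSeries (hT : RapidDecay T) (α : Phase M) :
    psi φ j x α * wignerSeries T α = wignerSeries (psiOp φ j x T) α := by
  rw [psiOp, wignerSeries_sum_smul _ (fun _ => PreservesRapidDecay.coordOp _) hT, psi, compose,
    Finset.sum_mul]
  refine Finset.sum_congr rfl fun p _ => ?_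
  rw [wignerSeries_coordOp hT, mul_assoc]

lemma psiBar_mul_wignerSeries (hT : RapidDecay T) (α : Phase M) :
    psiBar φ j x α * wignerSeries T α = wignerSeries (psiBarOp φ j x T) α := by
  rw [psiBarOp, wignerSeries_sum_smul _ (fun _ => PreservesRapidDecay.coordBarOp _) hT, psiBar, psi,
    compose, map_sum, Finset.sum_mul]
  refine Finset.sum_congr rfl fun p _ => ?_
  rw [wignerSeries_coordBarOp hT, map_mul, mul_assoc]

lemma funDeriv_wignerSeries (hT : RapidDecay T) :
    funDeriv φ j x (wignerSeries T) = wignerSeries (funDerivOp φ j x T) := by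
  ext α
  rw [funDerivOp, wignerSeries_sum_smul _ (fun _ => PreservesRapidDecay.derivOp _) hT, funDeriv]
  refine Finset.sum_congr rfl fun p _ => ?_
  rw [(hasWirtinger_wignerSeries hT α).wirtinger_eq ⟨j, p⟩]

lemma funDerivBar_wignerSeries (hT : RapidDecay T) :
    funDerivBar φ j x (wignerSeries T) = wignerSeries (funDerivBarOp φ j x T) := by
  ext α
  rw [funDerivBarOp, wignerSeries_sum_smul _ (fun _ => PreservesRapidDecay.derivBarOp _) hT,
    funDerivBar]
  refine Finset.sum_congr rfl fun p _ => ?_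
  rw [(hasWirtinger_wignerSeries hT α).wirtingerBar_eq ⟨j, p⟩]

lemma drift_mul_wignerSeries (hT : RapidDecay T) :
    (fun α => drift φ j k x α * wignerSeries T α) = wignerSeries (driftOp φ j k x T) := by
  ext α
  have hj := PreservesRapidDecay.psiOp φ j x
  have hk := PreservesRapidDecay.psiOp φ k x
  have hb := PreservesRapidDecay.psiBarOp φ k x
  have h : driftOp φ j k x T = -(psiOp φ j x (psiOp φ k x (psiBarOp φ k x T))) +
      (deltaTilde φ k x / 2) •
        ((if j = k then 1 else 0 : ℂ) • psiOp φ k x T + psiOp φ j x T) := rfl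
  rw [h, wignerSeries_add (hj _ (hk _ (hb _ hT))).neg
    ((((hk _ hT).smul _).add (hj _ hT)).smul _), wignerSeries_neg, wignerSeries_smul,
    wignerSeries_add ((hk _ hT).smul _) (hj _ hT), wignerSeries_smul]
  simp only [Pi.add_apply, Pi.neg_apply, Pi.smul_apply, smul_eq_mul]
  rw [← psi_mul_wignerSeries φ j x (hk _ (hb _ hT)), ← psi_mul_wignerSeries φ k x (hb _ hT),
    ← psiBar_mul_wignerSeries φ k x hT, ← psi_mul_wignerSeries φ k x hT,
    ← psi_mul_wignerSeries φ j x hT, drift]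
  ring

lemma driftBar_mul_wignerSeries (hT : RapidDecay T) :
    (fun α => driftBar φ j k x α * wignerSeries T α) = wignerSeries (driftBarOp φ j k x T) := by
  ext α
  have hj := PreservesRapidDecay.psiBarOp φ j x
  have hk := PreservesRapidDecay.psiOp φ k x
  have hb := PreservesRapidDecay.psiBarOp φ k x
  have h : driftBarOp φ j k x T = psiBarOp φ j x (psiOp φ k x (psiBarOp φ k x T)) -
      (deltaTilde φ k x / 2) •
        ((if j = k then 1 else 0 : ℂ) • psiBarOp φ k x T + psiBarOp φ j x T) := rfl
  rw [h, wignerSeries_sub (hj _ (hk _ (hb _ hT)))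
    ((((hb _ hT).smul _).add (hj _ hT)).smul _), wignerSeries_smul,
    wignerSeries_add ((hb _ hT).smul _) (hj _ hT), wignerSeries_smul]
  simp only [Pi.add_apply, Pi.sub_apply, Pi.smul_apply, smul_eq_mul]
  rw [← psiBar_mul_wignerSeries φ j x (hk _ (hb _ hT)), ← psi_mul_wignerSeries φ k x (hb _ hT),
    ← psiBar_mul_wignerSeries φ k x hT, ← psiBar_mul_wignerSeries φ j x hT, driftBar]
  ring

lemma quarter_psi_mul_wignerSeries (hT : RapidDecay T) :
    (fun α => 1 / 4 * psi φ j x α * wignerSeries T α) =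
      wignerSeries (((1 / 4 : ℂ) • psiOp φ j x) T) := by
  ext α
  rw [LinearMap.smul_apply, wignerSeries_smul, Pi.smul_apply, ← psi_mul_wignerSeries φ j x hT,
    smul_eq_mul, mul_assoc]

lemma quarter_psiBar_mul_wignerSeries (hT : RapidDecay T) :
    (fun α => 1 / 4 * psiBar φ j x α * wignerSeries T α) =
      wignerSeries (((1 / 4 : ℂ) • psiBarOp φ j x) T) := by
  ext α
  rw [LinearMap.smul_apply, wignerSeries_smul, Pi.smul_apply, ← psiBar_mul_wignerSeries φ j x hT,
    smul_eq_mul, mul_assoc]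

lemma wignerGenerator_wignerSeries (hT : RapidDecay T) :
    wignerGenerator φ j k x (wignerSeries T) = wignerSeries (generatorOp φ j k x T) := by
  have hd := fun j k => PreservesRapidDecay.driftOp φ j k x T hT
  have hdb := fun j k => PreservesRapidDecay.driftBarOp φ j k x T hT
  have hx := fun j => (PreservesRapidDecay.psiOp φ j x).smul (1 / 4) T hT
  have hxb := fun j => (PreservesRapidDecay.psiBarOp φ j x).smul (1 / 4) T hT
  have hP := fun j => PreservesRapidDecay.funDerivOp φ j x
  have hPb := fun j => PreservesRapidDecay.funDerivBarOp φ j x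
  have h1 := hP j _ (hd j k)
  have h2 := hPb j _ (hdb j k)
  have h3 := hP k _ (hd k j)
  have h4 := hPb k _ (hdb k j)
  have h5 := hP j _ (hPb j _ (hP k _ (hx k)))
  have h6 := hP j _ (hPb j _ (hPb k _ (hxb k)))
  have h7 := hP k _ (hPb k _ (hP j _ (hx j)))
  have h8 := hP k _ (hPb k _ (hPb j _ (hxb j)))
  ext α
  simp only [wignerGenerator, drift_mul_wignerSeries φ _ _ x hT,
    driftBar_mul_wignerSeries φ _ _ x hT, quarter_psi_mul_wignerSeries φ _ x hT,
    quarter_psiBar_mul_wignerSeries φ _ x hT]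
  rw [funDeriv_wignerSeries φ j x (hd j k), funDerivBar_wignerSeries φ j x (hdb j k),
    funDeriv_wignerSeries φ k x (hd k j), funDerivBar_wignerSeries φ k x (hdb k j),
    funDeriv_wignerSeries φ k x (hx k), funDerivBar_wignerSeries φ j x (hP k _ (hx k)),
    funDeriv_wignerSeries φ j x (hPb j _ (hP k _ (hx k))),
    funDerivBar_wignerSeries φ k x (hxb k), funDerivBar_wignerSeries φ j x (hPb k _ (hxb k)),
    funDeriv_wignerSeries φ j x (hPb j _ (hPb k _ (hxb k))),
    funDeriv_wignerSeries φ j x (hx j), funDerivBar_wignerSeries φ k x (hP j _ (hx j)),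
    funDeriv_wignerSeries φ k x (hPb k _ (hP j _ (hx j))),
    funDerivBar_wignerSeries φ j x (hxb j), funDerivBar_wignerSeries φ k x (hPb j _ (hxb j)),
    funDeriv_wignerSeries φ k x (hPb k _ (hPb j _ (hxb j)))]
  simp only [generatorOp, LinearMap.add_apply, LinearMap.sub_apply, Module.End.mul_apply]
  rw [wignerSeries_sub ((((((h1.add h2).add h3).add h4).add h5).sub h6).add h7) h8,
    wignerSeries_add (((((h1.add h2).add h3).add h4).add h5).sub h6) h7,
    wignerSeries_sub ((((h1.add h2).add h3).add h4).add h5) h6,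
    wignerSeries_add (((h1.add h2).add h3).add h4) h5,
    wignerSeries_add ((h1.add h2).add h3) h4, wignerSeries_add (h1.add h2) h3,
    wignerSeries_add h1 h2]
  rfl

variable {j k}

lemma wignerSeries_commOp (c : Quad M j k → ℂ) (hT : RapidDecay T) (α : Phase M) :
    wignerSeries (commOp c T) α = ∑ t, c t * wignerSeries ((leftQuad t - rightQuad t) T) α :=
  wignerSeries_sum_smul _ (fun t =>
    (PreservesRapidDecay.leftQuad t).sub (PreservesRapidDecay.rightQuad t)) hT α

lemma wignerGenerator_eq_sum (hT : RapidDecay T) (α : Phase M) :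
    wignerGenerator φ j k x (wignerSeries T) α =
      ∑ t : Quad M j k, quadCoeff φ x t * wignerSeries ((leftQuad t - rightQuad t) T) α := by
  rw [wignerGenerator_wignerSeries φ j k x hT, generatorOp_eq_commOp, wignerSeries_commOp _ hT]

end FieldOperators

section Smooth

variable {D C : ℕ} {M : Fin C → ℕ} {S : Set (Space D)}
  {φ : (j : Fin C) → Fin (M j) → Space D → ℂ} {j k : Fin C} {K : Kernel (MultiOcc M)}

/-- The formula for operators with rapidly decreasing matrix elements. -/
lemma wigner_opComm_interaction (hφ2 : ∀ j p, MemLp (φ j p) 2 (volume.restrict S))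
    (hφ4 : ∀ j p, MemLp (φ j p) 4 (volume.restrict S))
    (hφ : ∀ j p q, ∫ x in S, conj (φ j p x) * φ j q x = if p = q then 1 else 0)
    (hK : RapidDecay (flatten K)) (α : Phase M) :
    IntegrableOn (fun x => wignerGenerator φ j k x (wigner S φ K) α) S ∧
      wigner S φ (opComm (interaction S φ j k) K) α =
        ∫ x in S, wignerGenerator φ j k x (wigner S φ K) α := by
  have hi := fun t : Quad M j k => (integrable_quadCoeff hφ4 t).mul_const
    (wignerSeries ((leftQuad t - rightQuad t) (flatten K)) α)
  have hc : RapidDecay (flatten (opComm (interaction S φ j k) K)) := by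
    rw [flatten_opComm_interaction hφ4]
    exact PreservesRapidDecay.commOp _ _ hK
  simp only [wigner_eq_wignerSeries hφ2 hφ hK, wigner_eq_wignerSeries hφ2 hφ hc,
    wignerGenerator_eq_sum φ _ hK]
  refine ⟨integrable_finsetSum _ fun t _ => hi t, ?_⟩
  rw [flatten_opComm_interaction hφ4, wignerSeries_commOp _ hK,
    integral_finsetSum _ fun t _ => hi t]
  simp only [integral_mul_const]

end Smooth

/-! ### Orthogonality and convergence in `L²` -/

section Orthogonality

variable {C : ℕ} {M : Fin C → ℕ} {T T' : (Label M → ℕ) → ℂ}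

lemma memLp_wignerSeries (hT : RapidDecay T) : MemLp (wignerSeries T) 2 :=
  (wignerSchwartz hT).memLp 2 volume

lemma integrable_conj_mul_wignerSeries (hT : RapidDecay T) (hT' : RapidDecay T') :
    Integrable fun α => conj (wignerSeries T α) * wignerSeries T' α :=
  (memLp_wignerSeries hT).star.integrable_mul (memLp_wignerSeries hT')

/-- The `L²` inner product of Wigner functions. -/
def wignerInner (T T' : (Label M → ℕ) → ℂ) : ℂ :=
  ∫ α, conj (wignerSeries T α) * wignerSeries T' α

lemma wignerInner_conj (T T' : (Label M → ℕ) → ℂ) :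
    conj (wignerInner T T') = wignerInner T' T := by
  rw [wignerInner, ← integral_conj, wignerInner]
  simp only [map_mul, Complex.conj_conj, mul_comm]

lemma wignerInner_smul_right (c : ℂ) (T T' : (Label M → ℕ) → ℂ) :
    wignerInner T (c • T') = c * wignerInner T T' := by
  simp only [wignerInner, wignerSeries_smul, Pi.smul_apply, smul_eq_mul, mul_left_comm _ c,
    integral_const_mul]

lemma wignerInner_smul_left (c : ℂ) (T T' : (Label M → ℕ) → ℂ) :
    wignerInner (c • T) T' = conj c * wignerInner T T' := by
  rw [← wignerInner_conj, wignerInner_smul_right, map_mul, wignerInner_conj]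

lemma wignerInner_deriv (hT : RapidDecay T) (hT' : RapidDecay T') (i : Mode M) :
    wignerInner T (derivOp i T') = -wignerInner (derivBarOp i T) T' ∧
      wignerInner T (derivBarOp i T') = -wignerInner (derivOp i T) T' :=
  HasWirtinger.integral_mul_eq_neg (fun α => (hasWirtinger_wignerSeries hT α).starRingEnd)
    (fun α => hasWirtinger_wignerSeries hT' α) i (integrable_conj_mul_wignerSeries hT hT')
    (integrable_conj_mul_wignerSeries (PreservesRapidDecay.derivBarOp i _ hT) hT')
    (integrable_conj_mul_wignerSeries (PreservesRapidDecay.derivOp i _ hT) hT')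
    (integrable_conj_mul_wignerSeries hT (PreservesRapidDecay.derivOp i _ hT'))
    (integrable_conj_mul_wignerSeries hT (PreservesRapidDecay.derivBarOp i _ hT'))

lemma wignerInner_coordOp (hT : RapidDecay T) (hT' : RapidDecay T') (i : Mode M) :
    wignerInner T (coordOp i T') = wignerInner (coordBarOp i T) T' := by
  simp only [wignerInner, wignerSeries_coordOp hT', wignerSeries_coordBarOp hT, map_mul,
    Complex.conj_conj]
  exact integral_congr_ae (Eventually.of_forall fun α => by simp only []; ring)

lemma wignerInner_coordBarOp (hT : RapidDecay T) (hT' : RapidDecay T') (i : Mode M) :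
    wignerInner T (coordBarOp i T') = wignerInner (coordOp i T) T' := by
  rw [← wignerInner_conj, ← wignerInner_coordOp hT' hT, wignerInner_conj]

lemma wignerInner_add_right (hT : RapidDecay T) {U V : (Label M → ℕ) → ℂ} (hU : RapidDecay U)
    (hV : RapidDecay V) : wignerInner T (U + V) = wignerInner T U + wignerInner T V := by
  simp only [wignerInner, wignerSeries_add hU hV, Pi.add_apply, mul_add]
  exact integral_add (integrable_conj_mul_wignerSeries hT hU)
    (integrable_conj_mul_wignerSeries hT hV)

lemma wignerInner_add_left (hT : RapidDecay T) {U V : (Label M → ℕ) → ℂ} (hU : RapidDecay U)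
    (hV : RapidDecay V) : wignerInner (U + V) T = wignerInner U T + wignerInner V T := by
  rw [← wignerInner_conj, wignerInner_add_right hT hU hV, map_add, wignerInner_conj,
    wignerInner_conj]

/-- With respect to the `L²` inner product, `lower` and `raise` are adjoint. -/
lemma wignerInner_lower (hT : RapidDecay T) (hT' : RapidDecay T') (s : Label M) :
    wignerInner T (lower s T') = wignerInner (raise s T) T' := by
  have hc : conj (-1 / 2 : ℂ) = -1 / 2 := by rw [map_div₀, map_neg, map_one, map_ofNat]
  cases s with
  | inl i =>
    have h1 : lower (Sum.inl i) T' = coordOp i T' + (1 / 2 : ℂ) • derivBarOp i T' := by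
      simp only [coordOp, derivBarOp, LinearMap.smul_apply, LinearMap.add_apply,
        LinearMap.sub_apply]
      module
    have h2 : raise (Sum.inl i) T = coordBarOp i T + (-1 / 2 : ℂ) • derivOp i T := by
      simp only [coordBarOp, derivOp, LinearMap.smul_apply, LinearMap.add_apply,
        LinearMap.sub_apply]
      module
    rw [h1, h2, wignerInner_add_right hT (PreservesRapidDecay.coordOp i _ hT')
      ((PreservesRapidDecay.derivBarOp i _ hT').smul _), wignerInner_add_left hT'
      (PreservesRapidDecay.coordBarOp i _ hT) ((PreservesRapidDecay.derivOp i _ hT).smul _),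
      wignerInner_smul_right, wignerInner_smul_left, wignerInner_coordOp hT hT',
      (wignerInner_deriv hT hT' i).2, hc]
    ring
  | inr i =>
    have h1 : lower (Sum.inr i) T' = coordBarOp i T' + (1 / 2 : ℂ) • derivOp i T' := by
      simp only [coordBarOp, derivOp, LinearMap.smul_apply, LinearMap.add_apply,
        LinearMap.sub_apply]
      module
    have h2 : raise (Sum.inr i) T = coordOp i T + (-1 / 2 : ℂ) • derivBarOp i T := by
      simp only [coordOp, derivBarOp, LinearMap.smul_apply, LinearMap.add_apply,
        LinearMap.sub_apply]
      module
    rw [h1, h2, wignerInner_add_right hT (PreservesRapidDecay.coordBarOp i _ hT')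
      ((PreservesRapidDecay.derivOp i _ hT').smul _), wignerInner_add_left hT'
      (PreservesRapidDecay.coordOp i _ hT) ((PreservesRapidDecay.derivBarOp i _ hT).smul _),
      wignerInner_smul_right, wignerInner_smul_left, wignerInner_coordBarOp hT hT',
      (wignerInner_deriv hT hT' i).1, hc]
    ring

lemma rapidDecay_single (N : Label M → ℕ) (c : ℂ) :
    RapidDecay (Pi.single N c : (Label M → ℕ) → ℂ) :=
  RapidDecay.of_finite_support ((Set.finite_singleton N).subset fun N' hN' => by
    by_contra h
    exact hN' (Pi.single_eq_of_ne h _))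

lemma sqrt_mul_wignerInner_single (s : Label M) (N N' : Label M → ℕ) :
    (Real.sqrt (N' s) : ℂ) * wignerInner (Pi.single N 1) (Pi.single (N' - Pi.single s 1) 1) =
      (Real.sqrt (N s + 1) : ℂ) *
        wignerInner (Pi.single (N + Pi.single s 1) 1) (Pi.single N' 1) := by
  have h := wignerInner_lower (rapidDecay_single N 1) (rapidDecay_single N' 1) s
  rwa [lower_single, raise_single, wignerInner_smul_right, wignerInner_smul_left,
    Complex.conj_ofReal] at h

lemma sqrt_natCast_add_one_ne_zero (n : ℕ) : (Real.sqrt (n + 1) : ℂ) ≠ 0 := by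
  rw [Complex.ofReal_ne_zero]; positivity

lemma wignerInner_single_zero {N : Label M → ℕ} (hN : N ≠ 0) :
    wignerInner (Pi.single N 1) (Pi.single 0 1) = 0 := by
  obtain ⟨s, hs⟩ := Function.ne_iff.1 hN
  obtain ⟨N, rfl⟩ := exists_eq_add_single hs
  have h := sqrt_mul_wignerInner_single s N 0
  rw [Pi.zero_apply, Nat.cast_zero, Real.sqrt_zero, Complex.ofReal_zero, zero_mul] at h
  exact (mul_eq_zero.1 h.symm).resolve_left (sqrt_natCast_add_one_ne_zero _)

/-- The Wigner functions of the transitions between number states are orthogonal, with equal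
norms. -/
lemma wignerInner_single (N : Label M → ℕ) : ∀ N' : Label M → ℕ,
    wignerInner (Pi.single N 1) (Pi.single N' 1) =
      if N = N' then wignerInner (Pi.single (0 : Label M → ℕ) 1) (Pi.single 0 1) else 0 := by
  induction h : size N generalizing N with
  | zero =>
    intro N'
    have hN : N = 0 := by
      ext s
      have := le_size N s
      simp only [Pi.zero_apply]
      omega
    subst hN
    split_ifs with h0
    · rw [← h0]
    · rw [← wignerInner_conj, wignerInner_single_zero (Ne.symm h0), map_zero]
  | succ n ih =>
    intro N'
    have hN : N ≠ 0 := by rintro rfl; simp at h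
    obtain ⟨s, hs⟩ := Function.ne_iff.1 hN
    obtain ⟨N, rfl⟩ := exists_eq_add_single hs
    rw [size_add_single] at h
    have h1 := sqrt_mul_wignerInner_single s N N'
    rw [ih N (by omega)] at h1
    refine mul_left_cancel₀ (sqrt_natCast_add_one_ne_zero (N s)) (h1.symm.trans ?_)
    by_cases h0 : N' s = 0
    · have : N + Pi.single s 1 ≠ N' := fun hh => by simp [← hh] at h0
      rw [if_neg this, h0]
      simp
    · obtain ⟨N', rfl⟩ := exists_eq_add_single h0
      by_cases hNN : N = N'
      · subst hNN; simp
      · rw [if_neg (by simpa using hNN), if_neg (by simpa using hNN), mul_zero, mul_zero]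

/-- The Wigner function of a transition between number states, as an element of `L²`. -/
def wignerLp (N : Label M → ℕ) : Lp ℂ 2 (volume : Measure (Phase M)) :=
  (memLp_wignerSeries (rapidDecay_single N 1)).toLp _

lemma inner_toLp_wignerSeries (hT : RapidDecay T) (hT' : RapidDecay T') :
    inner ℂ ((memLp_wignerSeries hT).toLp _) ((memLp_wignerSeries hT').toLp _) =
      wignerInner T T' := by
  rw [L2.inner_def, wignerInner]
  refine integral_congr_ae ?_
  filter_upwards [(memLp_wignerSeries hT).coeFn_toLp, (memLp_wignerSeries hT').coeFn_toLp]
    with α h1 h2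
  rw [h1, h2, RCLike.inner_apply, mul_comm]

/-- Square summable superpositions of the Wigner functions of transitions converge in `L²`, since
these are orthogonal with equal norms. -/
lemma summable_smul_wignerLp (hT : Summable fun N => ‖T N‖ ^ 2) :
    Summable fun N => T N • wignerLp N := by
  set κ : ℝ := ‖wignerLp (0 : Label M → ℕ)‖ with hκ
  have hin : ∀ N N' : Label M → ℕ, inner ℂ (wignerLp N) (wignerLp N') =
      if N = N' then (κ ^ 2 : ℂ) else 0 := by
    intro N N'
    have h0 : (κ ^ 2 : ℂ) = wignerInner (Pi.single (0 : Label M → ℕ) 1) (Pi.single 0 1) := by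
      rw [← inner_toLp_wignerSeries (rapidDecay_single 0 1) (rapidDecay_single 0 1)]
      exact (inner_self_eq_norm_sq_to_K (𝕜 := ℂ) (wignerLp (0 : Label M → ℕ))).symm
    rw [h0, ← wignerInner_single]
    exact inner_toLp_wignerSeries (rapidDecay_single N 1) (rapidDecay_single N' 1)
  by_cases hκ0 : κ = 0
  · have : ∀ N : Label M → ℕ, wignerLp N = 0 := fun N => by
      have := hin N N
      rw [if_pos rfl, hκ0, Complex.ofReal_zero, zero_pow two_ne_zero, inner_self_eq_zero] at this
      exact this
    simp only [this, smul_zero]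
    exact summable_zero
  · have hκ1 : (κ : ℂ) ≠ 0 := Complex.ofReal_ne_zero.2 hκ0
    have hon : Orthonormal ℂ fun N : Label M → ℕ => (κ : ℂ)⁻¹ • wignerLp N := by
      rw [orthonormal_iff_ite]
      intro N N'
      rw [inner_smul_left, inner_smul_right, hin, map_inv₀, Complex.conj_ofReal]
      split_ifs
      · field_simp
      · simp
    have h := (hon.orthogonalFamily.summable_iff_norm_sq_summable fun N => (κ : ℂ) * T N).2 (by
      simp only [norm_mul, mul_pow]
      exact hT.mul_left _)
    refine h.congr fun N => ?_
    rw [LinearIsometry.toSpanSingleton_apply, smul_smul, mul_right_comm, mul_inv_cancel₀ hκ1,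
      one_mul]

end Orthogonality

section LimitL2

variable {D C : ℕ} {M : Fin C → ℕ} {S : Set (Space D)}
  {φ : (j : Fin C) → Fin (M j) → Space D → ℂ} {K : Kernel (MultiOcc M)}

/-- The pairs of number states with at most `R` particles each. -/
def cutoff (M : Fin C → ℕ) (R : ℕ) : Finset (Label M → ℕ) :=
  (finite_size_le (R + R)).toFinset.filter fun N =>
    totalNumber (rowOcc N) ≤ R ∧ totalNumber (colOcc N) ≤ R

lemma mem_cutoff {R : ℕ} {N : Label M → ℕ} :
    N ∈ cutoff M R ↔ totalNumber (rowOcc N) ≤ R ∧ totalNumber (colOcc N) ≤ R := by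
  rw [cutoff, Finset.mem_filter, Set.Finite.mem_toFinset, Set.mem_ofPred_eq, size_eq_totalNumber]
  omega

lemma tendsto_cutoff : Tendsto (cutoff M) atTop atTop := by
  refine tendsto_atTop_finset_of_monotone (fun R R' h N hN => ?_) fun N => ⟨size N, ?_⟩
  · rw [mem_cutoff] at hN ⊢
    exact ⟨hN.1.trans h, hN.2.trans h⟩
  · rw [mem_cutoff, size_eq_totalNumber]
    omega

lemma flatten_truncate_eq_sum (R : ℕ) (K : Kernel (MultiOcc M)) :
    flatten (truncate R K) = ∑ N ∈ cutoff M R, flatten K N • Pi.single N (1 : ℂ) := by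
  ext N
  have h : ∀ N', (flatten K N' • Pi.single N' (1 : ℂ) : (Label M → ℕ) → ℂ) N =
      if N = N' then flatten K N' else 0 := fun N' => by
    rw [Pi.smul_apply, Pi.single_apply]; split_ifs <;> simp
  simp only [Finset.sum_apply, h, Finset.sum_ite_eq, mem_cutoff]
  rfl

lemma toLp_wignerSeries_truncate (R : ℕ) (K : Kernel (MultiOcc M)) :
    (memLp_wignerSeries (rapidDecay_flatten_truncate R K)).toLp _ =
      ∑ N ∈ cutoff M R, flatten K N • wignerLp N := by
  refine Lp.ext ?_
  have h : ∀ N ∈ cutoff M R, ⇑(flatten K N • wignerLp N) =ᵐ[volume]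
      fun α => flatten K N * wignerSeries (Pi.single N 1) α := fun N _ => by
    filter_upwards [Lp.coeFn_smul (flatten K N) (wignerLp N),
      (memLp_wignerSeries (rapidDecay_single N 1)).coeFn_toLp] with α h1 h2
    rw [h1, Pi.smul_apply, wignerLp, h2, smul_eq_mul]
  have h' : ∀ᵐ α ∂(volume : Measure (Phase M)), ∀ N ∈ cutoff M R,
      (flatten K N • wignerLp N : Lp ℂ 2 _) α = flatten K N * wignerSeries (Pi.single N 1) α :=
    (ae_ball_iff (cutoff M R).countable_toSet).2 h
  filter_upwards [(memLp_wignerSeries (rapidDecay_flatten_truncate R K)).coeFn_toLp,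
    Lp.coeFn_finsetSum (cutoff M R) (fun N => flatten K N • wignerLp N), h'] with α h1 h2 h3
  rw [h1, h2, Finset.sum_apply, Finset.sum_congr rfl h3]
  conv_lhs => rw [flatten_truncate_eq_sum,
    wignerSeries_sum _ fun N _ => (rapidDecay_single N 1).smul _, Finset.sum_apply]
  simp only [wignerSeries_smul, Pi.smul_apply, smul_eq_mul]

/-- The Wigner transform of a Hilbert-Schmidt operator. -/
def wignerLimit (K : Kernel (MultiOcc M)) : Lp ℂ 2 (volume : Measure (Phase M)) :=
  ∑' N, flatten K N • wignerLp N

lemma tendsto_wignerLimit (hK : Summable fun N => ‖flatten K N‖ ^ 2) :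
    Tendsto (fun R => (memLp_wignerSeries (rapidDecay_flatten_truncate R K)).toLp _) atTop
      (𝓝 (wignerLimit K)) := by
  simp only [toLp_wignerSeries_truncate]
  exact (summable_smul_wignerLp hK).hasSum.comp tendsto_cutoff

lemma isWignerL2_wignerLimit (hφ2 : ∀ j p, MemLp (φ j p) 2 (volume.restrict S))
    (hφ : ∀ j p q, ∫ x in S, conj (φ j p x) * φ j q x = if p = q then 1 else 0)
    (hK : Summable fun N => ‖flatten K N‖ ^ 2) : IsWignerL2 S φ K (wignerLimit K) := by
  have h := (Lp.tendsto_Lp_iff_tendsto_eLpNorm' _ _).1 (tendsto_wignerLimit hK)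
  refine h.congr fun R => eLpNorm_congr_ae ?_
  filter_upwards [(memLp_wignerSeries (rapidDecay_flatten_truncate R K)).coeFn_toLp] with α h1
  rw [Pi.sub_apply, h1, wigner_eq_wignerSeries hφ2 hφ (rapidDecay_flatten_truncate R K)]

/-- For rapidly decreasing matrix elements the compressions converge pointwise, which identifies the
limit in `L²` with the integral formula. -/
lemma tendsto_wignerSeries_truncate (hK : RapidDecay (flatten K)) (α : Phase M) :
    Tendsto (fun R => wignerSeries (flatten (truncate R K)) α) atTop
      (𝓝 (wignerSeries (flatten K) α)) := by
  have h : ∀ R, wignerSeries (flatten (truncate R K)) α =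
      ∑ N ∈ cutoff M R, flatten K N * wignerElem α N := fun R => by
    rw [wignerSeries, pairing, tsum_eq_sum (s := cutoff M R)]
    · refine Finset.sum_congr rfl fun N hN => ?_
      congr 1
      exact if_pos (mem_cutoff.1 hN)
    · intro N hN
      have : flatten (truncate R K) N = 0 := if_neg (mt mem_cutoff.2 hN)
      rw [this, zero_mul]
  simp only [h]
  exact (summable_mul_wignerElem hK α).hasSum.comp tendsto_cutoff

lemma wignerLimit_ae_eq (hφ2 : ∀ j p, MemLp (φ j p) 2 (volume.restrict S))
    (hφ : ∀ j p q, ∫ x in S, conj (φ j p x) * φ j q x = if p = q then 1 else 0)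
    (hK2 : Summable fun N => ‖flatten K N‖ ^ 2) (hK : RapidDecay (flatten K)) :
    wignerLimit K =ᵐ[volume] wigner S φ K := by
  rw [wigner_eq_wignerSeries hφ2 hφ hK]
  have h1 := (Lp.tendsto_Lp_iff_tendsto_eLpNorm' _ _).1 (tendsto_wignerLimit hK2)
  have h2 := tendstoInMeasure_of_tendsto_eLpNorm (p := 2) (by norm_num)
    (fun R => (Lp.aestronglyMeasurable _)) (Lp.aestronglyMeasurable _) h1
  obtain ⟨ns, hns, h3⟩ := h2.exists_seq_tendsto_ae
  have h4 : ∀ᵐ α ∂(volume : Measure (Phase M)), ∀ R,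
      (memLp_wignerSeries (rapidDecay_flatten_truncate R K)).toLp _ α =
        wignerSeries (flatten (truncate R K)) α :=
    ae_all_iff.2 fun R => (memLp_wignerSeries (rapidDecay_flatten_truncate R K)).coeFn_toLp
  filter_upwards [h3, h4] with α h3 h4
  simp only [h4] at h3
  exact tendsto_nhds_unique h3 ((tendsto_wignerSeries_truncate hK α).comp hns.tendsto_atTop)

lemma matrixElements_apply (A : Fock M →L[ℂ] Fock M) (m n : MultiOcc M) :
    matrixElements A m n = A (numberState n) m := by
  rw [matrixElements, numberState, lp.inner_single_left]
  simp

lemma IsHilbertSchmidt.summable_flatten {A : Fock M →L[ℂ] Fock M} (hA : IsHilbertSchmidt A) :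
    Summable fun N => ‖flatten (matrixElements A) N‖ ^ 2 := by
  have h1 : ∀ n : MultiOcc M, HasSum (fun m => ‖matrixElements A m n‖ ^ 2)
      (‖A (numberState n)‖ ^ 2) := fun n => by
    have := lp.hasSum_norm (p := 2) (by norm_num) (A (numberState n))
    simp only [matrixElements_apply]
    simpa using this
  have h2 : Summable fun q : MultiOcc M × MultiOcc M => ‖matrixElements A q.2 q.1‖ ^ 2 := by
    rw [summable_prod_of_nonneg fun _ => by positivity]
    exact ⟨fun n => (h1 n).summable, hA.congr fun n => ((h1 n).tsum_eq).symm⟩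
  rw [← (occEquiv.trans (Equiv.prodComm _ _)).summable_iff] at h2
  exact h2

end LimitL2

/-! ### Ladder operators on tempered distributions -/

section Distributions

variable {C : ℕ} {M : Fin C → ℕ} {T : (Label M → ℕ) → ℂ}

/-- The Wigner function of a rapidly decreasing operator, as a tempered distribution. -/
def wignerDist (hT : RapidDecay T) : 𝓢'(Phase M, ℂ) :=
  SchwartzMap.toTemperedDistributionCLM (Phase M) ℂ volume (wignerSchwartz hT)

lemma wignerDist_apply (hT : RapidDecay T) (f : 𝓢(Phase M, ℂ)) :
    wignerDist hT f = ∫ α, f α * wignerSeries T α :=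
  SchwartzMap.toTemperedDistributionCLM_apply_apply volume (wignerSchwartz hT) f

/-- A continuous operation `Φ` on tempered distributions that maps the Wigner function of `T` to the
Wigner function of `A T`. -/
structure Represents (Φ : 𝓢'(Phase M, ℂ) → 𝓢'(Phase M, ℂ))
    (A : Module.End ℂ ((Label M → ℕ) → ℂ)) : Prop where
  preserves : PreservesRapidDecay A
  continuous : Continuous Φ
  apply_wignerDist : ∀ (T : (Label M → ℕ) → ℂ) (hT : RapidDecay T),
    Φ (wignerDist hT) = wignerDist (preserves T hT)

namespace Represents

variable {Φ Ψ : 𝓢'(Phase M, ℂ) → 𝓢'(Phase M, ℂ)} {A B : Module.End ℂ ((Label M → ℕ) → ℂ)}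

lemma of_wignerSchwartz (hA : PreservesRapidDecay A) (hΦ : Continuous Φ)
    (h : ∀ (T : (Label M → ℕ) → ℂ) (hT : RapidDecay T), ∃ g : 𝓢(Phase M, ℂ),
      Φ (wignerDist hT) = SchwartzMap.toTemperedDistributionCLM (Phase M) ℂ volume g ∧
        ∀ α, g α = wignerSeries (A T) α) : Represents Φ A :=
  ⟨hA, hΦ, fun T hT => by
    obtain ⟨g, h1, h2⟩ := h T hT
    rw [h1, wignerDist]
    congr 1
    ext α
    exact h2 α⟩

lemma id : Represents (fun u => u) (1 : Module.End ℂ ((Label M → ℕ) → ℂ)) :=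
  ⟨.one, continuous_id, fun _ _ => rfl⟩

lemma add (hΦ : Represents Φ A) (hΨ : Represents Ψ B) :
    Represents (fun u => Φ u + Ψ u) (A + B) :=
  of_wignerSchwartz (hΦ.preserves.add hΨ.preserves) (hΦ.continuous.add hΨ.continuous)
    fun T hT => ⟨wignerSchwartz (hΦ.preserves T hT) + wignerSchwartz (hΨ.preserves T hT), by
      rw [hΦ.apply_wignerDist, hΨ.apply_wignerDist, map_add]; rfl, fun α => by
      rw [LinearMap.add_apply, wignerSeries_add (hΦ.preserves T hT) (hΨ.preserves T hT)]; rfl⟩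

lemma smul (c : ℂ) (hΦ : Represents Φ A) : Represents (fun u => c • Φ u) (c • A) :=
  of_wignerSchwartz (hΦ.preserves.smul c) (hΦ.continuous.const_smul c)
    fun T hT => ⟨c • wignerSchwartz (hΦ.preserves T hT), by
      rw [hΦ.apply_wignerDist, map_smul]; rfl, fun α => by
      rw [LinearMap.smul_apply, wignerSeries_smul]; rfl⟩

lemma sub (hΦ : Represents Φ A) (hΨ : Represents Ψ B) :
    Represents (fun u => Φ u - Ψ u) (A - B) := by
  have h := hΦ.add (hΨ.smul (-1))
  have e : (fun u => Φ u - Ψ u) = fun u => Φ u + (-1 : ℂ) • Ψ u :=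
    funext fun u => (sub_eq_add_neg _ _).trans (congrArg _ (neg_one_smul ℂ (Ψ u)).symm)
  rw [e, sub_eq_add_neg, ← neg_one_smul ℂ B]
  exact h

lemma mul (hΦ : Represents Φ A) (hΨ : Represents Ψ B) :
    Represents (fun u => Φ (Ψ u)) (A * B) :=
  ⟨hΦ.preserves.mul hΨ.preserves, hΦ.continuous.comp hΨ.continuous, fun T hT => by
    rw [hΨ.apply_wignerDist, hΦ.apply_wignerDist]⟩

lemma zero : Represents (fun _ => 0) (0 : Module.End ℂ ((Label M → ℕ) → ℂ)) := by
  have h := (id (M := M)).smul 0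
  have e : (fun _ => 0 : 𝓢'(Phase M, ℂ) → 𝓢'(Phase M, ℂ)) = fun u => (0 : ℂ) • u :=
    funext fun u => (zero_smul ℂ u).symm
  rw [e, ← zero_smul ℂ (1 : Module.End ℂ ((Label M → ℕ) → ℂ))]
  exact h

lemma sum {κ : Type*} (s : Finset κ) {Φ : κ → 𝓢'(Phase M, ℂ) → 𝓢'(Phase M, ℂ)}
    {A : κ → Module.End ℂ ((Label M → ℕ) → ℂ)} (h : ∀ t, Represents (Φ t) (A t)) :
    Represents (fun u => ∑ t ∈ s, Φ t u) (∑ t ∈ s, A t) := by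
  classical
  induction s using Finset.induction_on with
  | empty => simpa using zero
  | insert a s ha ih =>
    simp only [Finset.sum_insert ha]
    exact (h a).add ih

lemma mulDist {g : Phase M → ℂ} (hg : g.HasTemperateGrowth) (hA : PreservesRapidDecay A)
    (h : ∀ (T : (Label M → ℕ) → ℂ), RapidDecay T →
      (fun α => g α * wignerSeries T α) = wignerSeries (A T)) :
    Represents (mulDist g) A :=
  ⟨hA, (TemperedDistribution.smulLeftCLM ℂ g).continuous, fun T hT => by
    ext f
    rw [FunctionalWigner.mulDist, TemperedDistribution.smulLeftCLM_apply_apply, wignerDist_apply,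
      wignerDist_apply, ← h T hT]
    refine integral_congr_ae (Eventually.of_forall fun α => ?_)
    simp only [SchwartzMap.smulLeftCLM_apply_apply hg, smul_eq_mul]
    ring⟩

lemma wirtinger (c : ℂ) (i : Mode M) : Represents (fun u : 𝓢'(Phase M, ℂ) => (c / 2) •
    (∂_{(modeVec i.1 i.2 1 : Phase M)} u -
      Complex.I • ∂_{(modeVec i.1 i.2 Complex.I : Phase M)} u)) (c • derivOp i) := by
  refine of_wignerSchwartz ((PreservesRapidDecay.derivOp i).smul c) ?_ fun T hT =>
    ⟨(c / 2) • (∂_{(modeVec i.1 i.2 1 : Phase M)} (wignerSchwartz hT) -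
      Complex.I • ∂_{(modeVec i.1 i.2 Complex.I : Phase M)} (wignerSchwartz hT)), ?_, fun α => ?_⟩
  · have hc : ∀ v : Phase M, Continuous fun u : 𝓢'(Phase M, ℂ) => ∂_{v} u :=
      LineDeriv.continuous_lineDerivOp
    exact ((hc _).sub ((hc _).const_smul Complex.I)).const_smul (c / 2)
  · simp only [wignerDist, TemperedDistribution.lineDerivOp_toTemperedDistributionCLM_eq, map_smul,
      map_sub]
  · rw [LinearMap.smul_apply, wignerSeries_smul, Pi.smul_apply, smul_eq_mul,
      ← (hasWirtinger_wignerSeries hT α).wirtinger_eq i, FunctionalWigner.wirtinger]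
    simp only [SchwartzMap.smul_apply, SchwartzMap.sub_apply, SchwartzMap.lineDerivOp_apply,
      smul_eq_mul]
    change c / 2 * (lineDeriv ℝ (wignerSeries T) _ _ - _ * lineDeriv ℝ (wignerSeries T) _ _) = _
    ring

lemma wirtingerBar (c : ℂ) (i : Mode M) : Represents (fun u : 𝓢'(Phase M, ℂ) => (c / 2) •
    (∂_{(modeVec i.1 i.2 1 : Phase M)} u +
      Complex.I • ∂_{(modeVec i.1 i.2 Complex.I : Phase M)} u)) (c • derivBarOp i) := by
  refine of_wignerSchwartz ((PreservesRapidDecay.derivBarOp i).smul c) ?_ fun T hT =>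
    ⟨(c / 2) • (∂_{(modeVec i.1 i.2 1 : Phase M)} (wignerSchwartz hT) +
      Complex.I • ∂_{(modeVec i.1 i.2 Complex.I : Phase M)} (wignerSchwartz hT)), ?_, fun α => ?_⟩
  · have hc : ∀ v : Phase M, Continuous fun u : 𝓢'(Phase M, ℂ) => ∂_{v} u :=
      LineDeriv.continuous_lineDerivOp
    exact ((hc _).add ((hc _).const_smul Complex.I)).const_smul (c / 2)
  · simp only [wignerDist, TemperedDistribution.lineDerivOp_toTemperedDistributionCLM_eq, map_smul,
      map_add]
  · rw [LinearMap.smul_apply, wignerSeries_smul, Pi.smul_apply, smul_eq_mul,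
      ← (hasWirtinger_wignerSeries hT α).wirtingerBar_eq i, FunctionalWigner.wirtingerBar]
    simp only [SchwartzMap.smul_apply, SchwartzMap.add_apply, SchwartzMap.lineDerivOp_apply,
      smul_eq_mul]
    change c / 2 * (lineDeriv ℝ (wignerSeries T) _ _ + _ * lineDeriv ℝ (wignerSeries T) _ _) = _
    ring

lemma exists_coordOp (i : Mode M) : ∃ Φ, Represents Φ (coordOp i) :=
  ⟨_, mulDist (coord i).hasTemperateGrowth (.coordOp i) fun _ hT =>
    funext fun α => (wignerSeries_coordOp hT i α).symm⟩

lemma exists_coordBarOp (i : Mode M) : ∃ Φ, Represents Φ (coordBarOp i) :=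
  ⟨_, mulDist (coordBar i).hasTemperateGrowth (.coordBarOp i) fun _ hT =>
    funext fun α => (wignerSeries_coordBarOp hT i α).symm⟩

/-- Annihilation operators are combinations of multiplication by an amplitude and differentiation,
for instance `a T = α T + (1 / 2) ∂/∂α^* T`, hence continuous on tempered distributions. -/
lemma exists_lower (s : Label M) : ∃ Φ, Represents Φ (lower s) := by
  cases s with
  | inl i =>
    obtain ⟨Φ, h⟩ := exists_coordOp i
    have h1 : lower (Sum.inl i) = coordOp i + (1 / 2 : ℂ) • derivBarOp i := by
      simp only [coordOp, derivBarOp]; module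
    rw [h1]
    exact ⟨_, h.add (wirtingerBar (1 / 2) i)⟩
  | inr i =>
    obtain ⟨Φ, h⟩ := exists_coordBarOp i
    have h1 : lower (Sum.inr i) = coordBarOp i + (1 / 2 : ℂ) • derivOp i := by
      simp only [coordBarOp, derivOp]; module
    rw [h1]
    exact ⟨_, h.add (wirtinger (1 / 2) i)⟩

lemma exists_raise (s : Label M) : ∃ Φ, Represents Φ (raise s) := by
  cases s with
  | inl i =>
    obtain ⟨Φ, h⟩ := exists_coordBarOp i
    have h1 : raise (Sum.inl i) = coordBarOp i + (-1 / 2 : ℂ) • derivOp i := by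
      simp only [coordBarOp, derivOp]; module
    rw [h1]
    exact ⟨_, h.add (wirtinger (-1 / 2) i)⟩
  | inr i =>
    obtain ⟨Φ, h⟩ := exists_coordOp i
    have h1 : raise (Sum.inr i) = coordOp i + (-1 / 2 : ℂ) • derivBarOp i := by
      simp only [coordOp, derivBarOp]; module
    rw [h1]
    exact ⟨_, h.add (wirtingerBar (-1 / 2) i)⟩

lemma exists_quad {j k : Fin C} (t : Quad M j k) :
    ∃ Φ, Represents Φ (leftQuad t - rightQuad t) := by
  choose L hL using exists_lower (M := M)
  choose R hR using exists_raise (M := M)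
  exact ⟨_, ((((hR _).mul (hR _)).mul (hL _)).mul (hL _)).sub
    ((((hR _).mul (hR _)).mul (hL _)).mul (hL _))⟩

end Represents

variable {D : ℕ} (φ : (j : Fin C) → Fin (M j) → Space D → ℂ) (j k : Fin C) (x : Space D)

lemma represents_funDerivDist : Represents (funDerivDist φ j x) (funDerivOp φ j x) :=
  Represents.sum _ fun p => Represents.wirtinger (conj (φ j p x)) ⟨j, p⟩

lemma represents_funDerivBarDist : Represents (funDerivBarDist φ j x) (funDerivBarOp φ j x) :=
  Represents.sum _ fun p => Represents.wirtingerBar (φ j p x) ⟨j, p⟩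

lemma hasTemperateGrowth_psi : (psi φ j x).HasTemperateGrowth := by
  have h : psi φ j x = fun α => ∑ p, φ j p x * coord ⟨j, p⟩ α := rfl
  rw [h]
  exact .sum fun p _ => .mul (.const _) (coord _).hasTemperateGrowth

lemma hasTemperateGrowth_psiBar : (psiBar φ j x).HasTemperateGrowth := by
  have h : psiBar φ j x = fun α => ∑ p, conj (φ j p x) * coordBar ⟨j, p⟩ α := by
    ext α
    simp [psiBar, psi, compose]
  rw [h]
  exact .sum fun p _ => .mul (.const _) (coordBar _).hasTemperateGrowth

lemma represents_drift : Represents (mulDist (drift φ j k x)) (driftOp φ j k x) := by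
  refine .mulDist ?_ (.driftOp φ j k x) fun T hT => drift_mul_wignerSeries φ j k x hT
  have hj := hasTemperateGrowth_psi φ j x
  have hk := hasTemperateGrowth_psi φ k x
  have hb := hasTemperateGrowth_psiBar φ k x
  exact ((hj.mul hk).mul hb).neg.add
    (.mul (.const _) ((Function.HasTemperateGrowth.const _).mul hk |>.add hj))

lemma represents_driftBar : Represents (mulDist (driftBar φ j k x)) (driftBarOp φ j k x) := by
  refine .mulDist ?_ (.driftBarOp φ j k x) fun T hT => driftBar_mul_wignerSeries φ j k x hT
  have hj := hasTemperateGrowth_psiBar φ j x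
  have hk := hasTemperateGrowth_psi φ k x
  have hb := hasTemperateGrowth_psiBar φ k x
  exact ((hj.mul hk).mul hb).sub
    (.mul (.const _) ((Function.HasTemperateGrowth.const _).mul hb |>.add hj))

lemma represents_quarter_psi :
    Represents (mulDist fun β => 1 / 4 * psi φ j x β) ((1 / 4 : ℂ) • psiOp φ j x) :=
  .mulDist (.mul (.const _) (hasTemperateGrowth_psi φ j x))
    ((PreservesRapidDecay.psiOp φ j x).smul _)
    fun _ hT => quarter_psi_mul_wignerSeries φ j x hT

lemma represents_quarter_psiBar :
    Represents (mulDist fun β => 1 / 4 * psiBar φ j x β) ((1 / 4 : ℂ) • psiBarOp φ j x) :=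
  .mulDist (.mul (.const _) (hasTemperateGrowth_psiBar φ j x))
    ((PreservesRapidDecay.psiBarOp φ j x).smul _)
    fun _ hT => quarter_psiBar_mul_wignerSeries φ j x hT

lemma represents_wignerGeneratorDist :
    Represents (wignerGeneratorDist φ j k x) (generatorOp φ j k x) := by
  have hP := fun j => represents_funDerivDist φ j x
  have hPb := fun j => represents_funDerivBarDist φ j x
  have hd := fun j k => represents_drift φ j k x
  have hdb := fun j k => represents_driftBar φ j k x
  have hx := fun j => represents_quarter_psi φ j x
  have hxb := fun j => represents_quarter_psiBar φ j x
  exact ((((((((hP j).mul (hd j k)).add ((hPb j).mul (hdb j k))).add ((hP k).mul (hd k j))).add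
    ((hPb k).mul (hdb k j))).add ((hP j).mul ((hPb j).mul ((hP k).mul (hx k))))).sub
    ((hP j).mul ((hPb j).mul ((hPb k).mul (hxb k))))).add
    ((hP k).mul ((hPb k).mul ((hP j).mul (hx j))))).sub
    ((hP k).mul ((hPb k).mul ((hPb j).mul (hxb j))))

lemma wignerDist_eq_toLp (hT : RapidDecay T) :
    wignerDist hT =
      (((memLp_wignerSeries hT).toLp _ : Lp ℂ 2 (volume : Measure (Phase M))) :
        𝓢'(Phase M, ℂ)) := by
  ext f
  rw [wignerDist_apply, Lp.toTemperedDistribution_apply]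
  refine integral_congr_ae ?_
  filter_upwards [(memLp_wignerSeries hT).coeFn_toLp] with α h
  rw [h, smul_eq_mul]

variable {K : Kernel (MultiOcc M)}

/-- The Wigner transform of a Hilbert-Schmidt operator as a limit in the sense of distributions;
the operations on distributions commute with it. -/
lemma Represents.tendsto {Φ : 𝓢'(Phase M, ℂ) → 𝓢'(Phase M, ℂ)}
    {A : Module.End ℂ ((Label M → ℕ) → ℂ)} (hΦ : Represents Φ A)
    (hK : Summable fun N => ‖flatten K N‖ ^ 2) (f : 𝓢(Phase M, ℂ)) :
    Tendsto (fun R => ∫ α, f α * wignerSeries (A (flatten (truncate R K))) α) atTop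
      (𝓝 (Φ (wignerLimit K : 𝓢'(Phase M, ℂ)) f)) := by
  have h1 := ((Lp.toTemperedDistributionCLM ℂ (volume : Measure (Phase M)) 2).continuous.tendsto
    _).comp (tendsto_wignerLimit hK)
  have h2 := ((PointwiseConvergenceCLM.evalCLM (RingHom.id ℂ) ℂ f).continuous.comp
    hΦ.continuous).tendsto _ |>.comp h1
  refine h2.congr fun R => ?_
  rw [← wignerDist_apply (hΦ.preserves _ (rapidDecay_flatten_truncate R K)),
    ← hΦ.apply_wignerDist _ (rapidDecay_flatten_truncate R K),
    wignerDist_eq_toLp (rapidDecay_flatten_truncate R K)]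
  rfl

variable {S : Set (Space D)} {φ j k}

/-- The formula for Hilbert-Schmidt operators, in the sense of distributions. -/
lemma exists_isWignerDist (hφ2 : ∀ j p, MemLp (φ j p) 2 (volume.restrict S))
    (hφ4 : ∀ j p, MemLp (φ j p) 4 (volume.restrict S))
    (hφ : ∀ j p q, ∫ x in S, conj (φ j p x) * φ j q x = if p = q then 1 else 0)
    (hK : Summable fun N => ‖flatten K N‖ ^ 2) :
    ∃ u : 𝓢'(Phase M, ℂ), IsWignerDist S φ (opComm (interaction S φ j k) K) u ∧
      ∀ f : 𝓢(Phase M, ℂ),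
        IntegrableOn (fun x => wignerGeneratorDist φ j k x (wignerLimit K : 𝓢'(Phase M, ℂ)) f) S ∧
        u f = ∫ x in S, wignerGeneratorDist φ j k x (wignerLimit K : 𝓢'(Phase M, ℂ)) f := by
  choose Φ hΦ using fun t : Quad M j k => Represents.exists_quad t
  have hsum : ∀ c : Quad M j k → ℂ, Represents (fun u => ∑ t, c t • Φ t u) (commOp c) :=
    fun c => Represents.sum _ fun t => (hΦ t).smul (c t)
  have happ : ∀ (c : Quad M j k → ℂ) (v : 𝓢'(Phase M, ℂ)) (f : 𝓢(Phase M, ℂ)),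
      (∑ t, c t • Φ t v) f = ∑ t, c t * Φ t v f := fun c v f => by
    exact map_sum (PointwiseConvergenceCLM.evalCLM (RingHom.id ℂ) ℂ f) _ _
  have hgen : ∀ (x : Space D) (f : 𝓢(Phase M, ℂ)),
      wignerGeneratorDist φ j k x (wignerLimit K : 𝓢'(Phase M, ℂ)) f =
        ∑ t, quadCoeff φ x t * Φ t (wignerLimit K : 𝓢'(Phase M, ℂ)) f := fun x f => by
    have h1 := (represents_wignerGeneratorDist φ j k x).tendsto hK f
    rw [generatorOp_eq_commOp] at h1
    rw [← happ]
    exact tendsto_nhds_unique h1 ((hsum (quadCoeff φ x)).tendsto hK f)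
  refine ⟨∑ t, (∫ x in S, quadCoeff φ x t) • Φ t (wignerLimit K : 𝓢'(Phase M, ℂ)),
    fun f => ?_, fun f => ?_⟩
  · refine ((hsum fun t => ∫ x in S, quadCoeff φ x t).tendsto hK f).congr fun R => ?_
    rw [← flatten_truncate_opComm hφ4,
      ← wigner_eq_wignerSeries hφ2 hφ (rapidDecay_flatten_truncate R _)]
  · have hi := fun t : Quad M j k => (integrable_quadCoeff hφ4 t).mul_const
      (Φ t (wignerLimit K : 𝓢'(Phase M, ℂ)) f)
    simp only [hgen]
    refine ⟨integrable_finsetSum _ fun t _ => hi t, ?_⟩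
    rw [happ, integral_finsetSum _ fun t _ => hi t]
    simp only [integral_mul_const]

end Distributions

end FunctionalWigner

end

open FunctionalWigner in
theorem mainTheorem4 {D C : ℕ} (M : Fin C → ℕ)
    (S : Set (Space D)) (hS : MeasurableSet S)
    (φ : (j : Fin C) → Fin (M j) → Space D → ℂ)
    (hφ2 : ∀ j p, MemLp (φ j p) 2 (volume.restrict S))
    (hφ4 : ∀ j p, MemLp (φ j p) 4 (volume.restrict S))
    (hφ : ∀ j p q, ∫ x in S, conj (φ j p x) * φ j q x = if p = q then 1 else 0)
    (j k : Fin C) (A : Fock M →L[ℂ] Fock M) :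
    (RapidlyDecreasing (matrixElements A) →
      WignerConverges S φ (matrixElements A) ∧
      WignerConverges S φ (opComm (interaction S φ j k) (matrixElements A)) ∧
      ContDiff ℝ ∞ (wigner S φ (matrixElements A)) ∧
      ∀ α : Phase M,
        IntegrableOn (fun x => wignerGenerator φ j k x (wigner S φ (matrixElements A)) α) S ∧
        wigner S φ (opComm (interaction S φ j k) (matrixElements A)) α =
          ∫ x in S, wignerGenerator φ j k x (wigner S φ (matrixElements A)) α) ∧
    (IsHilbertSchmidt A →
      ∃ (w : Lp ℂ 2 (volume : Measure (Phase M))) (u : 𝓢'(Phase M, ℂ)),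
        IsWignerL2 S φ (matrixElements A) w ∧
        (RapidlyDecreasing (matrixElements A) → w =ᵐ[volume] wigner S φ (matrixElements A)) ∧
        IsWignerDist S φ (opComm (interaction S φ j k) (matrixElements A)) u ∧
        ∀ f : 𝓢(Phase M, ℂ),
          IntegrableOn (fun x => wignerGeneratorDist φ j k x (w : 𝓢'(Phase M, ℂ)) f) S ∧
          u f = ∫ x in S, wignerGeneratorDist φ j k x (w : 𝓢'(Phase M, ℂ)) f) := by
  refine ⟨fun hA => ?_, fun hA => ?_⟩
  · have hK := hA.flatten
    refine ⟨wignerConverges_of_rapidDecay hφ2 hφ hK, wignerConverges_of_rapidDecay hφ2 hφ ?_, ?_,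
      wigner_opComm_interaction hφ2 hφ4 hφ hK⟩
    · rw [flatten_opComm_interaction hφ4]
      exact PreservesRapidDecay.commOp _ _ hK
    · rw [wigner_eq_wignerSeries hφ2 hφ hK]
      exact contDiff_wignerSeries hK
  · have hK := hA.summable_flatten
    obtain ⟨u, hu, huf⟩ := exists_isWignerDist hφ2 hφ4 hφ hK
    exact ⟨wignerLimit (matrixElements A), u, isWignerL2_wignerLimit hφ2 hφ hK,
      fun hR => wignerLimit_ae_eq hφ2 hφ hK hR.flatten, hu, huf⟩
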